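/- Let $k$ be a field; all algebras are associative unital $k$-algebras, and "noetherian" means left and right noetherian. For $w\ge 0$ let $A$ be a $\mathbb Z^w$-graded algebra and let $\mathcal D^b(A\text{-}\mathrm{Gr})$ be the bounded derived category of $\mathbb Z^w$-graded left $A$-modules. An object $X$ of it is an *$\epsilon$-object* if it is perfect (isomorphic in the derived category to a bounded complex of finitely generated projective graded modules) and $\dim_k H^n(X)<\infty$ for all $n\in\mathbb Z$. Let $\mathcal D_\epsilon(A)$ be the full subcategory of $\epsilon$-objects. We say that $A$, or $(A,\mathbb Z^w)$, satisfies the *$\epsilon$-condition* if $\mathcal D_\epsilon(A)\ne 0$. The algebra $A$ is $\mathbb N^w$-graded if $A_r\neq 0$ only for $r\in\mathbb N^w$; an $\mathbb N^w$-graded algebra is *connected* if $A_0=k$ (in particular $A\neq 0$), and *locally finite* if all $\dim_k A_r<\infty$. A commutative algebra is *affine* if it is finitely generated as a $k$-algebra. A connected locally finite $\mathbb N$-graded algebra $A$ is *AS regular* if it has finite global dimension and there are $d\ge 0$ and $l\in\mathbb Z$ such that $A$ has injective dimension $d$ as a left $A$-module, $\mathrm{Ext}^d_A(k,A)\cong k(l)$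 as graded modules, and $\mathrm{Ext}^i_A(k,A)=0$ for $i\ne d$, where $k=A/A_{\ge1}$. If $\sigma_1,\dots,\sigma_w$ are pairwise commuting graded automorphisms of the $\mathbb Z^w$-graded algebra $A$ and $\sigma^r=\sigma_1^{r_1}\cdots\sigma_w^{r_w}$, the *graded twist* $A^{\tilde\sigma}$ is the graded vector space $A$ with the multiplication $a\star b=\sigma^{|b|}(a)\,b$ for $b$ homogeneous of degree $|b|$. (1) Let $A$ be a noetherian $\mathbb Z^w$-graded algebra of finite global dimension. If there is a nonzero finite-dimensional graded left $A$-module, then $A$ satisfies the $\epsilon$-condition. As a consequence, every connected graded noetherian AS regular algebra satisfies the $\epsilon$-condition. (2) Let $A$ be $\mathbb Z^w$-graded and let $\phi:\mathbb Z^w\to\mathbb Z^n$ be a group homomorphism. Then $A$ is also $\mathbb Z^n$-graded, by $A_r=\bigoplus_{\phi(s)=r}A_s$, and if $(A,\mathbb Z^w)$ satisfies the $\epsilon$-condition, then so does $(A,\mathbb Z^n)$. (3) Let $w>0$ and let $A$ be connected $\mathbb N^w$-graded and right noetherian, satisfying the $\epsilon$-condition. If $B\ne 0$ is a $\mathbb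 Z^w$-graded algebra and there is a $\mathbb Z^w$-graded algebra map $A\to B$ such that $B$ is finitely generated as a right $A$-module, then $(B,\mathbb Z^w)$ satisfies the $\epsilon$-condition. As a consequence, every affine connected $\mathbb N^w$-graded commutative algebra satisfies the $\epsilon$-condition. (4) If $B\neq0$ is locally finite $\mathbb N$-graded, its center is affine, and $B$ is a finitely generated module over its center, then $B$ satisfies the $\epsilon$-condition. (5) Let $A$ and $B$ be connected $\mathbb N$-graded, and suppose that $A\otimes_k B$ is noetherian. Then the following are equivalent: (i) $(A\otimes_kB,\mathbb Z^2)$, with $(A\otimes_k B)_{(i,j)}=A_i\otimes B_j$, satisfies the $\epsilon$-condition; (ii) $(A\otimes_kB,\mathbb Z)$, with the total degree, satisfies the $\epsilon$-condition; (iii) both $(A,\mathbb Z)$ and $(B,\mathbb Z)$ satisfy the $\epsilon$-condition. As a consequence, if $A$ is connected $\mathbb N$-graded and noetherian and $t$ is a central indeterminate of positive degree $e$, then $A$ satisfies the $\epsilon$-condition if and only if $A[t]$ does, either as a $\mathbb Z^2$-graded algebra ($|t|=(0,e)$, $|a|=(i,0)$ for $a\in A_i$) or as a $\mathbb Z$-graded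 algebra (with the total degree). (6) A $\mathbb Z^w$-graded algebra $A$ satisfies the $\epsilon$-condition if and only if any given graded twist $A^{\tilde\sigma}$ of it does. -/

import Mathlib

open CategoryTheory CategoryTheory.Limits
open scoped TensorProduct DirectSum

universe u

noncomputable section

/-! ### Graded modules -/

section GradedModules

variable {k A : Type u} {ι : Type} [Field k] [Ring A] [Algebra k A] [AddCommGroup ι]
  [DecidableEq ι]

/-- A graded left module over the `k`-algebra `A` graded by `𝒜`. -/
structure GrMod (𝒜 : ι → Submodule k A) where
  /-- the underlying left `A`-module -/
  carrier : Type u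
  [addCommGroup : AddCommGroup carrier]
  [moduleBase : Module k carrier]
  [module : Module A carrier]
  [isScalarTower : IsScalarTower k A carrier]
  /-- the homogeneous components -/
  deg : ι → Submodule k carrier
  isInternal : DirectSum.IsInternal deg
  smul_mem : ∀ {i j : ι} {a : A} {m : carrier}, a ∈ 𝒜 i → m ∈ deg j → a • m ∈ deg (i + j)

attribute [instance] GrMod.addCommGroup GrMod.moduleBase GrMod.module GrMod.isScalarTower

/-- A family of subspaces that admits a compatible family of projections is a grading. -/
theorem isInternal_of_proj {k : Type u} {ι : Type} [Field k] [DecidableEq ι] {V : Type u} [AddCommGroup V] [Module k V] (D : ι → Submodule k V)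
    (p : ι → V →ₗ[k] V) (h₁ : ∀ i, ∀ v ∈ D i, p i v = v)
    (h₂ : ∀ i j, i ≠ j → ∀ v ∈ D i, p j v = 0) (h₃ : ⨆ i, D i = ⊤) :
    DirectSum.IsInternal D := by
  rw [DirectSum.isInternal_submodule_iff_iSupIndep_and_iSup_eq_top]
  refine ⟨fun i => ?_, h₃⟩
  rw [Submodule.disjoint_def]
  intro x hx hx'
  rw [← h₁ i x hx]
  have : (⨆ j, ⨆ (_ : j ≠ i), D j) ≤ LinearMap.ker (p i) :=
    iSup₂_le fun j hj v hv => h₂ j i hj v hv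
  exact this hx'

variable {𝒜 : ι → Submodule k A}

namespace GrMod

instance (M : GrMod 𝒜) : SMulCommClass A k M.carrier := IsScalarTower.to_smulCommClass'

/-- The decomposition of a graded module into its components. -/
def decomp (M : GrMod 𝒜) : M.carrier ≃ₗ[k] ⨁ i, M.deg i :=
  (LinearEquiv.ofBijective (DirectSum.coeLinearMap M.deg)
    (show Function.Bijective (DirectSum.coeLinearMap M.deg) from M.isInternal)).symm

/-- The projection of a graded module onto its component of degree `i`. -/
def proj (M : GrMod 𝒜) (i : ι) : M.carrier →ₗ[k] M.carrier :=
  (M.deg i).subtype ∘ₗ DirectSum.component k ι (fun i => M.deg i) i ∘ₗ M.decomp.toLinearMap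

theorem proj_mem (M : GrMod 𝒜) (i : ι) (m : M.carrier) : M.proj i m ∈ M.deg i :=
  Subtype.property _

theorem decomp_of_mem (M : GrMod 𝒜) {i : ι} {m : M.carrier} (hm : m ∈ M.deg i) :
    M.decomp m = DirectSum.lof k ι (fun i => M.deg i) i ⟨m, hm⟩ := by
  rw [decomp, LinearEquiv.symm_apply_eq]
  simp

theorem proj_same (M : GrMod 𝒜) {i : ι} {m : M.carrier} (hm : m ∈ M.deg i) :
    M.proj i m = m := by
  simp [proj, M.decomp_of_mem hm]

theorem proj_ne (M : GrMod 𝒜) {i j : ι} (hij : i ≠ j) {m : M.carrier} (hm : m ∈ M.deg i) :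
    M.proj j m = 0 := by
  simp [proj, M.decomp_of_mem hm, DirectSum.component.of, hij]

theorem iSup_deg (M : GrMod 𝒜) : ⨆ i, M.deg i = ⊤ := M.isInternal.submodule_iSup_eq_top

theorem hom_ext_deg (M : GrMod 𝒜) {W : Type u} [AddCommGroup W] [Module k W]
    {f g : M.carrier →ₗ[k] W} (h : ∀ i, ∀ m ∈ M.deg i, f m = g m) : f = g := by
  have : (⊤ : Submodule k M.carrier) ≤ LinearMap.eqLocus f g := by
    rw [← M.iSup_deg]
    exact iSup_le fun i m hm => h i m hm
  ext m
  exact this (Submodule.mem_top (x := m))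

/-- An element lies in every subspace that contains all its components. -/
theorem mem_of_proj_mem (M : GrMod 𝒜) (S : Submodule k M.carrier) (m : M.carrier)
    (h : ∀ i, M.proj i m ∈ S) : m ∈ S := by
  classical
  obtain ⟨x, rfl⟩ := M.decomp.symm.surjective m
  have hx : ∀ i, M.proj i (M.decomp.symm x) = x i := by
    intro i
    simp only [proj, LinearMap.comp_apply, LinearEquiv.coe_coe, LinearEquiv.apply_symm_apply]
    rfl
  change DirectSum.coeLinearMap M.deg x ∈ S
  rw [DirectSum.coeLinearMap_eq_dfinsuppSum]
  exact Submodule.dfinsuppSum_mem _ _ _ fun i _ => hx i ▸ h i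

/-- The graded homomorphisms of degree zero, as a subspace of all `A`-linear maps. -/
def homs (M N : GrMod 𝒜) : Submodule k (M.carrier →ₗ[A] N.carrier) where
  carrier := {f | ∀ i, ∀ m ∈ M.deg i, f m ∈ N.deg i}
  add_mem' hf hg i m hm := add_mem (hf i m hm) (hg i m hm)
  zero_mem' i _ _ := zero_mem (N.deg i)
  smul_mem' c _ hf i m hm := (N.deg i).smul_mem c (hf i m hm)

instance : Category (GrMod 𝒜) where
  Hom M N := homs M N
  id M := ⟨LinearMap.id, fun _ _ hm => hm⟩
  comp f g := ⟨g.1 ∘ₗ f.1, fun i m hm => g.2 i _ (f.2 i m hm)⟩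

/-- The linear map underlying a morphism. -/
def lin {M N : GrMod 𝒜} (f : M ⟶ N) : M.carrier →ₗ[A] N.carrier :=
  Subtype.val (p := (· ∈ homs M N)) f

/-- The morphism with a given underlying linear map. -/
def ofLin {M N : GrMod 𝒜} (f : M.carrier →ₗ[A] N.carrier)
    (hf : ∀ i, ∀ m ∈ M.deg i, f m ∈ N.deg i) : M ⟶ N := (⟨f, hf⟩ : homs M N)

theorem lin_mem {M N : GrMod 𝒜} (f : M ⟶ N) {i : ι} {m : M.carrier} (hm : m ∈ M.deg i) :
    lin f m ∈ N.deg i := Subtype.property (p := (· ∈ homs M N)) f i m hm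

theorem hom_ext {M N : GrMod 𝒜} {f g : M ⟶ N} (h : ∀ m, lin f m = lin g m) : f = g :=
  Subtype.ext (LinearMap.ext h)

instance : Preadditive (GrMod 𝒜) where
  homGroup M N := inferInstanceAs (AddCommGroup (homs M N))
  add_comp _ _ _ _ _ _ := Subtype.ext (LinearMap.comp_add _ _ _)
  comp_add _ _ _ _ _ _ := Subtype.ext (LinearMap.add_comp _ _ _)

instance : Linear k (GrMod 𝒜) where
  homModule M N := inferInstanceAs (Module k (homs M N))
  smul_comp _ _ _ r f g := hom_ext fun m => (lin g).map_smul_of_tower r (lin f m)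
  comp_smul _ _ _ _ _ _ := rfl

@[simp] theorem lin_ofLin {M N : GrMod 𝒜} (f : M.carrier →ₗ[A] N.carrier)
    (hf : ∀ i, ∀ m ∈ M.deg i, f m ∈ N.deg i) : lin (ofLin f hf) = f := rfl

@[simp] theorem lin_id (M : GrMod 𝒜) : lin (𝟙 M) = LinearMap.id := rfl

@[simp] theorem lin_comp {M N K : GrMod 𝒜} (f : M ⟶ N) (g : N ⟶ K) :
    lin (f ≫ g) = lin g ∘ₗ lin f := rfl

@[simp] theorem lin_add {M N : GrMod 𝒜} (f g : M ⟶ N) : lin (f + g) = lin f + lin g := rfl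

@[simp] theorem lin_zero {M N : GrMod 𝒜} : lin (0 : M ⟶ N) = 0 := rfl

theorem lin_proj {M N : GrMod 𝒜} (f : M ⟶ N) (i : ι) (m : M.carrier) :
    lin f (M.proj i m) = N.proj i (lin f m) := by
  have : (lin f).restrictScalars k ∘ₗ M.proj i = N.proj i ∘ₗ (lin f).restrictScalars k := by
    refine M.hom_ext_deg fun j m hm => ?_
    by_cases hij : j = i
    · subst hij
      simp [M.proj_same hm, N.proj_same (lin_mem f hm)]
    · simp [M.proj_ne hij hm, N.proj_ne hij (lin_mem f hm)]
  exact LinearMap.congr_fun this m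

/-- The zero graded module. -/
def zero (𝒜 : ι → Submodule k A) : GrMod 𝒜 where
  carrier := PUnit
  deg _ := ⊤
  isInternal := isInternal_of_proj _ 0 (fun _ _ _ => rfl) (fun _ _ _ _ _ => rfl)
    (Subsingleton.elim _ _)
  smul_mem _ _ := trivial

instance : HasZeroObject (GrMod 𝒜) :=
  ⟨zero 𝒜, (IsZero.iff_id_eq_zero _).2 (hom_ext fun _ => rfl)⟩

/-- The direct sum of two graded modules. -/
def prod (M N : GrMod 𝒜) : GrMod 𝒜 where
  carrier := M.carrier × N.carrier
  deg i := (M.deg i).prod (N.deg i)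
  isInternal := by
    refine isInternal_of_proj _ (fun i => (M.proj i).prodMap (N.proj i)) ?_ ?_ ?_
    · rintro i ⟨m, n⟩ ⟨hm, hn⟩
      exact Prod.ext (M.proj_same hm) (N.proj_same hn)
    · rintro i j hij ⟨m, n⟩ ⟨hm, hn⟩
      exact Prod.ext (M.proj_ne hij hm) (N.proj_ne hij hn)
    · rw [eq_top_iff]
      rintro ⟨m, n⟩ -
      have h₁ : (⊤ : Submodule k M.carrier) ≤
          (⨆ i, (M.deg i).prod (N.deg i)).comap (LinearMap.inl k _ _) := by
        rw [← M.iSup_deg]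
        exact iSup_le fun i x hx => Submodule.mem_iSup_of_mem i ⟨hx, zero_mem (N.deg i)⟩
      have h₂ : (⊤ : Submodule k N.carrier) ≤
          (⨆ i, (M.deg i).prod (N.deg i)).comap (LinearMap.inr k _ _) := by
        rw [← N.iSup_deg]
        exact iSup_le fun i x hx => Submodule.mem_iSup_of_mem i ⟨zero_mem (M.deg i), hx⟩
      have e : (m, n) = LinearMap.inl k M.carrier N.carrier m +
          LinearMap.inr k M.carrier N.carrier n := by simp
      rw [e]
      exact Submodule.add_mem _ (h₁ Submodule.mem_top) (h₂ Submodule.mem_top)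
  smul_mem ha hm := ⟨M.smul_mem ha hm.1, N.smul_mem ha hm.2⟩

instance : HasBinaryBiproducts (GrMod 𝒜) where
  has_binary_biproduct M N := hasBinaryBiproduct_of_total
    { pt := prod M N
      fst := ofLin (LinearMap.fst A _ _) fun _ _ hm => hm.1
      snd := ofLin (LinearMap.snd A _ _) fun _ _ hm => hm.2
      inl := ofLin (LinearMap.inl A _ _) fun i _ hm => ⟨hm, zero_mem (N.deg i)⟩
      inr := ofLin (LinearMap.inr A _ _) fun i _ hm => ⟨zero_mem (M.deg i), hm⟩
      inl_fst := hom_ext fun _ => rfl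
      inl_snd := hom_ext fun _ => rfl
      inr_fst := hom_ext fun _ => rfl
      inr_snd := hom_ext fun _ => rfl }
    (hom_ext fun m => Prod.ext (add_zero m.1) (zero_add m.2))

/-- A homogeneous submodule, as a graded module. -/
def sub (M : GrMod 𝒜) (S : Submodule A M.carrier) (hS : ∀ i, ∀ m ∈ S, M.proj i m ∈ S) :
    GrMod 𝒜 where
  carrier := S
  deg i := (M.deg i).comap (S.subtype.restrictScalars k)
  isInternal := by
    set p : ι → S →ₗ[k] S := fun i =>
      ((M.proj i).restrict (p := S.restrictScalars k) (q := S.restrictScalars k) (hS i)) with hp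
    refine isInternal_of_proj _ p ?_ ?_ ?_
    · intro i v hv
      exact Subtype.ext (M.proj_same hv)
    · intro i j hij v hv
      exact Subtype.ext (M.proj_ne hij hv)
    · rw [eq_top_iff]
      rintro v -
      have := M.mem_of_proj_mem
        ((⨆ i, (M.deg i).comap (S.subtype.restrictScalars k)).map (S.subtype.restrictScalars k))
        v.1 fun i => ⟨⟨M.proj i v.1, hS i _ v.2⟩,
          Submodule.mem_iSup_of_mem i (M.proj_mem i _), rfl⟩
      obtain ⟨w, hw, hwv⟩ := this
      rwa [← Subtype.ext hwv]
  smul_mem ha hm := M.smul_mem ha hm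

/-- The quotient of a graded module by a homogeneous submodule. -/
def quot (M : GrMod 𝒜) (S : Submodule A M.carrier) (hS : ∀ i, ∀ m ∈ S, M.proj i m ∈ S) :
    GrMod 𝒜 where
  carrier := M.carrier ⧸ S
  deg i := (M.deg i).map (S.mkQ.restrictScalars k)
  isInternal := by
    have key : ∀ i, ∃ p : (M.carrier ⧸ S) →ₗ[k] (M.carrier ⧸ S),
        ∀ m, p (S.mkQ m) = S.mkQ (M.proj i m) := by
      intro i
      refine ⟨((S.restrictScalars k).mapQ (S.restrictScalars k) (M.proj i) (hS i)), fun m => rfl⟩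
    choose p hp using key
    refine isInternal_of_proj _ p ?_ ?_ ?_
    · rintro i _ ⟨m, hm, rfl⟩
      exact (hp i m).trans (congrArg _ (M.proj_same hm))
    · rintro i j hij _ ⟨m, hm, rfl⟩
      exact (hp j m).trans ((congrArg _ (M.proj_ne hij hm)).trans (map_zero _))
    · rw [← Submodule.map_iSup, M.iSup_deg, Submodule.map_top, LinearMap.range_eq_top]
      exact S.mkQ_surjective
  smul_mem := by
    rintro i j a _ ha ⟨m, hm, rfl⟩
    exact ⟨a • m, M.smul_mem ha hm, rfl⟩

theorem ker_homogeneous {M N : GrMod 𝒜} (f : M ⟶ N) (i : ι) (m : M.carrier)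
    (hm : m ∈ LinearMap.ker (lin f)) : M.proj i m ∈ LinearMap.ker (lin f) := by
  rw [LinearMap.mem_ker] at hm ⊢
  rw [lin_proj, hm, map_zero]

theorem range_homogeneous {M N : GrMod 𝒜} (f : M ⟶ N) (i : ι) (n : N.carrier)
    (hn : n ∈ LinearMap.range (lin f)) : N.proj i n ∈ LinearMap.range (lin f) := by
  obtain ⟨m, rfl⟩ := hn
  exact ⟨M.proj i m, lin_proj f i m⟩

/-- The inclusion of the kernel of a morphism. -/
def kerι {M N : GrMod 𝒜} (f : M ⟶ N) : M.sub (LinearMap.ker (lin f)) (ker_homogeneous f) ⟶ M :=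
  ofLin (Submodule.subtype _) fun _ _ hm => hm

theorem kerι_comp {M N : GrMod 𝒜} (f : M ⟶ N) : kerι f ≫ f = 0 := hom_ext fun m => m.2

/-- The projection onto the cokernel of a morphism. -/
def cokerπ {M N : GrMod 𝒜} (f : M ⟶ N) :
    N ⟶ N.quot (LinearMap.range (lin f)) (range_homogeneous f) :=
  ofLin (Submodule.mkQ _) fun _ m hm => ⟨m, hm, rfl⟩

theorem comp_cokerπ {M N : GrMod 𝒜} (f : M ⟶ N) : f ≫ cokerπ f = 0 :=
  hom_ext fun m => (Submodule.Quotient.mk_eq_zero _).2 ⟨m, rfl⟩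

theorem lin_eq_zero_of_comp {M N K : GrMod 𝒜} {f : M ⟶ N} {g : N ⟶ K} (h : f ≫ g = 0)
    (m : M.carrier) : lin g (lin f m) = 0 :=
  LinearMap.congr_fun (congrArg lin h) m

instance : HasKernels (GrMod 𝒜) where
  has_limit {M N} f := ⟨⟨⟨_, KernelFork.IsLimit.ofι (kerι f) (kerι_comp f)
    (fun g h => ofLin ((lin g).codRestrict _ (lin_eq_zero_of_comp h)) fun _ _ hm => lin_mem g hm)
    (fun g h => hom_ext fun _ => rfl)
    (fun g h m hm => hom_ext fun x => Subtype.ext (by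
      subst hm; rfl))⟩⟩⟩

/-- A surjective morphism is a cokernel of every morphism onto its kernel. -/
def isColimitOfSurjective {K M N : GrMod 𝒜} (g : K ⟶ M) (f : M ⟶ N)
    (hf : Function.Surjective (lin f)) (w : g ≫ f = 0)
    (hg : LinearMap.ker (lin f) ≤ LinearMap.range (lin g)) :
    IsColimit (CokernelCofork.ofπ f w) :=
  have key : ∀ {W : GrMod 𝒜} (h : M ⟶ W), g ≫ h = 0 →
      LinearMap.ker (lin f) ≤ LinearMap.ker (lin h) := by
    intro W h hh x hx
    obtain ⟨y, rfl⟩ := hg hx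
    exact lin_eq_zero_of_comp hh y
  have key₂ : ∀ {W : GrMod 𝒜} (h : M ⟶ W) (hh : g ≫ h = 0) (x : M.carrier),
      ((LinearMap.ker (lin f)).liftQ (lin h) (key h hh) ∘ₗ
        ((lin f).quotKerEquivOfSurjective hf).symm.toLinearMap) (lin f x) = lin h x := by
    intro W h hh x
    have : ((lin f).quotKerEquivOfSurjective hf).symm (lin f x) = Submodule.Quotient.mk x := by
      rw [LinearEquiv.symm_apply_eq]; rfl
    simp [this]
  CokernelCofork.IsColimit.ofπ _ _
    (fun h hh => ofLin ((LinearMap.ker (lin f)).liftQ (lin h) (key h hh) ∘ₗ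
        ((lin f).quotKerEquivOfSurjective hf).symm.toLinearMap) (by
      intro i n hn
      obtain ⟨x, rfl⟩ := hf n
      rw [← N.proj_same hn, ← lin_proj, key₂ h hh]
      exact lin_mem h (M.proj_mem i x)))
    (fun h hh => hom_ext fun x => key₂ h hh x)
    (fun h hh m hm => hom_ext fun n => by
      obtain ⟨x, rfl⟩ := hf n
      refine Eq.trans ?_ (key₂ h hh x).symm
      subst hm; rfl)

/-- An injective morphism is a kernel of every morphism whose kernel is its image. -/
def isLimitOfInjective {M N K : GrMod 𝒜} (f : M ⟶ N) (g : N ⟶ K)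
    (hf : Function.Injective (lin f)) (w : f ≫ g = 0)
    (hg : LinearMap.ker (lin g) ≤ LinearMap.range (lin f)) :
    IsLimit (KernelFork.ofι f w) :=
  have key : ∀ {W : GrMod 𝒜} (h : W ⟶ N), h ≫ g = 0 → ∀ x, lin h x ∈ LinearMap.range (lin f) :=
    fun h hh x => hg (lin_eq_zero_of_comp hh x)
  have key₂ : ∀ {W : GrMod 𝒜} (h : W ⟶ N) (hh : h ≫ g = 0) (x : W.carrier),
      lin f ((LinearEquiv.ofInjective (lin f) hf).symm ((lin h).codRestrict _ (key h hh) x)) =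
        lin h x := by
    intro W h hh x
    exact congrArg Subtype.val ((LinearEquiv.ofInjective (lin f) hf).apply_symm_apply
      ((lin h).codRestrict _ (key h hh) x))
  KernelFork.IsLimit.ofι _ _
    (fun h hh => ofLin ((LinearEquiv.ofInjective (lin f) hf).symm.toLinearMap ∘ₗ
        (lin h).codRestrict _ (key h hh)) (by
      intro i x hx
      have : M.proj i ((LinearEquiv.ofInjective (lin f) hf).symm
          ((lin h).codRestrict _ (key h hh) x)) =
          (LinearEquiv.ofInjective (lin f) hf).symm ((lin h).codRestrict _ (key h hh) x) := by
        apply hf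
        rw [lin_proj, key₂ h hh, N.proj_same (lin_mem h hx)]
      change (LinearEquiv.ofInjective (lin f) hf).symm
        ((lin h).codRestrict _ (key h hh) x) ∈ M.deg i
      rw [← this]
      exact M.proj_mem i _))
    (fun h hh => hom_ext fun x => key₂ h hh x)
    (fun h hh m hm => hom_ext fun x => hf (by
      refine Eq.trans ?_ (key₂ h hh x).symm
      subst hm; rfl))

instance : HasCokernels (GrMod 𝒜) where
  has_colimit f := ⟨⟨⟨_, isColimitOfSurjective f (cokerπ f) (Submodule.mkQ_surjective _)
    (comp_cokerπ f) (Submodule.ker_mkQ _).le⟩⟩⟩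

theorem injective_of_mono {M N : GrMod 𝒜} (f : M ⟶ N) [Mono f] : Function.Injective (lin f) := by
  rw [← LinearMap.ker_eq_bot, eq_bot_iff]
  intro x hx
  have h : kerι f = 0 := by rw [← cancel_mono f, kerι_comp, zero_comp]
  exact LinearMap.congr_fun (congrArg lin h) ⟨x, hx⟩

theorem surjective_of_epi {M N : GrMod 𝒜} (f : M ⟶ N) [Epi f] : Function.Surjective (lin f) := by
  rw [← LinearMap.range_eq_top, eq_top_iff]
  intro x _
  have h : cokerπ f = 0 := by rw [← cancel_epi f, comp_cokerπ, comp_zero]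
  exact (Submodule.Quotient.mk_eq_zero _).1 (LinearMap.congr_fun (congrArg lin h) x)

/-- Graded modules and graded homomorphisms of degree zero form an abelian category. -/
instance : Abelian (GrMod 𝒜) where
  normalMonoOfMono f _ := ⟨⟨_, cokerπ f, comp_cokerπ f, isLimitOfInjective f (cokerπ f)
    (injective_of_mono f) (comp_cokerπ f) (Submodule.ker_mkQ _).le⟩⟩
  normalEpiOfEpi f _ := ⟨⟨_, kerι f, kerι_comp f, isColimitOfSurjective (kerι f) f
    (surjective_of_epi f) (kerι_comp f) (Submodule.range_subtype _).ge⟩⟩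
  has_finite_products := hasFiniteProducts_of_has_binary_and_terminal

instance : HasDerivedCategory.{u + 1} (GrMod 𝒜) := HasDerivedCategory.standard _

instance : HasExt.{u + 1} (GrMod 𝒜) := HasExt.standard _

/-- The algebra itself as a graded left module. -/
def self (𝒜 : ι → Submodule k A) [GradedAlgebra 𝒜] : GrMod 𝒜 where
  carrier := A
  deg := 𝒜
  isInternal := DirectSum.Decomposition.isInternal 𝒜
  smul_mem ha hm := SetLike.mul_mem_graded ha hm

/-- The shift `M(j)`, with `M(j)_i = M_{i + j}`. -/
def shift (M : GrMod 𝒜) (j : ι) : GrMod 𝒜 where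
  carrier := M.carrier
  deg i := M.deg (i + j)
  isInternal := isInternal_of_proj _ (fun i => M.proj (i + j)) (fun _ _ hv => M.proj_same hv)
    (fun _ _ hij _ hv => M.proj_ne (fun h => hij (add_right_cancel h)) hv)
    (((Equiv.addRight j).iSup_comp (g := M.deg)).trans M.iSup_deg)
  smul_mem ha hm := by
    rw [add_assoc]
    exact M.smul_mem ha hm

end GrMod

/-! ### The `ε`-condition -/

/-- A perfect complex: an object of the derived category of graded modules that is isomorphic
there to a bounded complex of finitely generated projective graded modules. -/
def IsPerfect (X : DerivedCategory (GrMod 𝒜)) : Prop :=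
  ∃ P : CochainComplex (GrMod 𝒜) ℤ,
    (∃ a b : ℤ, P.IsStrictlyGE a ∧ P.IsStrictlyLE b) ∧
    (∀ n, Projective (P.X n) ∧ Module.Finite A (P.X n).carrier) ∧
    Nonempty (DerivedCategory.Q.obj P ≅ X)

/-- The `ε`-objects of the bounded derived category of graded modules: the perfect complexes with
finite-dimensional cohomology. They are the objects of `𝒟_ε(A)`. -/
def epsilonObjects (𝒜 : ι → Submodule k A) :
    ObjectProperty (DerivedCategory.Bounded (GrMod 𝒜)) := fun X =>
  IsPerfect X.obj ∧
    ∀ n : ℤ, FiniteDimensional k ((DerivedCategory.homologyFunctor (GrMod 𝒜) n).obj X.obj).carrier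

/-- The `ε`-condition `𝒟_ε(A) ≠ 0` for the algebra `A` with the grading `𝒜`. -/
def EpsilonCondition (𝒜 : ι → Submodule k A) : Prop :=
  ∃ X : (epsilonObjects 𝒜).FullSubcategory, ¬ IsZero X

/-! ### Conditions on graded algebras -/

/-- The grading is supported in nonnegative degrees. -/
def IsNonnegGraded [PartialOrder ι] (𝒜 : ι → Submodule k A) : Prop :=
  ∀ i, 𝒜 i ≠ ⊥ → 0 ≤ i

/-- Connected graded: supported in nonnegative degrees, with degree zero part `k`. -/
structure IsConnectedGraded [PartialOrder ι] (𝒜 : ι → Submodule k A) : Prop where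
  nontrivial : Nontrivial A
  nonneg : IsNonnegGraded 𝒜
  deg_zero : 𝒜 0 = LinearMap.range (Algebra.linearMap k A)

/-- All homogeneous components are finite-dimensional. -/
def IsLocallyFinite (𝒜 : ι → Submodule k A) : Prop :=
  ∀ i, FiniteDimensional k (𝒜 i)

end GradedModules

/-- Left and right noetherian. -/
def IsTwoSidedNoetherian (A : Type u) [Ring A] : Prop :=
  IsNoetherianRing A ∧ IsNoetherianRing Aᵐᵒᵖ

/-- Finite (left) global dimension. -/
def HasFiniteGlobalDimension (A : Type u) [Ring A] : Prop :=
  ∃ d : ℕ, ∀ M : ModuleCat.{u} A, HasProjectiveDimensionLE M d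

section AlgebraMaps

variable {k A B : Type u} [Field k] [Ring A] [Algebra k A] [Ring B] [Algebra k B]

/-- `B` is finitely generated as a right `A`-module through the algebra map `f : A → B`. -/
def IsRightFinite (f : A →ₐ[k] B) : Prop :=
  letI : Module Aᵐᵒᵖ B := Module.compHom B (RingHom.op (f : A →+* B))
  Module.Finite Aᵐᵒᵖ B

end AlgebraMaps

/-! ### Artin-Schelter regular algebras -/

section ASRegular

variable {k A : Type u} [Field k] [Ring A] [Algebra k A]

/-- The left ideal `A_{≥ 1}`. -/
def augmentationIdeal (𝒜 : ℤ → Submodule k A) : Ideal A :=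
  Ideal.span {a | ∃ i, 0 < i ∧ a ∈ 𝒜 i}

theorem augmentationIdeal_homogeneous (𝒜 : ℤ → Submodule k A) [GradedAlgebra 𝒜] (i : ℤ) (a : A)
    (ha : a ∈ augmentationIdeal 𝒜) : (GrMod.self 𝒜).proj i a ∈ augmentationIdeal 𝒜 := by
  have h := Ideal.homogeneous_span 𝒜 {a | ∃ i, 0 < i ∧ a ∈ 𝒜 i}
    (fun x hx => let ⟨i, _, hi⟩ := hx; ⟨i, hi⟩) i ha
  have e₁ : ∀ a ∈ 𝒜 i, GradedAlgebra.proj 𝒜 i a = a := fun a ha =>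
    DirectSum.decompose_of_mem_same 𝒜 ha
  have e₂ : ∀ j ≠ i, ∀ a ∈ 𝒜 j, GradedAlgebra.proj 𝒜 i a = 0 := fun j hj a ha =>
    DirectSum.decompose_of_mem_ne 𝒜 ha hj
  have h' : (GrMod.self 𝒜).proj i = GradedAlgebra.proj 𝒜 i := by
    refine (GrMod.self 𝒜).hom_ext_deg fun j m hm => ?_
    by_cases hij : j = i
    · subst hij
      rw [(GrMod.self 𝒜).proj_same hm]
      exact (e₁ m hm).symm
    · rw [(GrMod.self 𝒜).proj_ne hij hm]
      exact (e₂ j hij m hm).symm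
  rw [h']
  exact h

/-- The trivial graded module `k = A / A_{≥ 1}`. -/
def trivialModule (𝒜 : ℤ → Submodule k A) [GradedAlgebra 𝒜] : GrMod 𝒜 :=
  (GrMod.self 𝒜).quot (augmentationIdeal 𝒜) (augmentationIdeal_homogeneous 𝒜)

/-- Artin-Schelter Gorenstein algebras. The degree `j` part of `Ext^i_A(k, A)` is the space
`Ext^i(k, A(j))` in the category of graded modules, and `k(l)` is one-dimensional and
concentrated in degree `-l`, with the only possible action of a connected graded algebra. -/
structure IsASGorenstein (𝒜 : ℤ → Submodule k A) [GradedAlgebra 𝒜] : Prop where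
  connected : IsConnectedGraded 𝒜
  locallyFinite : IsLocallyFinite 𝒜
  gorenstein : ∃ (d : ℕ) (l : ℤ), HasInjectiveDimensionLE (ModuleCat.of A A) d ∧
    Module.finrank k (Abelian.Ext (trivialModule 𝒜) ((GrMod.self 𝒜).shift (-l)) d) = 1 ∧
    ∀ (i : ℕ) (j : ℤ), i ≠ d ∨ j ≠ -l →
      Subsingleton (Abelian.Ext (trivialModule 𝒜) ((GrMod.self 𝒜).shift j) i)

/-- Artin-Schelter regular algebras. -/
structure IsASRegular (𝒜 : ℤ → Submodule k A) [GradedAlgebra 𝒜] : Prop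
    extends IsASGorenstein 𝒜 where
  finiteGlobalDimension : HasFiniteGlobalDimension A

end ASRegular

/-! ### New gradings -/

section Regrading

variable {k A B : Type u} [Field k] [Ring A] [Algebra k A] [Ring B] [Algebra k B]

/-- The grading `A_r = ⨁_{φ s = r} A_s` obtained from a homomorphism of the grading groups. -/
def regrade {ι κ : Type} [AddCommGroup ι] [AddCommGroup κ] (φ : ι →+ κ) (𝒜 : ι → Submodule k A) :
    κ → Submodule k A :=
  fun r => ⨆ s, ⨆ (_ : φ s = r), 𝒜 s

/-- The addition `ℤ² → ℤ`. -/
def totalDegree : ℤ × ℤ →+ ℤ := AddMonoidHom.fst ℤ ℤ + AddMonoidHom.snd ℤ ℤ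

/-- The `ℤ²`-grading of `A ⊗ B`, with `(A ⊗ B)_{(i, j)} = A_i ⊗ B_j`. -/
def tensorGrading (𝒜 : ℤ → Submodule k A) (ℬ : ℤ → Submodule k B) :
    ℤ × ℤ → Submodule k (A ⊗[k] B) :=
  fun r => Submodule.map₂ (TensorProduct.mk k A B) (𝒜 r.1) (ℬ r.2)

/-- The `ℤ²`-grading of `A[t]` with `t` in degree `(0, e)`: the component of degree `(i, j)` is
`A_i tⁿ` if `j = n e`. -/
def polyGrading (𝒜 : ℤ → Submodule k A) (e : ℤ) : ℤ × ℤ → Submodule k (Polynomial A) :=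
  fun r => ⨆ n : ℕ, ⨆ (_ : n * e = r.2),
    (𝒜 r.1).map ((Polynomial.monomial n : A →ₗ[A] Polynomial A).restrictScalars k)

end Regrading

/-! ### Graded twists -/

section Twists

variable {k A : Type u} [Field k] [Ring A] [Algebra k A] {w : ℕ}

/-- A sequence of pairwise commuting graded automorphisms of a `ℤ^w`-graded algebra. -/
structure TwistData (𝒜 : (Fin w → ℤ) → Submodule k A) where
  /-- the automorphisms -/
  σ : Fin w → (A ≃ₐ[k] A)
  mem_iff : ∀ i r a, σ i a ∈ 𝒜 r ↔ a ∈ 𝒜 r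
  comm : ∀ i j, Commute (σ i) (σ j)

variable {𝒜 : (Fin w → ℤ) → Submodule k A}

namespace TwistData

/-- `σ^r = σ_1^{r_1} ⋯ σ_w^{r_w}`. -/
def pow (T : TwistData 𝒜) (r : Fin w → ℤ) : A ≃ₐ[k] A :=
  Finset.univ.noncommProd (fun i => T.σ i ^ r i) fun i _ j _ _ => (T.comm i j).zpow_zpow _ _

theorem pow_zero (T : TwistData 𝒜) : T.pow 0 = 1 :=
  Finset.noncommProd_eq_pow_card _ _ _ 1 (fun _ _ => zpow_zero _) |>.trans (one_pow _)

theorem pow_add (T : TwistData 𝒜) (r s : Fin w → ℤ) : T.pow (r + s) = T.pow r * T.pow s := by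
  refine Eq.trans ?_ (Finset.noncommProd_mul_distrib _ _ _ _
    fun i _ j _ _ => (T.comm i j).zpow_zpow _ _)
  exact Finset.noncommProd_congr rfl (fun i _ => zpow_add _ _ _) _

theorem pow_mem (T : TwistData 𝒜) (r : Fin w → ℤ) {s : Fin w → ℤ} {a : A} (ha : a ∈ 𝒜 s) :
    T.pow r a ∈ 𝒜 s := by
  let H : Subgroup (A ≃ₐ[k] A) :=
    { carrier := {τ | ∀ a, τ a ∈ 𝒜 s ↔ a ∈ 𝒜 s}
      one_mem' := fun _ => Iff.rfl
      mul_mem' := fun {τ τ'} h h' a => (h (τ' a)).trans (h' a)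
      inv_mem' := fun {τ} h a => by
        rw [← h (τ⁻¹ a)]
        exact iff_of_eq (congrArg (· ∈ 𝒜 s) (τ.apply_symm_apply a)) }
  have : T.pow r ∈ H := H.noncommProd_mem _ fun i _ => H.zpow_mem (fun a => T.mem_iff i s a) _
  exact (this a).2 ha

variable [GradedAlgebra 𝒜]

/-- The twisted multiplication `(b, a) ↦ a ⋆ b`, bilinear with `a ⋆ b = σ^r(a) b` for `b` of
degree `r`. -/
def mul (T : TwistData 𝒜) : A →ₗ[k] A →ₗ[k] A :=
  DirectSum.toModule k (Fin w → ℤ) (A →ₗ[k] A) (fun r =>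
    LinearMap.lcomp k A (T.pow r).toLinearMap ∘ₗ (LinearMap.mul k A).flip ∘ₗ (𝒜 r).subtype) ∘ₗ
    (DirectSum.decomposeLinearEquiv 𝒜).toLinearMap

theorem mul_of_mem (T : TwistData 𝒜) {r : Fin w → ℤ} (a : A) {b : A} (hb : b ∈ 𝒜 r) :
    T.mul b a = T.pow r a * b := by
  have : DirectSum.decompose 𝒜 b = DirectSum.lof k _ (fun r => 𝒜 r) r ⟨b, hb⟩ :=
    DirectSum.decompose_of_mem 𝒜 hb
  simp only [mul, LinearMap.comp_apply, LinearEquiv.coe_coe,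
    DirectSum.decomposeLinearEquiv_apply, this, DirectSum.toModule_lof]
  rfl

/-- The underlying space of the twisted algebra. -/
def Twist (_ : TwistData 𝒜) : Type u := A

variable (T : TwistData 𝒜)

instance : AddCommGroup T.Twist := inferInstanceAs (AddCommGroup A)

instance : Module k T.Twist := inferInstanceAs (Module k A)

theorem ext_deg {f g : A →ₗ[k] A} (h : ∀ r, ∀ a ∈ 𝒜 r, f a = g a) : f = g := by
  have h' : (⊤ : Submodule k A) ≤ LinearMap.eqLocus f g := by
    rw [← (DirectSum.Decomposition.isInternal 𝒜).submodule_iSup_eq_top]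
    exact iSup_le fun i m hm => h i m hm
  ext m
  exact h' (Submodule.mem_top (x := m))

theorem mul_one' (a : A) : T.mul 1 a = a := by
  rw [T.mul_of_mem a (SetLike.one_mem_graded 𝒜), T.pow_zero]
  simp

theorem one_mul' (b : A) : T.mul b 1 = b := by
  have : T.mul.flip 1 = LinearMap.id := ext_deg (𝒜 := 𝒜) fun r b hb => by
    simp [T.mul_of_mem 1 hb]
  exact LinearMap.congr_fun this b

theorem mul_assoc' (a b c : A) : T.mul c (T.mul b a) = T.mul (T.mul c b) a := by
  have h₁ : ∀ r, ∀ c ∈ 𝒜 r, T.mul c ∘ₗ T.mul.flip a = T.mul.flip a ∘ₗ T.mul c := by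
    intro r c hc
    refine ext_deg (𝒜 := 𝒜) fun s b hb => ?_
    simp only [LinearMap.comp_apply, LinearMap.flip_apply]
    have hbc : T.mul c b ∈ 𝒜 (r + s) := by
      rw [T.mul_of_mem b hc, add_comm]
      exact SetLike.mul_mem_graded (T.pow_mem r hb) hc
    rw [T.mul_of_mem a hbc, T.mul_of_mem _ hc, T.mul_of_mem _ hc, T.mul_of_mem _ hb, T.pow_add]
    simp [mul_assoc]
  have h₂ : T.mul.flip (T.mul b a) = T.mul.flip a ∘ₗ T.mul.flip b :=
    ext_deg (𝒜 := 𝒜) fun r c hc => LinearMap.congr_fun (h₁ r c hc) b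
  exact LinearMap.congr_fun h₂ c

/-- The ring structure of the graded twist, with multiplication `a ⋆ b`. -/
instance : Ring T.Twist :=
  { (inferInstance : AddCommGroup T.Twist) with
    mul := fun a b => T.mul (A := A) b a
    one := (1 : A)
    left_distrib := fun a b c => LinearMap.congr_fun (T.mul.map_add b c) a
    right_distrib := fun a b c => (T.mul c).map_add a b
    zero_mul := fun a => (T.mul a).map_zero
    mul_zero := fun a => LinearMap.congr_fun T.mul.map_zero a
    mul_assoc := fun a b c => T.mul_assoc' a b c
    one_mul := T.one_mul'
    mul_one := T.mul_one' }

instance : Algebra k T.Twist :=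
  Algebra.ofModule (fun c a b => (T.mul b).map_smul c a)
    (fun c a b => LinearMap.congr_fun (T.mul.map_smul c b) a)

/-- The grading of the graded twist: that of the original algebra. -/
def twistGrading : (Fin w → ℤ) → Submodule k T.Twist := 𝒜

theorem twist_mul_def {r : Fin w → ℤ} (a b : A) (hb : b ∈ 𝒜 r) :
    ((show T.Twist from a) * (show T.Twist from b) : T.Twist) = T.pow r a * b :=
  T.mul_of_mem a hb

instance : GradedAlgebra T.twistGrading where
  one_mem := SetLike.one_mem_graded 𝒜
  mul_mem r s a b ha hb := by
    change T.mul (A := A) b a ∈ 𝒜 (r + s)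
    rw [T.mul_of_mem (A := A) a hb]
    exact SetLike.mul_mem_graded (T.pow_mem s ha) hb
  decompose' := DirectSum.decompose 𝒜
  left_inv := (DirectSum.decompose 𝒜).left_inv
  right_inv := (DirectSum.decompose 𝒜).right_inv

end TwistData

end Twists

end

/-! A finitely generated projective graded module is a direct summand of a graded free module of
finite rank, so a bounded complex of such modules amounts to two homogeneous matrices: an idempotent
`E` and a differential `D`, acting on rows. The ε-condition says that some such pair has
finite-dimensional nonzero homology (`epsilonCondition_iff`). Each part of the theorem then becomes
a construction with matrices.

Regrading keeps the matrices. A graded twist changes their entries by powers of the automorphisms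
(`HasEpsilonMatrices.of_twist`). If `A` is noetherian of finite global dimension, a
finite-dimensional graded module has a finite resolution by finitely generated projectives, and its
homology is the module itself (`MatResolution`). For an algebra finite over its affine center, one
takes the Koszul complex on the homogeneous components of nonzero degree of generators of the
center. Its homology is finitely generated and killed by these elements, and the quotient by them is
finite-dimensional and nonzero (`hasEpsilonMatrices_of_central`). A commutative algebra is its own
center, which gives the affine commutative case.

For a finite map `A → B` the complex is changed to `B ⊗_A X`. Its homology is finite-dimensional by
descending induction on the position: finitely generated right modules are resolved by free ones and
the long exact sequence is used (`MatComplex.HasFiniteHomology.finiteAt`). It is nonzero by a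
Nakayama argument. At the top position with homology the cycles split off, so a homology class of
lowest degree is detected by a covector over `k` (`MatComplex.exists_residue`). Pairing with that
covector would put every `b` in `B A_{≥1}` if `b ⊗ z` were always a boundary, whereas a nonzero
element of lowest degree of `B` does not lie there.

For tensor products, each complex over the field `k` is contractible up to an endomorphism whose
square has finite rank. Combining the two homotopies with signs bounds the homology of the product
(`SignedComplex.finiteModulo_tensor`). A product of functionals shows that the homology is nonzero.
The converse is the finite map `A ⊗ B → A` given by the augmentation of `B`. For `A[t]` one tensors
with the Koszul complex of `t` over `k[t]`, and returns along `t ↦ 0`. -/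

noncomputable section

/-! ### Subspaces that are finite modulo another subspace -/

section FiniteModulo

variable {k : Type*} [Field k] {V W : Type*} [AddCommGroup V] [Module k V] [AddCommGroup W]
  [Module k W]

/-- The subspace `Z` is finite-dimensional modulo the subspace `R`. -/
def FiniteModulo (Z R : Submodule k V) : Prop :=
  ∃ S : Submodule k V, S.FG ∧ Z ≤ R ⊔ S

namespace FiniteModulo

theorem mono {Z Z' R R' : Submodule k V} (h : FiniteModulo Z R) (hZ : Z' ≤ Z) (hR : R ≤ R') :
    FiniteModulo Z' R' := by
  obtain ⟨S, hS, h⟩ := h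
  exact ⟨S, hS, hZ.trans (h.trans (sup_le_sup_right hR S))⟩

theorem map {Z R : Submodule k V} (h : FiniteModulo Z R) (f : V →ₗ[k] W) :
    FiniteModulo (Z.map f) (R.map f) := by
  obtain ⟨S, hS, h⟩ := h
  exact ⟨S.map f, hS.map f, (Submodule.map_mono h).trans (Submodule.map_sup _ _ _).le⟩

theorem trans {Z Y R : Submodule k V} (h : FiniteModulo Z Y) (h' : FiniteModulo Y R) :
    FiniteModulo Z R := by
  obtain ⟨S, hS, h⟩ := h
  obtain ⟨T, hT, h'⟩ := h'
  exact ⟨T ⊔ S, hT.sup hS, h.trans (by rw [← sup_assoc]; exact sup_le_sup_right h' S)⟩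

theorem fg_map_mkQ {Z R : Submodule k V} (h : FiniteModulo Z R) : (Z.map R.mkQ).FG := by
  obtain ⟨S, hS, h⟩ := h
  have h' : Z.map R.mkQ ≤ S.map R.mkQ := by
    refine (Submodule.map_mono h).trans ?_
    rw [Submodule.map_sup, Submodule.mkQ_map_self, bot_sup_eq]
  have : FiniteDimensional k (S.map R.mkQ) := Module.Finite.iff_fg.2 (hS.map _)
  exact Module.Finite.iff_fg.1 (Submodule.finiteDimensional_of_le h')

theorem of_fg_map {Z R : Submodule k V} (g : V →ₗ[k] W) (hg : Z ⊓ LinearMap.ker g ≤ R)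
    (h : (Z.map g).FG) : ∃ S : Submodule k V, S.FG ∧ S ≤ Z ∧ Z ≤ R ⊔ S := by
  have : FiniteDimensional k (Z.map g) := Module.Finite.iff_fg.2 h
  let g' : Z →ₗ[k] Z.map g := g.submoduleMap Z
  obtain ⟨s, hs⟩ := g'.exists_rightInverse_of_surjective
    (LinearMap.range_eq_top.2 (g.submoduleMap_surjective Z))
  refine ⟨(LinearMap.range s).map Z.subtype, ?_, Submodule.map_subtype_le _ _, ?_⟩
  · exact (Module.Finite.iff_fg.1 (inferInstance : FiniteDimensional k (LinearMap.range s))).map _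
  · intro z hz
    have e : z = (z - (s (g' ⟨z, hz⟩)).1) + (s (g' ⟨z, hz⟩)).1 := by abel
    rw [e]
    refine Submodule.add_mem_sup (hg ⟨Z.sub_mem hz (s _).2, ?_⟩) ⟨_, ⟨_, rfl⟩, rfl⟩
    have : g' (s (g' ⟨z, hz⟩)) = g' ⟨z, hz⟩ := LinearMap.congr_fun hs _
    rw [SetLike.mem_coe, LinearMap.mem_ker, map_sub, sub_eq_zero]
    exact (congrArg Subtype.val this).symm

theorem comap {Z : Submodule k V} {R : Submodule k W} (f : V →ₗ[k] W)
    (h : FiniteModulo (Z.map f) R) :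
    ∃ S : Submodule k V, S.FG ∧ S ≤ Z ∧ Z ≤ R.comap f ⊔ S := by
  refine of_fg_map (R.mkQ ∘ₗ f) ?_ ?_
  · rintro z ⟨-, hz⟩
    simpa using hz
  · rw [Submodule.map_comp]
    exact h.fg_map_mkQ

theorem pi {α : Type*} [Finite α] {V : α → Type*} [∀ i, AddCommGroup (V i)]
    [∀ i, Module k (V i)] {Z R : ∀ i, Submodule k (V i)} (h : ∀ i, FiniteModulo (Z i) (R i)) :
    FiniteModulo (Submodule.pi Set.univ Z) (Submodule.pi Set.univ R) := by
  classical
  choose S hS h using h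
  refine ⟨Submodule.pi Set.univ S, Submodule.fg_pi hS, fun v hv => ?_⟩
  choose r hr s hs e using fun i => Submodule.mem_sup.1 (h i (hv i trivial))
  rw [← funext e]
  exact Submodule.add_mem_sup (fun i _ => hr i) (fun i _ => hs i)

end FiniteModulo

end FiniteModulo

/-! ### Complexes presented by matrices -/

section MatComplex

open Matrix

variable {k A : Type u} {ι : Type} [Field k] [Ring A] [Algebra k A] [AddCommGroup ι]

/-- A bounded complex of finitely generated projective graded modules, presented by an idempotent
matrix `E` and a differential matrix `D`: the module of rows `v` with `v E = v`, with the
differential `v ↦ v D`. The basis vector `a` has degree `deg a` and sits in cohomological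
position `pos a`. -/
structure MatComplex (𝒜 : ι → Submodule k A) where
  /-- the index set of the rows -/
  I : Type
  [fintype : Fintype I]
  [decEq : DecidableEq I]
  /-- the internal degrees -/
  deg : I → ι
  /-- the cohomological positions -/
  pos : I → ℤ
  /-- the idempotent -/
  E : Matrix I I A
  /-- the differential -/
  D : Matrix I I A
  -- A row of degree `r` has its entry at `a` in degree `r - deg a`. Hence a matrix preserves
  -- degrees when its `(a, b)` entry has degree `deg a - deg b`.
  E_mem : ∀ a b, E a b ∈ 𝒜 (deg a - deg b)
  D_mem : ∀ a b, D a b ∈ 𝒜 (deg a - deg b)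
  E_pos : ∀ a b, E a b ≠ 0 → pos b = pos a
  D_pos : ∀ a b, D a b ≠ 0 → pos b = pos a + 1
  EE : E * E = E
  ED : E * D = D
  DE : D * E = D
  DD : D * D = 0

attribute [instance] MatComplex.fintype MatComplex.decEq

namespace MatComplex

variable {𝒜 : ι → Submodule k A} (X : MatComplex 𝒜)

/-- The cycles. -/
def cycles : Submodule A (X.I → A) :=
  LinearMap.eqLocus X.E.vecMulLinear LinearMap.id ⊓ LinearMap.ker X.D.vecMulLinear

/-- The boundaries. -/
def boundaries : Submodule A (X.I → A) := LinearMap.range X.D.vecMulLinear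

variable {X}

theorem mem_cycles {v : X.I → A} : v ∈ X.cycles ↔ v ᵥ* X.E = v ∧ v ᵥ* X.D = 0 := Iff.rfl

theorem mem_boundaries {v : X.I → A} : v ∈ X.boundaries ↔ ∃ u, u ᵥ* X.D = v := Iff.rfl

variable (X)

theorem vecMul_D_mem (u : X.I → A) : u ᵥ* X.D ∈ X.boundaries := ⟨u, rfl⟩

/-- The homology is finite-dimensional. -/
def HasFiniteHomology : Prop :=
  FiniteModulo (X.cycles.restrictScalars k) (X.boundaries.restrictScalars k)

end MatComplex

/-- There is a complex presented by matrices with finite-dimensional, nonzero homology. -/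
def HasEpsilonMatrices (𝒜 : ι → Submodule k A) : Prop :=
  ∃ X : MatComplex 𝒜, X.HasFiniteHomology ∧ ¬ X.cycles ≤ X.boundaries

end MatComplex

/-! ### Graded free modules -/

section GradedFree

open Matrix

variable {k A : Type u} {ι : Type} [Field k] [Ring A] [Algebra k A] [AddCommGroup ι]
  [DecidableEq ι] {𝒜 : ι → Submodule k A}

namespace GrMod

theorem proj_smul (M : GrMod 𝒜) {i : ι} {a : A} (ha : a ∈ 𝒜 i) (j : ι) (m : M.carrier) :
    M.proj (i + j) (a • m) = a • M.proj j m := by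
  have : M.proj (i + j) ∘ₗ (Module.toModuleEnd k (S := A) M.carrier a) =
      (Module.toModuleEnd k (S := A) M.carrier a) ∘ₗ M.proj j := by
    refine M.hom_ext_deg fun l m hm => ?_
    by_cases h : l = j
    · subst h
      simp [M.proj_same hm, M.proj_same (M.smul_mem ha hm)]
    · simp [M.proj_ne h hm, M.proj_ne (fun e => h (add_left_cancel e)) (M.smul_mem ha hm)]
  exact LinearMap.congr_fun this m

/-- Two `k`-linear maps that agree on homogeneous elements are linear over `A` if one can check
this on homogeneous elements. -/
theorem map_smul_of_homogeneous [GradedAlgebra 𝒜] (M : GrMod 𝒜) {N : Type u} [AddCommGroup N]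
    [Module k N] [Module A N] [IsScalarTower k A N] (f : M.carrier →ₗ[k] N)
    (h : ∀ i j, ∀ a ∈ 𝒜 i, ∀ m ∈ M.deg j, f (a • m) = a • f m) (a : A) (m : M.carrier) :
    f (a • m) = a • f m := by
  have : SMulCommClass A k N := IsScalarTower.to_smulCommClass'
  have h₁ : ∀ i, ∀ a ∈ 𝒜 i, ∀ m, f (a • m) = a • f m := by
    intro i a ha m
    have : f ∘ₗ (Module.toModuleEnd k (S := A) M.carrier a) =
        (Module.toModuleEnd k (S := A) N a) ∘ₗ f :=
      M.hom_ext_deg fun j m hm => h i j a ha m hm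
    exact LinearMap.congr_fun this m
  have h₂ : f ∘ₗ (LinearMap.toSpanSingleton A M.carrier m).restrictScalars k =
      (LinearMap.toSpanSingleton A N (f m)).restrictScalars k :=
    (self 𝒜).hom_ext_deg fun i a ha => h₁ i a ha m
  exact LinearMap.congr_fun h₂ a

/-- The component of degree zero of a linear map. -/
def degZero [GradedAlgebra 𝒜] {M N : GrMod 𝒜} (f : M.carrier →ₗ[A] N.carrier) : M ⟶ N :=
  let g : M.carrier →ₗ[k] N.carrier :=
    DirectSum.toModule k ι N.carrier
      (fun i => N.proj i ∘ₗ f.restrictScalars k ∘ₗ (M.deg i).subtype) ∘ₗ M.decomp.toLinearMap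
  have hg : ∀ i, ∀ m ∈ M.deg i, g m = N.proj i (f m) := fun i m hm => by
    simp [g, M.decomp_of_mem hm]
  ofLin { g with
      map_smul' := M.map_smul_of_homogeneous g fun i j a ha m hm => by
        rw [hg _ _ (M.smul_mem ha hm), hg _ _ hm, map_smul, N.proj_smul ha] }
    fun i m hm => (hg i m hm).symm ▸ N.proj_mem i _

theorem degZero_apply [GradedAlgebra 𝒜] {M N : GrMod 𝒜} (f : M.carrier →ₗ[A] N.carrier) {i : ι}
    {m : M.carrier} (hm : m ∈ M.deg i) : lin (degZero f) m = N.proj i (f m) := by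
  simp only [degZero, lin_ofLin]
  change (DirectSum.toModule k ι N.carrier
      (fun i => N.proj i ∘ₗ f.restrictScalars k ∘ₗ (M.deg i).subtype)) (M.decomp m) = _
  simp [M.decomp_of_mem hm]

theorem hom_ext_of_homogeneous {M N : GrMod 𝒜} {f g : M ⟶ N}
    (h : ∀ i, ∀ m ∈ M.deg i, lin f m = lin g m) : f = g :=
  hom_ext fun m => LinearMap.congr_fun
    (M.hom_ext_deg (f := (lin f).restrictScalars k) (g := (lin g).restrictScalars k) h) m

theorem epi_of_surjective {M N : GrMod 𝒜} (f : M ⟶ N) (hf : Function.Surjective (lin f)) :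
    Epi f where
  left_cancellation g h e := hom_ext fun n => by
    obtain ⟨m, rfl⟩ := hf n
    exact LinearMap.congr_fun (congrArg lin e) m

/-- A surjection that splits as a linear map splits as a graded map. -/
theorem exists_section [GradedAlgebra 𝒜] {M N : GrMod 𝒜} (f : M ⟶ N)
    (s : N.carrier →ₗ[A] M.carrier) (hs : ∀ n, lin f (s n) = n) :
    ∃ s : N ⟶ M, s ≫ f = 𝟙 N :=
  ⟨degZero s, hom_ext_of_homogeneous fun i n hn => by
    rw [lin_comp, LinearMap.comp_apply, degZero_apply s hn, lin_proj, hs, N.proj_same hn, lin_id,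
      LinearMap.id_apply]⟩

variable [GradedAlgebra 𝒜]

theorem _root_.GradedAlgebra.proj_mem' (i : ι) (a : A) : GradedAlgebra.proj 𝒜 i a ∈ 𝒜 i :=
  SetLike.coe_mem _

theorem _root_.GradedAlgebra.proj_same {i : ι} {a : A} (ha : a ∈ 𝒜 i) :
    GradedAlgebra.proj 𝒜 i a = a := DirectSum.decompose_of_mem_same 𝒜 ha

theorem _root_.GradedAlgebra.proj_ne {i j : ι} {a : A} (ha : a ∈ 𝒜 i) (hij : i ≠ j) :
    GradedAlgebra.proj 𝒜 j a = 0 := DirectSum.decompose_of_mem_ne 𝒜 ha hij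

variable (𝒜) in
/-- The graded free module with basis elements of given degrees. -/
def free {I : Type} [Finite I] (deg : I → ι) : GrMod 𝒜 where
  carrier := I → A
  deg r := Submodule.pi Set.univ fun a => 𝒜 (r - deg a)
  isInternal := by
    classical
    have := Fintype.ofFinite I
    refine isInternal_of_proj _
      (fun r => LinearMap.pi fun a => GradedAlgebra.proj 𝒜 (r - deg a) ∘ₗ LinearMap.proj a)
      ?_ ?_ ?_
    · exact fun r v hv => funext fun a => GradedAlgebra.proj_same (hv a trivial)
    · exact fun r s hrs v hv => funext fun a =>
        GradedAlgebra.proj_ne (hv a trivial) fun h => hrs (sub_left_injective h)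
    · rw [eq_top_iff]
      rintro v -
      rw [← Finset.univ_sum_single v]
      refine Submodule.sum_mem _ fun a _ => ?_
      have h : (⊤ : Submodule k A) ≤ (⨆ r, Submodule.pi Set.univ fun a => 𝒜 (r - deg a)).comap
          (LinearMap.single k (fun _ => A) a) := by
        rw [← (DirectSum.Decomposition.isInternal 𝒜).submodule_iSup_eq_top]
        refine iSup_le fun i x hx => Submodule.mem_iSup_of_mem (i + deg a) fun b _ => ?_
        by_cases h : b = a
        · subst h
          simpa using hx
        · simp [h]
      exact h (Submodule.mem_top (x := v a))
  smul_mem {i j a m} ha hm b _ := by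
    change a * m b ∈ 𝒜 (i + j - deg b)
    rw [add_sub_assoc]
    exact SetLike.mul_mem_graded ha (hm b trivial)

section Free

variable {I : Type} [Fintype I] (deg : I → ι)

theorem free_mem_deg {r : ι} {v : I → A} :
    (show (free 𝒜 deg).carrier from v) ∈ (free 𝒜 deg).deg r ↔ ∀ a, v a ∈ 𝒜 (r - deg a) :=
  ⟨fun h a => h a trivial, fun h a _ => h a⟩

theorem single_mem_deg [DecidableEq I] (a : I) :
    (show (free 𝒜 deg).carrier from Pi.single (M := fun _ => A) a 1) ∈
      (free 𝒜 deg).deg (deg a) := by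
  rw [free_mem_deg]
  intro b
  by_cases h : b = a
  · subst h
    simpa using SetLike.one_mem_graded 𝒜
  · simp [h]

/-- The graded map from a graded free module given by the images of the basis. -/
def freeLift (M : GrMod 𝒜) (t : I → M.carrier) (ht : ∀ a, t a ∈ M.deg (deg a)) :
    free 𝒜 deg ⟶ M :=
  ofLin (Fintype.linearCombination A t) fun r v hv => by
    change ∑ a, (show I → A from v) a • t a ∈ M.deg r
    refine Submodule.sum_mem _ fun a _ => ?_
    have := M.smul_mem (hv a trivial) (ht a)
    rwa [sub_add_cancel] at this

/-- Arbitrary preimages of the images of the basis may be replaced by their components of degree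
`deg a`: graded maps commute with the projections, so these are still preimages. -/
instance projective_free : Projective (free 𝒜 deg) where
  factors {X Y} f e _ := by
    classical
    choose t ht using fun a => surjective_of_epi e (lin f (Pi.single (M := fun _ => A) a 1))
    refine ⟨freeLift deg X (fun a => X.proj (deg a) (t a)) fun a => X.proj_mem _ _,
      hom_ext fun v => ?_⟩
    have h : ∀ a, lin e (X.proj (deg a) (t a)) = lin f (Pi.single (M := fun _ => A) a 1) :=
      fun a => by rw [lin_proj, ht, Y.proj_same (lin_mem f (single_mem_deg deg a))]
    let L : (I → A) →ₗ[A] Y.carrier := lin f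
    have hv : ∀ v : I → A, lin e (∑ a, v a • X.proj (deg a) (t a)) = L v := fun v => by
      conv_rhs => rw [pi_eq_sum_univ' v]
      rw [map_sum, map_sum]
      refine Finset.sum_congr rfl fun a _ => ?_
      rw [map_smul, map_smul, h]
      rfl
    exact hv v

/-- Every finitely generated graded module is a quotient of a graded free module of finite
rank. -/
theorem exists_free_surjective (M : GrMod 𝒜) [Module.Finite A M.carrier] :
    ∃ (n : ℕ) (deg : Fin n → ι) (f : free 𝒜 deg ⟶ M), Function.Surjective (lin f) := by
  have h : Submodule.span A {m | ∃ i, m ∈ M.deg i} = ⊤ := by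
    rw [eq_top_iff]
    intro m _
    exact M.mem_of_proj_mem ((Submodule.span A {m | ∃ i, m ∈ M.deg i}).restrictScalars k) m
      fun i => Submodule.subset_span ⟨i, M.proj_mem i m⟩
  obtain ⟨s, hs, hs'⟩ := Submodule.fg_span_iff_fg_span_finset_subset _ |>.1
    (h ▸ Module.Finite.fg_top : (Submodule.span A {m | ∃ i, m ∈ M.deg i}).FG)
  let t : Fin s.card → M.carrier := fun j => (s.equivFin.symm j).1
  have ht : Set.range t = s := by
    have : t = Subtype.val ∘ s.equivFin.symm := rfl
    rw [this, Set.range_comp, s.equivFin.symm.surjective.range_eq, Set.image_univ]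
    simp
  choose deg hdeg using fun j => hs (s.equivFin.symm j).2
  refine ⟨s.card, deg, freeLift deg M t hdeg, ?_⟩
  rw [← LinearMap.range_eq_top]
  change LinearMap.range (Fintype.linearCombination A t) = ⊤
  rw [Fintype.range_linearCombination, ht, ← hs', h]

/-- The matrix of a graded map between graded free modules is homogeneous. -/
theorem toMatrixRight'_mem [DecidableEq I] {J : Type} [Fintype J] (deg' : J → ι)
    (f : (I → A) →ₗ[A] (J → A))
    (hf : ∀ r, ∀ v : I → A, (∀ a, v a ∈ 𝒜 (r - deg a)) → ∀ b, f v b ∈ 𝒜 (r - deg' b)) (a : I)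
    (b : J) : LinearMap.toMatrixRight' f a b ∈ 𝒜 (deg a - deg' b) :=
  hf (deg a) _ (fun c => single_mem_deg (𝒜 := 𝒜) deg a c trivial) b

end Free

end GrMod

end GradedFree

/-! ### Homology of complexes of graded modules -/

section Homology

variable {k A : Type u} {ι : Type} [Field k] [Ring A] [Algebra k A] [AddCommGroup ι]
  [DecidableEq ι] {𝒜 : ι → Submodule k A}

namespace GrMod

theorem isZero_iff_subsingleton (M : GrMod 𝒜) : IsZero M ↔ Subsingleton M.carrier := by
  rw [IsZero.iff_id_eq_zero]
  constructor
  · intro h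
    have h' : ∀ m : M.carrier, m = 0 := fun m => LinearMap.congr_fun (congrArg lin h) m
    exact ⟨fun x y => (h' x).trans (h' y).symm⟩
  · intro h
    exact hom_ext fun m => Subsingleton.elim _ _

/-- The `k`-linear equivalence underlying an isomorphism. -/
def linEquiv {M N : GrMod 𝒜} (e : M ≅ N) : M.carrier ≃ₗ[k] N.carrier :=
  LinearEquiv.ofLinearMap ((lin e.hom).restrictScalars k) ((lin e.inv).restrictScalars k)
    (LinearMap.ext fun m => LinearMap.congr_fun (congrArg lin e.inv_hom_id) m)
    (LinearMap.ext fun m => LinearMap.congr_fun (congrArg lin e.hom_inv_id) m)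

variable (S : ShortComplex (GrMod 𝒜))

/-- The homology of a short complex of graded modules as the quotient of the kernel by the
range. -/
def leftHomologyData : S.LeftHomologyData :=
  have hi := isLimitOfInjective (kerι S.g) S.g Subtype.val_injective (kerι_comp S.g)
    (Submodule.range_subtype _).ge
  { K := S.X₂.sub (LinearMap.ker (lin S.g)) (ker_homogeneous S.g)
    H := quot _ (LinearMap.range (lin (hi.lift (KernelFork.ofι _ S.zero)))) (range_homogeneous _)
    i := kerι S.g
    π := cokerπ (hi.lift (KernelFork.ofι _ S.zero))
    wi := kerι_comp S.g
    hi := hi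
    wπ := comp_cokerπ _
    hπ := isColimitOfSurjective _ (cokerπ (hi.lift (KernelFork.ofι _ S.zero)))
      (Submodule.mkQ_surjective _) _ (Submodule.ker_mkQ _).le }

theorem leftHomologyData_range (S : ShortComplex (GrMod 𝒜))
    (z : LinearMap.ker (lin S.g)) :
    z ∈ LinearMap.range (lin (leftHomologyData S).f') ↔ z.1 ∈ LinearMap.range (lin S.f) := by
  have e : ∀ x, (show LinearMap.ker (lin S.g) from lin (leftHomologyData S).f' x).1 = lin S.f x :=
    fun x => LinearMap.congr_fun (congrArg lin (leftHomologyData S).f'_i) x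
  constructor
  · rintro ⟨x, rfl⟩
    exact ⟨x, (e x).symm⟩
  · rintro ⟨x, hx⟩
    exact ⟨x, Subtype.ext ((e x).trans hx)⟩

/-- The projection of the cycles onto the homology. -/
def homologyProj : LinearMap.ker (lin S.g) →ₗ[A] S.homology.carrier :=
  lin ((leftHomologyData S).π ≫ (leftHomologyData S).homologyIso.inv)

theorem homologyProj_surjective : Function.Surjective (homologyProj S) := by
  have : Epi ((leftHomologyData S).π ≫ (leftHomologyData S).homologyIso.inv) := inferInstance
  exact surjective_of_epi _

theorem homologyProj_eq_zero_iff (z : LinearMap.ker (lin S.g)) :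
    homologyProj S z = 0 ↔ z.1 ∈ LinearMap.range (lin S.f) := by
  rw [← leftHomologyData_range]
  have h : homologyProj S z =
      linEquiv (leftHomologyData S).homologyIso.symm (lin (leftHomologyData S).π z) := rfl
  rw [h, LinearEquiv.map_eq_zero_iff]
  exact Submodule.Quotient.mk_eq_zero _

theorem finiteDimensional_homology_iff :
    FiniteDimensional k S.homology.carrier ↔
      FiniteModulo ((LinearMap.ker (lin S.g)).restrictScalars k)
        ((LinearMap.range (lin S.f)).restrictScalars k) := by
  let K := (LinearMap.ker (lin S.g)).restrictScalars k
  let p : K →ₗ[k] S.homology.carrier := (homologyProj S).restrictScalars k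
  let j : K →ₗ[k] S.X₂.carrier := K.subtype
  have hp : Function.Surjective p := homologyProj_surjective S
  constructor
  · intro h
    obtain ⟨T, hT, -, h'⟩ := FiniteModulo.of_fg_map (Z := ⊤) (R := LinearMap.ker p) p inf_le_right
      (Module.Finite.iff_fg.1 inferInstance)
    have := FiniteModulo.map ⟨T, hT, h'⟩ j
    refine this.mono (by rw [Submodule.map_top, Submodule.range_subtype]) ?_
    rintro _ ⟨z, hz, rfl⟩
    exact (homologyProj_eq_zero_iff S z).1 hz
  · intro h
    obtain ⟨T, hT, -, h'⟩ := FiniteModulo.comap (Z := ⊤) j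
      (h.mono (by rw [Submodule.map_top, Submodule.range_subtype]) le_rfl)
    have h₂ : (⊤ : Submodule k S.homology.carrier) ≤ T.map p := by
      intro x _
      obtain ⟨z, rfl⟩ := hp x
      obtain ⟨r, hr, t, ht, rfl⟩ := Submodule.mem_sup.1 (h' (Submodule.mem_top (x := z)))
      have : p r = 0 := (homologyProj_eq_zero_iff S r).2 hr
      exact ⟨t, ht, by simp [this]⟩
    exact ⟨top_le_iff.1 h₂ ▸ hT.map p⟩

theorem isZero_homology_iff :
    IsZero S.homology ↔ LinearMap.ker (lin S.g) ≤ LinearMap.range (lin S.f) := by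
  rw [isZero_iff_subsingleton]
  constructor
  · intro h z hz
    exact (homologyProj_eq_zero_iff S ⟨z, hz⟩).1 (Subsingleton.elim _ _)
  · intro h
    have h' : ∀ x : S.homology.carrier, x = 0 := fun x => by
      obtain ⟨z, rfl⟩ := homologyProj_surjective S x
      exact (homologyProj_eq_zero_iff S z).2 (h z.2)
    exact ⟨fun x y => (h' x).trans (h' y).symm⟩

end GrMod

-- The zero map to the zero object induces isomorphisms on all homology objects, and in the derived
-- category such a map is an isomorphism.
open ZeroObject in
theorem DerivedCategory.isZero_of_isZero_homology {C : Type*} [Category* C] [Abelian C]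
    [HasDerivedCategory C] (X : DerivedCategory C)
    (h : ∀ n, IsZero ((DerivedCategory.homologyFunctor C n).obj X)) : IsZero X := by
  have h₀ : IsZero (0 : DerivedCategory C) := isZero_zero _
  have : IsIso (0 : X ⟶ 0) := by
    rw [DerivedCategory.isIso_iff]
    exact fun n => ⟨0, (h n).eq_of_src _ _,
      ((DerivedCategory.homologyFunctor C n).map_isZero h₀).eq_of_src _ _⟩
  exact h₀.of_iso (asIso (0 : X ⟶ 0))

open GrMod in
/-- The `ε`-condition in terms of bounded complexes of finitely generated projective modules. -/
theorem epsilonCondition_iff_exists_complex :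
    EpsilonCondition 𝒜 ↔ ∃ P : CochainComplex (GrMod 𝒜) ℤ,
      (∃ a b : ℤ, P.IsStrictlyGE a ∧ P.IsStrictlyLE b) ∧
      (∀ n, Projective (P.X n) ∧ Module.Finite A (P.X n).carrier) ∧
      (∀ n, FiniteModulo ((LinearMap.ker (lin (P.d n (n + 1)))).restrictScalars k)
        ((LinearMap.range (lin (P.d (n - 1) n))).restrictScalars k)) ∧
      ∃ n, ¬ LinearMap.ker (lin (P.d n (n + 1))) ≤ LinearMap.range (lin (P.d (n - 1) n)) := by
  have key : ∀ (P : CochainComplex (GrMod 𝒜) ℤ) (n : ℤ),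
      Nonempty ((DerivedCategory.homologyFunctor (GrMod 𝒜) n).obj (DerivedCategory.Q.obj P) ≅
        (P.sc' (n - 1) n (n + 1)).homology) := fun P n =>
    ⟨(DerivedCategory.homologyFunctorFactors (GrMod 𝒜) n).app P ≪≫
      ShortComplex.homologyMapIso (P.isoSc' (n - 1) n (n + 1) (by simp) (by simp))⟩
  constructor
  · rintro ⟨X, hX⟩
    obtain ⟨⟨P, hb, hP, ⟨e⟩⟩, hfin⟩ := X.property
    have e' : ∀ n, Nonempty ((DerivedCategory.homologyFunctor (GrMod 𝒜) n).obj X.obj.obj ≅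
        (P.sc' (n - 1) n (n + 1)).homology) := fun n =>
      ⟨(DerivedCategory.homologyFunctor (GrMod 𝒜) n).mapIso e.symm ≪≫ (key P n).some⟩
    refine ⟨P, hb, hP, fun n => ?_, ?_⟩
    · refine (finiteDimensional_homology_iff (P.sc' (n - 1) n (n + 1))).1 ?_
      have := hfin n
      exact (linEquiv (e' n).some).finiteDimensional
    · by_contra! h
      have h₁ : IsZero X.obj.obj := DerivedCategory.isZero_of_isZero_homology _ fun n =>
        ((isZero_homology_iff (P.sc' (n - 1) n (n + 1))).2 (h n)).of_iso (e' n).some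
      have h₂ : IsZero X.obj := IsZero.of_full_of_faithful_of_isZero (ObjectProperty.ι _) _ h₁
      exact hX (IsZero.of_full_of_faithful_of_isZero (ObjectProperty.ι _) _ h₂)
  · rintro ⟨P, ⟨a, b, ha, hb⟩, hP, hfin, n, hn⟩
    let Y : DerivedCategory.Bounded (GrMod 𝒜) := ⟨DerivedCategory.Q.obj P,
      ⟨a, (inferInstance : (DerivedCategory.Q.obj P).IsGE a)⟩,
      ⟨b, (inferInstance : (DerivedCategory.Q.obj P).IsLE b)⟩⟩
    let X : (epsilonObjects 𝒜).FullSubcategory := ⟨Y,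
      ⟨P, ⟨a, b, ha, hb⟩, hP, ⟨Iso.refl _⟩⟩, fun m => by
        have := (finiteDimensional_homology_iff (P.sc' (m - 1) m (m + 1))).2 (hfin m)
        exact (linEquiv (key P m).some.symm).finiteDimensional⟩
    refine ⟨X, fun h => hn ?_⟩
    refine (isZero_homology_iff (P.sc' (n - 1) n (n + 1))).1 ?_
    exact ((((epsilonObjects 𝒜).ι ⋙ ObjectProperty.ι _ ⋙
      DerivedCategory.homologyFunctor (GrMod 𝒜) n).map_isZero h)).of_iso (key P n).some.symm

end Homology

/-! ### Complexes presented by matrices and the `ε`-condition -/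

section MatrixModels

open Matrix

variable {k A : Type u} {ι : Type} [Field k] [Ring A] [Algebra k A] [AddCommGroup ι]

namespace MatComplex

variable {𝒜 : ι → Submodule k A} (X : MatComplex 𝒜)

/-- The part of the idempotent in position `n`. -/
def R (n : ℤ) : Matrix X.I X.I A := Matrix.of fun a b => if X.pos a = n then X.E a b else 0

theorem R_apply (n : ℤ) (a b : X.I) : X.R n a b = if X.pos a = n then X.E a b else 0 := rfl

theorem R_apply' (n : ℤ) (a b : X.I) : X.R n a b = if X.pos b = n then X.E a b else 0 := by
  rw [R_apply]
  by_cases h : X.E a b = 0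
  · simp [h]
  · rw [X.E_pos a b h]

theorem R_mem (n : ℤ) (a b : X.I) : X.R n a b ∈ 𝒜 (X.deg a - X.deg b) := by
  rw [R_apply]
  split_ifs
  · exact X.E_mem a b
  · exact zero_mem _

theorem R_mul_apply (n : ℤ) (M : Matrix X.I X.I A) (a b : X.I) :
    (X.R n * M) a b = if X.pos a = n then (X.E * M) a b else 0 := by
  simp only [mul_apply, R_apply]
  split_ifs <;> simp

theorem R_mul_E (n : ℤ) : X.R n * X.E = X.R n := by
  ext a b
  rw [R_mul_apply, X.EE, R_apply]

theorem E_mul_R (n : ℤ) : X.E * X.R n = X.R n := by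
  ext a b
  have : (X.E * X.R n) a b = if X.pos b = n then (X.E * X.E) a b else 0 := by
    simp only [mul_apply, R_apply']
    split_ifs <;> simp
  rw [this, X.EE, R_apply']

theorem R_mul_R (n : ℤ) : X.R n * X.R n = X.R n := by
  ext a b
  rw [R_mul_apply, E_mul_R, R_apply]
  split_ifs <;> rfl

theorem R_mul_R_of_ne {n m : ℤ} (h : n ≠ m) : X.R n * X.R m = 0 := by
  ext a b
  rw [R_mul_apply, E_mul_R, R_apply]
  split_ifs with h₁ h₂
  · exact absurd (h₁.symm.trans h₂) h
  · rfl
  · rfl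

/-- `D` raises the position by one, so cutting out a position before `D` is the same as cutting out
the next one after `D`. -/
theorem R_mul_D (n : ℤ) : X.R n * X.D = X.D * X.R (n + 1) := by
  ext a b
  have : (X.D * X.R (n + 1)) a b = if X.pos b = n + 1 then (X.D * X.E) a b else 0 := by
    simp only [mul_apply, R_apply']
    split_ifs <;> simp
  rw [R_mul_apply, this, X.ED, X.DE]
  by_cases h : X.D a b = 0
  · simp [h]
  · simp [X.D_pos a b h]

/-- The positions that occur. -/
def support : Finset ℤ := Finset.univ.image X.pos

theorem R_eq_zero {n : ℤ} (hn : n ∉ X.support) : X.R n = 0 := by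
  ext a b
  rw [R_apply, if_neg]
  · rfl
  · rintro rfl
    exact hn (Finset.mem_image_of_mem _ (Finset.mem_univ a))

theorem sum_R : ∑ n ∈ X.support, X.R n = X.E := by
  ext a b
  rw [Matrix.sum_apply, Finset.sum_eq_single (X.pos a)]
  · simp [R_apply]
  · exact fun n _ hn => if_neg hn.symm
  · exact fun h => absurd (Finset.mem_image_of_mem _ (Finset.mem_univ a)) h

theorem vecMul_R_mem_cycles {v : X.I → A} (hv : v ᵥ* X.D = 0) (n : ℤ) :
    v ᵥ* X.R n ∈ X.cycles := by
  refine mem_cycles.2 ⟨by rw [vecMul_vecMul, R_mul_E], ?_⟩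
  rw [vecMul_vecMul, R_mul_D, ← vecMul_vecMul, hv, zero_vecMul]

theorem mem_of_vecMul_R_mem {S : Submodule A (X.I → A)} {v : X.I → A} (hv : v ᵥ* X.E = v)
    (h : ∀ n, v ᵥ* X.R n ∈ S) : v ∈ S := by
  have : v = ∑ n ∈ X.support, v ᵥ* X.R n := by
    rw [← Matrix.vecMul_sum, sum_R, hv]
  rw [this]
  exact S.sum_mem fun n _ => h n

end MatComplex

variable [DecidableEq ι] {𝒜 : ι → Submodule k A} [GradedAlgebra 𝒜]

namespace GrMod

/-- The graded map between graded free modules given by a homogeneous matrix. -/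
def matHom {I J : Type} [Fintype I] [Fintype J] {deg : I → ι} {deg' : J → ι} (M : Matrix I J A)
    (hM : ∀ a b, M a b ∈ 𝒜 (deg a - deg' b)) : free 𝒜 deg ⟶ free 𝒜 deg' :=
  ofLin (M := free 𝒜 deg) (N := free 𝒜 deg') M.vecMulLinear fun r v hv b _ => by
    change ∑ a, (show I → A from v) a * M a b ∈ 𝒜 (r - deg' b)
    refine Submodule.sum_mem _ fun a _ => ?_
    have := SetLike.mul_mem_graded (hv a trivial) (hM a b)
    rwa [sub_add_sub_cancel] at this

/-- A finitely generated projective graded module has a homogeneous dual basis. -/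
theorem exists_dual_basis (M : GrMod 𝒜) [Projective M] [Module.Finite A M.carrier] :
    ∃ (n : ℕ) (deg : Fin n → ι) (p : (Fin n → A) →ₗ[A] M.carrier)
      (s : M.carrier →ₗ[A] (Fin n → A)), (∀ m, p (s m) = m) ∧
      (∀ r v, (∀ a, v a ∈ 𝒜 (r - deg a)) → p v ∈ M.deg r) ∧
      (∀ r, ∀ m ∈ M.deg r, ∀ a, s m a ∈ 𝒜 (r - deg a)) := by
  obtain ⟨n, deg, f, hf⟩ := M.exists_free_surjective
  have := epi_of_surjective f hf
  refine ⟨n, deg, lin f, lin (Projective.factorThru (𝟙 M) f), fun m => ?_, fun r v hv => ?_,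
    fun r m hm a => ?_⟩
  · exact LinearMap.congr_fun (congrArg lin (Projective.factorThru_comp (𝟙 M) f)) m
  · exact lin_mem f ((free_mem_deg deg).2 hv)
  · exact lin_mem (Projective.factorThru (𝟙 M) f) hm a trivial

end GrMod

namespace MatComplex

open GrMod

variable (X : MatComplex 𝒜)

/-- The term of the complex of graded modules in position `n`. -/
def term (n : ℤ) : GrMod 𝒜 :=
  (free 𝒜 X.deg).sub (LinearMap.range (lin (matHom (X.R n) (X.R_mem n)))) (range_homogeneous _)

/-- The inclusion of a term into the graded free module. -/
def incl (n : ℤ) : X.term n ⟶ free 𝒜 X.deg :=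
  ofLin (Submodule.subtype _) fun _ _ hm => hm

/-- The projection of the graded free module onto a term. -/
def retr (n : ℤ) : free 𝒜 X.deg ⟶ X.term n :=
  ofLin (LinearMap.rangeRestrict (lin (matHom (X.R n) (X.R_mem n))))
    fun _ _ hm => lin_mem (matHom (X.R n) (X.R_mem n)) hm

/-- The underlying row of an element of a term. -/
def row (n : ℤ) : (X.term n).carrier →ₗ[A] (X.I → A) := lin (X.incl n)

theorem row_injective (n : ℤ) : Function.Injective (X.row n) := Subtype.val_injective

theorem row_retr (n : ℤ) (v : X.I → A) : X.row n (lin (X.retr n) v) = v ᵥ* X.R n := rfl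

theorem row_vecMul_R (n : ℤ) (x : (X.term n).carrier) : X.row n x ᵥ* X.R n = X.row n x := by
  obtain ⟨v, hv⟩ := x.2
  change X.I → A at v
  have : X.row n x = v ᵥ* X.R n := hv.symm
  rw [this, vecMul_vecMul, R_mul_R]

theorem incl_retr (n : ℤ) : X.incl n ≫ X.retr n = 𝟙 _ :=
  hom_ext fun x => X.row_injective n (X.row_vecMul_R n x)

/-- The differential between two terms. -/
def diff (i j : ℤ) : X.term i ⟶ X.term j := X.incl i ≫ matHom X.D X.D_mem ≫ X.retr j

theorem row_diff (i j : ℤ) (x : (X.term i).carrier) :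
    X.row j (lin (X.diff i j) x) = X.row i x ᵥ* X.D ᵥ* X.R j := rfl

theorem row_diff_of_eq {i j : ℤ} (h : i + 1 = j) (x : (X.term i).carrier) :
    X.row j (lin (X.diff i j) x) = X.row i x ᵥ* X.D := by
  subst h
  rw [row_diff, vecMul_vecMul, ← R_mul_D, ← vecMul_vecMul, row_vecMul_R]

/-- The complex of graded modules presented by matrices. -/
def toComplex : CochainComplex (GrMod 𝒜) ℤ where
  X := X.term
  d := X.diff
  -- `diff` is defined for all pairs. Off the successive ones, `x R_i D R_j = x D R_{i+1} R_j`
  -- vanishes because the idempotents of different positions are orthogonal.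
  shape i j hij := hom_ext fun x => X.row_injective j <| by
    rw [row_diff, ← row_vecMul_R, vecMul_vecMul _ (X.R i), R_mul_D, vecMul_vecMul,
      Matrix.mul_assoc, X.R_mul_R_of_ne (fun h => hij h)]
    simp
  d_comp_d' i j l hij hjl := by
    obtain rfl : i + 1 = j := hij
    obtain rfl : i + 1 + 1 = l := hjl
    exact hom_ext fun x => X.row_injective _ <| by
      rw [lin_comp, LinearMap.comp_apply, row_diff_of_eq X rfl, row_diff_of_eq X rfl,
        vecMul_vecMul, X.DD]
      simp

theorem isZero_term {n : ℤ} (hn : n ∉ X.support) : IsZero (X.term n) := by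
  rw [isZero_iff_subsingleton]
  have h : ∀ x : (X.term n).carrier, x = 0 := fun x => X.row_injective n <| by
    rw [← row_vecMul_R, X.R_eq_zero hn, vecMul_zero, map_zero]
  exact ⟨fun x y => (h x).trans (h y).symm⟩

/-- A preimage in the total complex may be cut down to its part in position `n - 1`. -/
theorem mem_range_diff {n : ℤ} {x : (X.term n).carrier} (hx : X.row n x ∈ X.boundaries) :
    x ∈ LinearMap.range (lin (X.diff (n - 1) n)) := by
  obtain ⟨u, hu⟩ := mem_boundaries.1 hx
  refine ⟨lin (X.retr (n - 1)) u, X.row_injective n ?_⟩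
  rw [row_diff, row_retr, vecMul_vecMul u, R_mul_D, vecMul_vecMul, sub_add_cancel,
    Matrix.mul_assoc, R_mul_R, ← vecMul_vecMul, hu, row_vecMul_R]

end MatComplex

-- The total homology of the matrices is the sum of the homologies of the positions: finiteness
-- restricts to each position, and if every position were exact, every cycle, being the sum of its
-- parts `v R_n`, would be a boundary.
open GrMod in
theorem HasEpsilonMatrices.epsilonCondition (h : HasEpsilonMatrices 𝒜) : EpsilonCondition 𝒜 := by
  obtain ⟨X, hfin, hne⟩ := h
  have hker : ∀ n, ∀ x ∈ LinearMap.ker (lin (X.diff n (n + 1))), X.row n x ∈ X.cycles := by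
    intro n x hx
    rw [← X.row_vecMul_R]
    refine X.vecMul_R_mem_cycles ?_ n
    rw [← X.row_diff_of_eq rfl, LinearMap.mem_ker.1 hx, map_zero]
  rw [epsilonCondition_iff_exists_complex]
  refine ⟨X.toComplex, ?_, fun n => ⟨?_, ?_⟩, fun n => ?_, ?_⟩
  · obtain ⟨a, ha⟩ := X.support.bddBelow
    obtain ⟨b, hb⟩ := X.support.bddAbove
    refine ⟨a, b, ?_, ?_⟩
    · rw [CochainComplex.isStrictlyGE_iff]
      exact fun i hi => X.isZero_term fun h => (ha h).not_gt hi
    · rw [CochainComplex.isStrictlyLE_iff]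
      exact fun i hi => X.isZero_term fun h => (hb h).not_gt hi
  · exact (Retract.mk _ _ (X.incl_retr n)).projective
  · have : Module.Finite A (free 𝒜 X.deg).carrier :=
      inferInstanceAs (Module.Finite A (X.I → A))
    exact Module.Finite.of_surjective (lin (X.retr n)) (LinearMap.surjective_rangeRestrict _)
  · obtain ⟨S, hS, -, h⟩ := FiniteModulo.comap
      (Z := (LinearMap.ker (lin (X.diff n (n + 1)))).restrictScalars k)
      ((X.row n).restrictScalars k) (hfin.mono (by
        rintro _ ⟨x, hx, rfl⟩
        exact hker n x hx) le_rfl)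
    exact ⟨S, hS, h.trans (sup_le_sup_right (fun x hx => X.mem_range_diff hx) S)⟩
  · by_contra! h
    refine hne fun v hv => X.mem_of_vecMul_R_mem (MatComplex.mem_cycles.1 hv).1 fun n => ?_
    have hx : lin (X.retr n) v ∈ LinearMap.ker (lin (X.diff n (n + 1))) := by
      refine X.row_injective _ ?_
      rw [X.row_diff_of_eq rfl, X.row_retr, vecMul_vecMul, X.R_mul_D, ← vecMul_vecMul,
        (MatComplex.mem_cycles.1 hv).2, zero_vecMul, map_zero]
    obtain ⟨y, hy⟩ := h n hx
    refine ⟨X.row (n - 1) y, ?_⟩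
    exact (X.row_diff_of_eq (sub_add_cancel n 1) y).symm.trans (congrArg (X.row n) hy)

end MatrixModels

/-! ### From bounded complexes of projectives to matrices -/

section ComplexToMatrix

open Matrix GrMod

variable {k A : Type u} {ι : Type} [Field k] [Ring A] [Algebra k A] [AddCommGroup ι]
  [DecidableEq ι] {𝒜 : ι → Submodule k A}

section Total

variable (P : CochainComplex (GrMod 𝒜) ℤ) (a b : ℤ)

/-- The total differential of the terms in a range of positions. -/
def totalDiff : (∀ n : Finset.Icc a b, (P.X n).carrier) →ₗ[A]
    (∀ n : Finset.Icc a b, (P.X n).carrier) :=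
  LinearMap.pi fun j => ∑ i : Finset.Icc a b, lin (P.d i j) ∘ₗ LinearMap.proj i

variable {P a b}

theorem totalDiff_apply (p : ∀ n : Finset.Icc a b, (P.X n).carrier) (j : Finset.Icc a b) :
    totalDiff P a b p j = ∑ i : Finset.Icc a b, lin (P.d i j) (p i) := by
  simp [totalDiff]

theorem lin_d_eq_zero {i j : ℤ} (h : i + 1 ≠ j) (x : (P.X i).carrier) : lin (P.d i j) x = 0 := by
  rw [P.shape i j h]
  rfl

theorem totalDiff_eq (p : ∀ n : Finset.Icc a b, (P.X n).carrier) (i j : Finset.Icc a b)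
    (h : i.1 + 1 = j) : totalDiff P a b p j = lin (P.d i j) (p i) := by
  rw [totalDiff_apply]
  exact Finset.sum_eq_single i
    (fun l _ hl => lin_d_eq_zero (fun e => hl (Subtype.ext (by omega))) _)
    fun h => absurd (Finset.mem_univ _) h

theorem totalDiff_eq_zero (p : ∀ n : Finset.Icc a b, (P.X n).carrier) (j : Finset.Icc a b)
    (h : j.1 - 1 < a) : totalDiff P a b p j = 0 := by
  rw [totalDiff_apply]
  refine Finset.sum_eq_zero fun l _ => lin_d_eq_zero (fun e => ?_) _
  have := (Finset.mem_Icc.1 l.2).1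
  omega

theorem totalDiff_totalDiff (p : ∀ n : Finset.Icc a b, (P.X n).carrier) :
    totalDiff P a b (totalDiff P a b p) = 0 := by
  funext j
  rw [totalDiff_apply]
  refine Finset.sum_eq_zero fun i _ => ?_
  rw [totalDiff_apply, map_sum]
  exact Finset.sum_eq_zero fun l _ =>
    LinearMap.congr_fun (congrArg lin (P.d_comp_d l i j)) (p l)

theorem totalDiff_single (i : Finset.Icc a b) (x : (P.X i).carrier) (j : Finset.Icc a b) :
    totalDiff P a b (Pi.single i x) j = lin (P.d i j) x := by
  rw [totalDiff_apply, Finset.sum_eq_single i]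
  · simp
  · intro l _ hl
    rw [Pi.single_eq_of_ne hl, map_zero]
  · exact fun h => absurd (Finset.mem_univ _) h

theorem mem_ker_of_totalDiff_eq_zero (hb : P.IsStrictlyLE b)
    {p : ∀ n : Finset.Icc a b, (P.X n).carrier} (hp : totalDiff P a b p = 0)
    (i : Finset.Icc a b) : p i ∈ LinearMap.ker (lin (P.d i (i.1 + 1))) := by
  have hi := Finset.mem_Icc.1 i.2
  rw [LinearMap.mem_ker]
  by_cases h : i.1 + 1 ≤ b
  · rw [← totalDiff_eq p i ⟨i.1 + 1, Finset.mem_Icc.2 ⟨by omega, h⟩⟩ rfl, hp]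
    rfl
  · have := (isZero_iff_subsingleton _).1 (P.isZero_of_isStrictlyLE b (i.1 + 1) (by omega))
    exact Subsingleton.elim _ _

theorem mem_range_totalDiff (ha : P.IsStrictlyGE a)
    {p : ∀ n : Finset.Icc a b, (P.X n).carrier}
    (hp : ∀ i : Finset.Icc a b, p i ∈ LinearMap.range (lin (P.d (i.1 - 1) i))) :
    p ∈ LinearMap.range (totalDiff P a b) := by
  rw [← Finset.univ_sum_single p]
  refine Submodule.sum_mem _ fun i _ => ?_
  obtain ⟨x, hx⟩ := hp i
  have hi := Finset.mem_Icc.1 i.2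
  by_cases h : a ≤ i.1 - 1
  · let l : Finset.Icc a b := ⟨i.1 - 1, Finset.mem_Icc.2 ⟨h, by omega⟩⟩
    refine ⟨Pi.single l x, funext fun j => ?_⟩
    rw [totalDiff_single]
    by_cases hj : j = i
    · subst hj
      rw [Pi.single_eq_same]
      exact hx
    · rw [Pi.single_eq_of_ne hj]
      refine lin_d_eq_zero (fun e => hj (Subtype.ext ?_)) _
      have : l.1 = i.1 - 1 := rfl
      omega
  · have := (isZero_iff_subsingleton _).1 (P.isZero_of_isStrictlyGE a (i.1 - 1) (by omega))
    rw [Subsingleton.elim x 0, map_zero] at hx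
    rw [← hx, Pi.single_zero]
    exact zero_mem _

end Total

variable [GradedAlgebra 𝒜]

/-- Dual bases of all the terms give a retraction `πt` of a free module onto the sum `T` of the
terms, with section `st`. The matrices are those of `st πt` and `st d πt`, so the rows fixed by `E`
form a copy of `T` with its total differential. -/
theorem EpsilonCondition.hasEpsilonMatrices (h : EpsilonCondition 𝒜) : HasEpsilonMatrices 𝒜 := by
  rw [epsilonCondition_iff_exists_complex] at h
  obtain ⟨P, ⟨a, b, ha, hb⟩, hP, hfin, n₀, hn₀⟩ := h
  have hex : ∀ n, _ := fun n =>
    have := (hP n).1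
    have := (hP n).2
    (P.X n).exists_dual_basis
  choose m deg p s hps hp hs using hex
  let N := Finset.Icc a b
  let I := Σ n : N, Fin (m n)
  let inc : ∀ n : N, Fin (m n) → I := fun n j => ⟨n, j⟩
  let T := ∀ n : N, (P.X n).carrier
  let πt : (I → A) →ₗ[A] T := LinearMap.pi fun n => p n ∘ₗ LinearMap.funLeft A A (inc n)
  let st : T →ₗ[A] (I → A) := LinearMap.pi fun c =>
    LinearMap.proj c.2 ∘ₗ s c.1 ∘ₗ LinearMap.proj c.1
  let dt : T →ₗ[A] T := totalDiff P a b
  have hπs : πt ∘ₗ st = LinearMap.id := LinearMap.ext fun t => funext fun n => hps n (t n)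
  have hπs' : ∀ t, πt (st t) = t := LinearMap.congr_fun hπs
  have hdd : dt ∘ₗ dt = 0 := LinearMap.ext totalDiff_totalDiff
  let dg : I → ι := fun c => deg c.1 c.2
  have hπt : ∀ r (v : I → A), (∀ c, v c ∈ 𝒜 (r - dg c)) → ∀ n : N, πt v n ∈ (P.X n).deg r :=
    fun r v hv n => hp n r _ fun j => hv ⟨n, j⟩
  have hst : ∀ r (t : T), (∀ n : N, t n ∈ (P.X n).deg r) → ∀ c, st t c ∈ 𝒜 (r - dg c) :=
    fun r t ht c => hs c.1 r _ (ht c.1) c.2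
  have hdt : ∀ r (t : T), (∀ n : N, t n ∈ (P.X n).deg r) → ∀ n : N, dt t n ∈ (P.X n).deg r :=
    fun r t ht n => by
      rw [totalDiff_apply]
      exact Submodule.sum_mem _ fun i _ => lin_mem _ (ht i)
  have hsingle : ∀ (c : I) (n : N), c.1 ≠ n → πt (Pi.single (M := fun _ => A) c 1) n = 0 := by
    intro c n hn
    have : (LinearMap.funLeft A A (inc n)) (Pi.single (M := fun _ => A) c 1) = 0 :=
      funext fun j => Pi.single_eq_of_ne (fun e => hn (congrArg Sigma.fst e).symm) _
    change p n ((LinearMap.funLeft A A (inc n)) (Pi.single (M := fun _ => A) c 1)) = 0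
    rw [this, map_zero]
  let X : MatComplex 𝒜 :=
    { I := I
      deg := dg
      pos := fun c => c.1
      E := LinearMap.toMatrixRight' (st ∘ₗ πt)
      D := LinearMap.toMatrixRight' (st ∘ₗ dt ∘ₗ πt)
      E_mem := toMatrixRight'_mem dg dg _ fun r v hv => hst r _ (hπt r v hv)
      D_mem := toMatrixRight'_mem dg dg _ fun r v hv => hst r _ (hdt r _ (hπt r v hv))
      E_pos := fun c c' h => by
        by_contra hc
        refine h ?_
        change s c'.1 (πt (Pi.single (M := fun _ => A) c 1) c'.1) c'.2 = 0
        rw [hsingle c c'.1 fun e => hc (congrArg Subtype.val e).symm, map_zero]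
        rfl
      D_pos := fun c c' h => by
        by_contra hc
        refine h ?_
        change s c'.1 (dt (πt (Pi.single (M := fun _ => A) c 1)) c'.1) c'.2 = 0
        have : dt (πt (Pi.single (M := fun _ => A) c 1)) c'.1 = 0 := by
          rw [totalDiff_apply]
          refine Finset.sum_eq_zero fun i _ => ?_
          by_cases hi : c.1 = i
          · subst hi
            exact lin_d_eq_zero (fun e => hc e.symm) _
          · rw [hsingle c i hi, map_zero]
        rw [this, map_zero]
        rfl
      EE := by
        rw [← LinearMap.toMatrixRight'_comp]
        exact congrArg _ (LinearMap.ext fun v => by simp [hπs'])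
      ED := by
        rw [← LinearMap.toMatrixRight'_comp]
        exact congrArg _ (LinearMap.ext fun v => by simp [hπs'])
      DE := by
        rw [← LinearMap.toMatrixRight'_comp]
        exact congrArg _ (LinearMap.ext fun v => by simp [hπs'])
      DD := by
        rw [← LinearMap.toMatrixRight'_comp, ← map_zero LinearMap.toMatrixRight']
        refine congrArg _ (LinearMap.ext fun v => ?_)
        have : dt (dt (πt v)) = 0 := LinearMap.congr_fun hdd _
        simp [hπs', this] }
  have hE : ∀ v, v ᵥ* X.E = st (πt v) := fun v =>
    LinearMap.congr_fun (LinearMap.toMatrixRight'.symm_apply_apply (st ∘ₗ πt)) v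
  have hD : ∀ v, v ᵥ* X.D = st (dt (πt v)) := fun v =>
    LinearMap.congr_fun (LinearMap.toMatrixRight'.symm_apply_apply (st ∘ₗ dt ∘ₗ πt)) v
  refine ⟨X, ?_, fun hle => hn₀ fun x hx => ?_⟩
  · have h₁ := (FiniteModulo.pi fun n : N => hfin n).map (st.restrictScalars k)
    refine h₁.mono (fun v hv => ?_) ?_
    · obtain ⟨hv₁, hv₂⟩ := MatComplex.mem_cycles.1 hv
      refine ⟨πt v, fun n _ => ?_, (hE v).symm.trans hv₁⟩
      refine mem_ker_of_totalDiff_eq_zero hb ?_ n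
      have := congrArg πt ((hD v).symm.trans hv₂)
      rwa [hπs', map_zero] at this
    · rintro _ ⟨t, ht, rfl⟩
      obtain ⟨u, rfl⟩ := mem_range_totalDiff ha fun i => ht i trivial
      exact ⟨st u, (hD _).trans (by rw [hπs']; rfl)⟩
  -- A cycle that is not a boundary, placed in position `n₀` of `T`, is mapped by `st` to a cycle of
  -- rows. Were this a boundary, the `n₀` component of a preimage equation in `T` would make the
  -- original a boundary.
  · by_cases hn : n₀ ∈ N
    · let n : N := ⟨n₀, hn⟩
      let t : T := Pi.single n x
      have ht : dt t = 0 := funext fun j => by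
        rw [totalDiff_single]
        by_cases hj : n₀ + 1 = j
        · have hj' : j = ⟨n₀ + 1, hj ▸ j.2⟩ := Subtype.ext hj.symm
          rw [hj']
          exact hx
        · exact lin_d_eq_zero hj _
      have hc : st t ∈ X.cycles := MatComplex.mem_cycles.2
        ⟨by rw [hE, hπs'], by rw [hD, hπs', ht, map_zero]⟩
      obtain ⟨u, hu⟩ := hle hc
      have h₂ : dt (πt u) = t := by
        have := congrArg πt ((hD u).symm.trans hu)
        rwa [hπs', hπs'] at this
      have h₃ : dt (πt u) n = x := by rw [h₂]; exact Pi.single_eq_same _ _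
      rw [← h₃]
      by_cases h : a ≤ n₀ - 1
      · have := Finset.mem_Icc.1 hn
        rw [totalDiff_eq (πt u) ⟨n₀ - 1, Finset.mem_Icc.2 ⟨h, by omega⟩⟩ n (sub_add_cancel _ _)]
        exact ⟨_, rfl⟩
      -- At the lowest position nothing maps in, so the component of a boundary is zero.
      · rw [totalDiff_eq_zero _ _ (not_le.1 h)]
        exact zero_mem _
    · have : Subsingleton (P.X n₀).carrier := by
        rw [← isZero_iff_subsingleton]
        by_cases h : n₀ < a
        · exact P.isZero_of_isStrictlyGE a n₀ h
        · exact P.isZero_of_isStrictlyLE b n₀ (by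
            by_contra h'
            exact hn (Finset.mem_Icc.2 ⟨by omega, by omega⟩))
      rw [Subsingleton.elim x 0]
      exact zero_mem _

/-- The `ε`-condition in terms of matrices. -/
theorem epsilonCondition_iff : EpsilonCondition 𝒜 ↔ HasEpsilonMatrices 𝒜 :=
  ⟨EpsilonCondition.hasEpsilonMatrices, HasEpsilonMatrices.epsilonCondition⟩

end ComplexToMatrix

/-! ### Regradings -/

section Regrade

open Matrix

variable {k A : Type u} {ι κ : Type} [Field k] [Ring A] [Algebra k A] [AddCommGroup ι]
  [AddCommGroup κ]

/-- The graded algebra structure given by an internal direct sum decomposition. -/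
@[reducible] def GradedAlgebra.ofIsInternal [DecidableEq ι] (𝒜 : ι → Submodule k A)
    (h₁ : (1 : A) ∈ 𝒜 0) (h₂ : ∀ i j, 𝒜 i * 𝒜 j ≤ 𝒜 (i + j)) (h : DirectSum.IsInternal 𝒜) : GradedAlgebra 𝒜 where
  one_mem := h₁
  mul_mem i j _ _ ha hb := h₂ i j (Submodule.mul_mem_mul ha hb)
  __ := h.chooseDecomposition

theorem mem_regrade (φ : ι →+ κ) {𝒜 : ι → Submodule k A} {i : ι} {a : A} (ha : a ∈ 𝒜 i) :
    a ∈ regrade φ 𝒜 (φ i) :=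
  Submodule.mem_iSup_of_mem i (Submodule.mem_iSup_of_mem rfl ha)

theorem regrade_le (φ : ι →+ κ) {𝒜 : ι → Submodule k A} {r : κ} {S : Submodule k A}
    (h : ∀ i, φ i = r → 𝒜 i ≤ S) : regrade φ 𝒜 r ≤ S :=
  iSup₂_le h

theorem isInternal_regrade [DecidableEq ι] [DecidableEq κ] (φ : ι →+ κ) (𝒜 : ι → Submodule k A)
    [GradedAlgebra 𝒜] : DirectSum.IsInternal (regrade φ 𝒜) := by
  let p : κ → A →ₗ[k] A := fun r => DirectSum.toModule k ι A
    (fun s => if φ s = r then (𝒜 s).subtype else 0) ∘ₗ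
      (DirectSum.decomposeLinearEquiv 𝒜).toLinearMap
  have hp : ∀ r s, ∀ a ∈ 𝒜 s, p r a = if φ s = r then a else 0 := by
    intro r s a ha
    have : DirectSum.decompose 𝒜 a = DirectSum.lof k _ (fun r => 𝒜 r) s ⟨a, ha⟩ :=
      DirectSum.decompose_of_mem 𝒜 ha
    simp only [p, LinearMap.comp_apply, LinearEquiv.coe_coe,
      DirectSum.decomposeLinearEquiv_apply, this, DirectSum.toModule_lof]
    split_ifs <;> rfl
  refine isInternal_of_proj _ p (fun r => ?_) (fun r r' h => ?_) ?_
  · have : regrade φ 𝒜 r ≤ LinearMap.eqLocus (p r) LinearMap.id :=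
      regrade_le φ fun i hi a ha => by simp [hp r i a ha, hi]
    exact this
  · have : regrade φ 𝒜 r ≤ LinearMap.ker (p r') :=
      regrade_le φ fun i hi a ha => by
        rw [LinearMap.mem_ker, hp r' i a ha, if_neg (fun e => h (hi.symm.trans e))]
    exact this
  · rw [eq_top_iff, ← (DirectSum.Decomposition.isInternal 𝒜).submodule_iSup_eq_top]
    exact iSup_le fun i a ha => Submodule.mem_iSup_of_mem (φ i) (mem_regrade φ ha)

instance GradedAlgebra.regrade [DecidableEq ι] [DecidableEq κ] (φ : ι →+ κ)
    (𝒜 : ι → Submodule k A) [GradedAlgebra 𝒜] : GradedAlgebra (regrade φ 𝒜) :=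
  GradedAlgebra.ofIsInternal _ (by simpa using mem_regrade φ (SetLike.one_mem_graded 𝒜))
    (fun r s => by
      simp only [_root_.regrade, Submodule.iSup_mul, Submodule.mul_iSup]
      refine iSup₂_le fun i hi => iSup₂_le fun j hj => ?_
      rw [Submodule.mul_le]
      intro a ha b hb
      have := mem_regrade φ (SetLike.mul_mem_graded ha hb)
      rwa [map_add, hi, hj] at this)
    (isInternal_regrade φ 𝒜)

/-- The regrading of a complex presented by matrices. -/
def MatComplex.regrade (φ : ι →+ κ) {𝒜 : ι → Submodule k A} (X : MatComplex 𝒜) :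
    MatComplex (regrade φ 𝒜) where
  I := X.I
  deg a := φ (X.deg a)
  pos := X.pos
  E := X.E
  D := X.D
  E_mem a b := by
    rw [← map_sub]
    exact mem_regrade φ (X.E_mem a b)
  D_mem a b := by
    rw [← map_sub]
    exact mem_regrade φ (X.D_mem a b)
  E_pos := X.E_pos
  D_pos := X.D_pos
  EE := X.EE
  ED := X.ED
  DE := X.DE
  DD := X.DD

theorem HasEpsilonMatrices.regrade (φ : ι →+ κ) {𝒜 : ι → Submodule k A}
    (h : HasEpsilonMatrices 𝒜) : HasEpsilonMatrices (regrade φ 𝒜) := by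
  obtain ⟨X, h₁, h₂⟩ := h
  exact ⟨X.regrade φ, h₁, h₂⟩

theorem EpsilonCondition.regrade [DecidableEq ι] [DecidableEq κ] (φ : ι →+ κ)
    {𝒜 : ι → Submodule k A} [GradedAlgebra 𝒜] (h : EpsilonCondition 𝒜) :
    EpsilonCondition (regrade φ 𝒜) :=
  (h.hasEpsilonMatrices.regrade φ).epsilonCondition

end Regrade

/-! ### Graded twists -/

section Twist

open Matrix

variable {k A A' : Type u} {ι : Type} [Field k] [Ring A] [Algebra k A] [Ring A'] [Algebra k A']
  [AddCommGroup ι]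

/-- The transfer of the `ε`-condition along a linear bijection that transforms the multiplication
of `A` into the twisted multiplication `a ⋆ b = τ_r(a) b`, for `b` of degree `r`. -/
theorem HasEpsilonMatrices.of_twist {𝒜 : ι → Submodule k A} {𝒜' : ι → Submodule k A'}
    (h : HasEpsilonMatrices 𝒜) (e : A ≃ₗ[k] A') (τ : ι → A ≃ₗ[k] A)
    (he : ∀ r, ∀ a ∈ 𝒜 r, e a ∈ 𝒜' r)
    (hτ : ∀ r s a, τ (r + s) a = τ r (τ s a)) (hτ_mem : ∀ r s, ∀ a ∈ 𝒜 s, τ r a ∈ 𝒜 s)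
    (hτ_mul : ∀ r s a, ∀ b ∈ 𝒜 s, τ r (a * b) = τ r a * τ r b)
    (hmul : ∀ r a, ∀ b ∈ 𝒜 r, e a * e b = e (τ r a * b)) : HasEpsilonMatrices 𝒜' := by
  obtain ⟨X, hfin, hne⟩ := h
  -- Coordinate `a` is twisted by `τ` at `-deg a`. Multiplying by an entry of degree `deg a - deg b`
  -- contributes `τ` at `deg a - deg b`, which turns this into `τ` at `-deg b`, the twist of
  -- coordinate `b`. So `Φ` intertwines `M` with `T M`.
  let Φ : (X.I → A) ≃ₗ[k] (X.I → A') :=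
    LinearEquiv.piCongrRight fun a => (τ (-X.deg a)).trans e
  let T : Matrix X.I X.I A → Matrix X.I X.I A' := fun M => Matrix.of fun a => Φ (M a)
  have hΦ : ∀ (M : Matrix X.I X.I A), (∀ a b, M a b ∈ 𝒜 (X.deg a - X.deg b)) → ∀ v,
      Φ v ᵥ* T M = Φ (v ᵥ* M) := by
    intro M hM v
    funext b
    change ∑ a, e (τ (-X.deg a) (v a)) * e (τ (-X.deg b) (M a b)) =
      e (τ (-X.deg b) (∑ a, v a * M a b))
    rw [map_sum, map_sum]
    refine Finset.sum_congr rfl fun a _ => ?_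
    rw [hmul _ _ _ (hτ_mem _ _ _ (hM a b)), ← hτ, hτ_mul _ _ _ _ (hM a b)]
    congr 4
    abel
  have hT : ∀ (M N : Matrix X.I X.I A), (∀ a b, N a b ∈ 𝒜 (X.deg a - X.deg b)) →
      T M * T N = T (M * N) := fun M N hN => by
    ext a b
    rw [Matrix.mul_apply_eq_vecMul]
    have : (M * N) a = M a ᵥ* N := Matrix.mul_apply_eq_vecMul M N a
    exact (congrFun (hΦ N hN (M a)) b).trans (congrFun (congrArg Φ this.symm) b)
  have hT_mem : ∀ (M : Matrix X.I X.I A), (∀ a b, M a b ∈ 𝒜 (X.deg a - X.deg b)) →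
      ∀ a b, T M a b ∈ 𝒜' (X.deg a - X.deg b) :=
    fun M hM a b => he _ _ (hτ_mem _ _ _ (hM a b))
  have hT_ne : ∀ (M : Matrix X.I X.I A) a b, T M a b ≠ 0 → M a b ≠ 0 := by
    intro M a b h h'
    refine h ?_
    change e (τ (-X.deg b) (M a b)) = 0
    rw [h', map_zero, map_zero]
  let Y : MatComplex 𝒜' :=
    { I := X.I
      deg := X.deg
      pos := X.pos
      E := T X.E
      D := T X.D
      E_mem := hT_mem _ X.E_mem
      D_mem := hT_mem _ X.D_mem
      E_pos := fun a b h => X.E_pos a b (hT_ne _ a b h)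
      D_pos := fun a b h => X.D_pos a b (hT_ne _ a b h)
      EE := by rw [hT _ _ X.E_mem, X.EE]
      ED := by rw [hT _ _ X.D_mem, X.ED]
      DE := by rw [hT _ _ X.E_mem, X.DE]
      DD := by
        rw [hT _ _ X.D_mem, X.DD]
        ext a b
        exact congrFun (map_zero Φ) b }
  have hb : ∀ v, v ∈ X.boundaries ↔ Φ v ∈ Y.boundaries := by
    intro v
    constructor
    · rintro ⟨u, rfl⟩
      exact ⟨Φ u, hΦ _ X.D_mem u⟩
    · rintro ⟨u, hu⟩
      obtain ⟨u, rfl⟩ := Φ.surjective u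
      exact ⟨u, Φ.injective ((hΦ _ X.D_mem u).symm.trans hu)⟩
  have hc : ∀ v, v ∈ X.cycles ↔ Φ v ∈ Y.cycles := by
    intro v
    rw [MatComplex.mem_cycles, MatComplex.mem_cycles]
    have h₁ : Φ v ᵥ* Y.E = Φ (v ᵥ* X.E) := hΦ _ X.E_mem v
    have h₂ : Φ v ᵥ* Y.D = Φ (v ᵥ* X.D) := hΦ _ X.D_mem v
    rw [h₁, h₂, Φ.injective.eq_iff, LinearEquiv.map_eq_zero_iff]
  refine ⟨Y, (hfin.map Φ.toLinearMap).mono (fun v hv => ?_) ?_, fun hle => hne fun v hv => ?_⟩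
  · obtain ⟨v, rfl⟩ := Φ.surjective v
    exact ⟨v, (hc v).2 hv, rfl⟩
  · rintro _ ⟨v, hv, rfl⟩
    exact (hb v).1 hv
  · exact (hb v).2 (hle ((hc v).1 hv))

/-- The original algebra is the twist of the twisted algebra by the inverse automorphisms, so one
transfer lemma serves both directions. -/
theorem TwistData.epsilonCondition_iff {w : ℕ} {𝒜 : (Fin w → ℤ) → Submodule k A}
    [GradedAlgebra 𝒜] (T : TwistData 𝒜) :
    EpsilonCondition 𝒜 ↔ EpsilonCondition T.twistGrading := by
  rw [_root_.epsilonCondition_iff, _root_.epsilonCondition_iff]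
  let e : A ≃ₗ[k] T.Twist := LinearEquiv.refl k A
  have hmul : ∀ r (a : A), ∀ b ∈ 𝒜 r, e a * e b = e (T.pow r a * b) := fun r a b hb =>
    T.twist_mul_def a b hb
  have hpow : ∀ r (a : A), T.pow r (T.pow (-r) a) = a := fun r a => by
    rw [← AlgEquiv.mul_apply, ← T.pow_add, add_neg_cancel, T.pow_zero, AlgEquiv.one_apply]
  have h₁ : ∀ r s (a : A), ∀ b ∈ 𝒜 s,
      T.pow (-r) (T.mul b a) = T.mul (T.pow (-r) b) (T.pow (-r) a) := fun r s a b hb => by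
    rw [T.mul_of_mem a hb, T.mul_of_mem _ (T.pow_mem _ hb), map_mul, ← AlgEquiv.mul_apply,
      ← AlgEquiv.mul_apply, ← T.pow_add, ← T.pow_add, add_comm]
  have h₂ : ∀ r (a : A), ∀ b ∈ 𝒜 r, a * b = T.mul b (T.pow (-r) a) := fun r a b hb => by
    rw [T.mul_of_mem _ hb, hpow]
  constructor
  · intro h
    exact h.of_twist e (fun r => (T.pow r).toLinearEquiv) (fun r a ha => ha)
      (fun r s a => by rw [T.pow_add]; rfl) (fun r s a ha => T.pow_mem r ha)
      (fun r s a b _ => map_mul (T.pow r) a b) hmul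
  · intro h
    refine h.of_twist e.symm
      (fun r => e.symm.trans ((T.pow (-r)).toLinearEquiv.trans e)) (fun r a ha => ha)
      (fun r s a => by
        change T.pow (-(r + s)) a = T.pow (-r) (T.pow (-s) a)
        rw [neg_add, T.pow_add]
        rfl) (fun r s a ha => T.pow_mem _ ha)
      h₁ h₂

end Twist

/-! ### Finite global dimension -/

section Resolution

open Matrix GrMod

variable {k A : Type u} {ι : Type} [Field k] [Ring A] [Algebra k A] [AddCommGroup ι]
  [DecidableEq ι] {𝒜 : ι → Submodule k A}

/-- A finite resolution of a graded module, presented by matrices. -/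
structure MatResolution (M : GrMod 𝒜) extends MatComplex 𝒜 where
  /-- the augmentation -/
  aug : (I → A) →ₗ[A] M.carrier
  aug_mem : ∀ r v, (∀ a, v a ∈ 𝒜 (r - deg a)) → aug v ∈ M.deg r
  aug_pos : ∀ a, aug (Pi.single (M := fun _ => A) a 1) ≠ 0 → pos a = 0
  aug_D : ∀ v, aug (v ᵥ* D) = 0
  aug_E : ∀ v, aug (v ᵥ* E) = aug v
  exact_aug : ∀ v ∈ toMatComplex.cycles, aug v = 0 → v ∈ toMatComplex.boundaries
  surjective_aug : ∀ m, ∃ v ∈ toMatComplex.cycles, aug v = m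

variable [GradedAlgebra 𝒜]

/-- Projectivity is assumed over the ungraded ring only. The degree-zero component of an ungraded
section of a graded free cover is a graded section, which gives the idempotent of a resolution of
length zero. -/
theorem MatResolution.exists_of_projective (M : GrMod 𝒜) [Module.Finite A M.carrier]
    [Module.Projective A M.carrier] : Nonempty (MatResolution M) := by
  obtain ⟨n, deg, f, hf⟩ := M.exists_free_surjective
  obtain ⟨s₀, hs₀⟩ := Module.projective_lifting_property (lin f) LinearMap.id hf
  obtain ⟨s, hs⟩ := exists_section f s₀ (LinearMap.congr_fun hs₀)
  let f' : (Fin n → A) →ₗ[A] M.carrier := lin f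
  let s' : M.carrier →ₗ[A] (Fin n → A) := lin s
  have hfs : ∀ m, f' (s' m) = m := LinearMap.congr_fun (congrArg lin hs)
  let X : MatComplex 𝒜 :=
    { I := Fin n
      deg := deg
      pos := 0
      E := LinearMap.toMatrixRight' (s' ∘ₗ f')
      D := 0
      E_mem := toMatrixRight'_mem deg deg _ fun r v hv =>
        (free_mem_deg deg).1 (lin_mem s (lin_mem f ((free_mem_deg deg).2 hv)))
      D_mem := fun _ _ => zero_mem _
      E_pos := fun _ _ _ => rfl
      D_pos := fun _ _ h => absurd rfl h
      EE := by
        rw [← LinearMap.toMatrixRight'_comp]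
        exact congrArg _ (LinearMap.ext fun v => by simp [hfs])
      ED := Matrix.mul_zero _
      DE := Matrix.zero_mul _
      DD := Matrix.mul_zero _ }
  have hE : ∀ v, v ᵥ* X.E = s' (f' v) := fun v =>
    LinearMap.congr_fun (LinearMap.toMatrixRight'.symm_apply_apply (s' ∘ₗ f')) v
  exact ⟨{ X with
    aug := f'
    aug_mem := fun r v hv => lin_mem f ((free_mem_deg deg).2 hv)
    aug_pos := fun _ _ => rfl
    aug_D := fun v => by
      change f' (v ᵥ* (0 : Matrix (Fin n) (Fin n) A)) = 0
      simp
    aug_E := fun v => by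
      change f' (v ᵥ* X.E) = _
      rw [hE, hfs]
    exact_aug := fun v hv h => by
      have h₁ : v ᵥ* X.E = v := (MatComplex.mem_cycles.1 hv).1
      rw [← h₁, hE, h, map_zero]
      exact zero_mem _
    surjective_aug := fun m => ⟨s' m, MatComplex.mem_cycles.2
      ⟨(hE _).trans (by rw [hfs]), vecMul_zero _⟩, hfs m⟩ }⟩

/-- Splicing: the resolution of the kernel moves down by one position and is joined by `H`, its
augmentation followed by the inclusion, to the free module placed in position zero. -/
theorem MatResolution.exists_of_kernel {M : GrMod 𝒜} {n : ℕ} {deg : Fin n → ι}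
    (f : free 𝒜 deg ⟶ M) (hf : Function.Surjective (lin f))
    (Y : MatResolution ((free 𝒜 deg).sub (LinearMap.ker (lin f)) (ker_homogeneous f))) :
    Nonempty (MatResolution M) := by
  let f' : (Fin n → A) →ₗ[A] M.carrier := lin f
  let κ : LinearMap.ker f' →ₗ[A] (Fin n → A) := (LinearMap.ker f').subtype
  let η : (Y.I → A) →ₗ[A] LinearMap.ker f' := Y.aug
  let H : Matrix Y.I (Fin n) A := LinearMap.toMatrixRight' (κ ∘ₗ η)
  have hH : ∀ v, v ᵥ* H = κ (η v) := fun v =>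
    LinearMap.congr_fun (LinearMap.toMatrixRight'.symm_apply_apply (κ ∘ₗ η)) v
  have hfκ : ∀ x, f' (κ x) = 0 := fun x => x.2
  have hηE : ∀ v, η (v ᵥ* Y.E) = η v := Y.aug_E
  have hηD : ∀ v, η (v ᵥ* Y.D) = 0 := Y.aug_D
  have hEH : Y.E * H = H := Matrix.toLinearMapRight'.injective <| LinearMap.ext fun v => by
    simp [hH, hηE]
  have hDH : Y.D * H = 0 := Matrix.toLinearMapRight'.injective <| LinearMap.ext fun v => by
    simp [hH, hηD]
  let X : MatComplex 𝒜 :=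
    { I := Y.I ⊕ Fin n
      deg := Sum.elim Y.deg deg
      pos := Sum.elim (fun a => Y.pos a - 1) 0
      E := fromBlocks Y.E 0 0 1
      D := fromBlocks Y.D H 0 0
      E_mem := by
        rintro (a | a) (b | b)
        · exact Y.E_mem a b
        · exact zero_mem _
        · exact zero_mem _
        · rcases eq_or_ne a b with rfl | h
          · have : deg a - deg a = 0 := sub_self _
            change (1 : Matrix (Fin n) (Fin n) A) a a ∈ 𝒜 (deg a - deg a)
            rw [this, Matrix.one_apply_eq]
            exact SetLike.one_mem_graded 𝒜
          · change (1 : Matrix (Fin n) (Fin n) A) a b ∈ 𝒜 (deg a - deg b)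
            rw [Matrix.one_apply_ne h]
            exact zero_mem _
      D_mem := by
        rintro (a | a) (b | b)
        · exact Y.D_mem a b
        · exact toMatrixRight'_mem (𝒜 := 𝒜) Y.deg deg (κ ∘ₗ η)
            (fun r v hv b => Y.aug_mem r v hv b trivial) a b
        · exact zero_mem _
        · exact zero_mem _
      E_pos := by
        rintro (a | a) (b | b) h
        · simpa using Y.E_pos a b h
        · exact absurd rfl h
        · exact absurd rfl h
        · rfl
      D_pos := by
        rintro (a | a) (b | b) h
        · have := Y.D_pos a b h
          simp [this]
        · have : Y.pos a = 0 := Y.aug_pos a fun h' => h (by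
            change κ (η (Pi.single (M := fun _ => A) a 1)) b = 0
            have h'' : η (Pi.single (M := fun _ => A) a 1) = 0 := h'
            rw [h'', map_zero]
            rfl)
          simp [this]
        · exact absurd rfl h
        · exact absurd rfl h
      EE := by simp [fromBlocks_multiply, Y.EE]
      ED := by simp [fromBlocks_multiply, Y.ED, hEH]
      DE := by simp [fromBlocks_multiply, Y.DE]
      DD := by simp [fromBlocks_multiply, Y.DD, hDH] }
  have hE' : ∀ v : Y.I ⊕ Fin n → A,
      v ᵥ* fromBlocks Y.E 0 0 1 = Sum.elim ((v ∘ Sum.inl) ᵥ* Y.E) (v ∘ Sum.inr) := by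
    simp [vecMul_fromBlocks]
  have hE : ∀ v : X.I → A, v ᵥ* X.E = Sum.elim ((v ∘ Sum.inl) ᵥ* Y.E) (v ∘ Sum.inr) := hE'
  have hD' : ∀ v : Y.I ⊕ Fin n → A, v ᵥ* fromBlocks Y.D H 0 0 =
      Sum.elim ((v ∘ Sum.inl) ᵥ* Y.D) (κ (η (v ∘ Sum.inl))) := by
    simp [vecMul_fromBlocks, hH]
  have hD : ∀ v : X.I → A, v ᵥ* X.D = Sum.elim ((v ∘ Sum.inl) ᵥ* Y.D) (κ (η (v ∘ Sum.inl))) :=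
    hD'
  have hsum : ∀ v : X.I → A, Sum.elim (v ∘ Sum.inl) (v ∘ Sum.inr) = v :=
    fun v => Sum.elim_comp_inl_inr v
  exact ⟨{ X with
    aug := f' ∘ₗ LinearMap.funLeft A A Sum.inr
    aug_mem := fun r v hv => lin_mem f ((free_mem_deg deg).2 fun a => hv (Sum.inr a))
    aug_pos := by
      rintro (a | a) h
      · refine absurd ?_ h
        have : LinearMap.funLeft A A Sum.inr (Pi.single (M := fun _ => A) (Sum.inl a : X.I) 1) =
            (0 : Fin n → A) := funext fun b => by simp [LinearMap.funLeft]
        rw [LinearMap.comp_apply, this, map_zero]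
      · rfl
    aug_D := fun v => by
      change f' ((v ᵥ* X.D) ∘ Sum.inr) = 0
      rw [hD, Sum.elim_comp_inr, hfκ]
    aug_E := fun v => by
      change f' ((v ᵥ* X.E) ∘ Sum.inr) = f' (v ∘ Sum.inr)
      rw [hE, Sum.elim_comp_inr]
    exact_aug := fun v hv h => by
      obtain ⟨h₁, h₂⟩ : v ᵥ* X.E = v ∧ v ᵥ* X.D = 0 := hv
      rw [hE] at h₁
      rw [hD] at h₂
      have h₃ : (v ∘ Sum.inl) ᵥ* Y.E = v ∘ Sum.inl := by
        conv_rhs => rw [← h₁]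
        rw [Sum.elim_comp_inl]
      have h₄ : (v ∘ Sum.inl) ᵥ* Y.D = 0 := by
        have := congrArg (· ∘ Sum.inl) h₂
        simpa using this
      have h₅ : η (v ∘ Sum.inl) = 0 := Subtype.ext <| by
        have := congrArg (· ∘ Sum.inr) h₂
        rwa [Sum.elim_comp_inr] at this
      obtain ⟨u, hu⟩ := Y.exact_aug (v ∘ Sum.inl) ⟨h₃, h₄⟩ h₅
      have hu : u ᵥ* Y.D = v ∘ Sum.inl := hu
      have h₆ : f' (v ∘ Sum.inr) = 0 := h
      -- The row `u` already has the right image in the old part. A cycle `z` with the prescribed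
      -- augmentation corrects the free part without disturbing it.
      obtain ⟨z, ⟨hz₁, hz₂⟩, hz₃⟩ := Y.surjective_aug
        (⟨v ∘ Sum.inr, h₆⟩ - η u : LinearMap.ker f')
      have hz₂ : z ᵥ* Y.D = 0 := hz₂
      have hz₃ : η z = ⟨v ∘ Sum.inr, h₆⟩ - η u := hz₃
      refine ⟨Sum.elim (u + z) 0, ?_⟩
      change (Sum.elim (u + z) 0 : X.I → A) ᵥ* X.D = v
      rw [hD, Sum.elim_comp_inl, add_vecMul, hu, hz₂, add_zero, map_add, hz₃,
        add_sub_cancel]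
      exact hsum v
    surjective_aug := fun m => by
      obtain ⟨x, hx⟩ := hf m
      change Fin n → A at x
      let v : Y.I ⊕ Fin n → A := Sum.elim 0 x
      have h₁ : v ᵥ* fromBlocks Y.E 0 0 1 = v := by simp [hE', v]
      have h₂ : v ᵥ* fromBlocks Y.D H 0 0 = 0 := by simp [hD', v]
      exact ⟨v, ⟨h₁, h₂⟩, hx⟩ }⟩

/-- Dimension shifting along a graded free cover. The kernel is again finitely generated because `A`
is noetherian, and its projective dimension drops because the cover is projective. -/
theorem MatResolution.exists_of_hasProjectiveDimensionLE [IsNoetherianRing A] (d : ℕ) :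
    ∀ (M : GrMod 𝒜) [Module.Finite A M.carrier],
      HasProjectiveDimensionLE (ModuleCat.of A M.carrier) d → Nonempty (MatResolution M) := by
  induction d with
  | zero =>
    intro M _ h
    have : Projective (ModuleCat.of A M.carrier) :=
      (projective_iff_hasProjectiveDimensionLE_zero _).2 h
    have : Module.Projective A M.carrier := (IsProjective.iff_projective _).2 this
    exact exists_of_projective M
  | succ d ih =>
    intro M _ h
    obtain ⟨n, deg, f, hf⟩ := M.exists_free_surjective
    let f' : (Fin n → A) →ₗ[A] M.carrier := lin f
    have : Module.Finite A (LinearMap.ker f') := inferInstance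
    have : Module.Finite A
        ((free 𝒜 deg).sub (LinearMap.ker (lin f)) (ker_homogeneous f)).carrier := this
    obtain ⟨Y⟩ := ih ((free 𝒜 deg).sub (LinearMap.ker (lin f)) (ker_homogeneous f)) (by
      let S : ShortComplex (ModuleCat.{u} A) := ShortComplex.mk
        (ModuleCat.ofHom (LinearMap.ker f').subtype) (ModuleCat.ofHom f')
        (by ext x; exact x.2)
      have hS : S.ShortExact :=
        { exact := by
            rw [ShortComplex.moduleCat_exact_iff]
            exact fun x hx => ⟨⟨x, hx⟩, rfl⟩
          mono_f := (ModuleCat.mono_iff_injective _).2 Subtype.val_injective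
          epi_g := (ModuleCat.epi_iff_surjective _).2 hf }
      have hP : Projective S.X₂ := (IsProjective.iff_projective (Fin n → A)).1 inferInstance
      exact (hS.hasProjectiveDimensionLT_X₃_iff d hP).1 h)
    exact exists_of_kernel f hf Y

/-- The augmentation of a resolution identifies its homology with the module: boundaries are exactly
the cycles of augmentation zero, and every element comes from a cycle. -/
theorem epsilonCondition_of_hasFiniteGlobalDimension [IsNoetherianRing A]
    (h : HasFiniteGlobalDimension A) (M : GrMod 𝒜) [Nontrivial M.carrier]
    [FiniteDimensional k M.carrier] : EpsilonCondition 𝒜 := by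
  obtain ⟨d, hd⟩ := h
  have : Module.Finite A M.carrier := Module.Finite.of_restrictScalars_finite k A M.carrier
  obtain ⟨X⟩ := MatResolution.exists_of_hasProjectiveDimensionLE d M (hd _)
  refine HasEpsilonMatrices.epsilonCondition ⟨X.toMatComplex, ?_, fun hle => ?_⟩
  · obtain ⟨S, hS, -, h⟩ := FiniteModulo.of_fg_map (Z := X.cycles.restrictScalars k)
      (R := X.boundaries.restrictScalars k) (X.aug.restrictScalars k)
      (fun v hv => X.exact_aug v hv.1 hv.2)
      (Module.Finite.iff_fg.1 inferInstance)
    exact ⟨S, hS, h⟩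
  · obtain ⟨m, hm⟩ := exists_ne (0 : M.carrier)
    obtain ⟨v, hv, rfl⟩ := X.surjective_aug m
    obtain ⟨u, hu⟩ := hle hv
    rw [← hu] at hm
    exact hm (X.aug_D u)

end Resolution

/-! ### Nonnegatively graded algebras -/

section Nonneg

variable {k A : Type u} {ι : Type} [Field k] [Ring A] [Algebra k A] [AddCommGroup ι]
  [DecidableEq ι] [PartialOrder ι] [IsOrderedAddMonoid ι] {𝒜 : ι → Submodule k A}
  [GradedAlgebra 𝒜]

/-- Two nonnegative degrees add up to zero only if both are zero. -/
theorem IsNonnegGraded.proj_zero_mul (h : IsNonnegGraded 𝒜) (a b : A) :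
    GradedAlgebra.proj 𝒜 0 (a * b) = GradedAlgebra.proj 𝒜 0 a * GradedAlgebra.proj 𝒜 0 b := by
  have h₁ : ∀ i, ∀ a ∈ 𝒜 i, ∀ j, ∀ b ∈ 𝒜 j, GradedAlgebra.proj 𝒜 0 (a * b) =
      GradedAlgebra.proj 𝒜 0 a * GradedAlgebra.proj 𝒜 0 b := by
    intro i a ha j b hb
    by_cases hi : i = 0
    · subst hi
      by_cases hj : j = 0
      · subst hj
        have := SetLike.mul_mem_graded ha hb
        rw [add_zero] at this
        rw [GradedAlgebra.proj_same ha, GradedAlgebra.proj_same hb, GradedAlgebra.proj_same this]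
      · rw [GradedAlgebra.proj_ne hb hj, mul_zero]
        exact GradedAlgebra.proj_ne (SetLike.mul_mem_graded ha hb) (by rwa [zero_add])
    · rw [GradedAlgebra.proj_ne ha hi, zero_mul]
      rcases eq_or_ne a 0 with rfl | ha'
      · simp
      rcases eq_or_ne b 0 with rfl | hb'
      · simp
      have hi' : 0 ≤ i := h i fun e => ha' (by simpa [e] using ha)
      have hj' : 0 ≤ j := h j fun e => hb' (by simpa [e] using hb)
      exact GradedAlgebra.proj_ne (SetLike.mul_mem_graded ha hb)
        fun e => hi ((add_eq_zero_iff_of_nonneg hi' hj').1 e).1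
  let p := GradedAlgebra.proj 𝒜 (0 : ι)
  have h₂ : (LinearMap.mul k A).compr₂ p = (LinearMap.mul k A).compl₁₂ p p :=
    (GrMod.self 𝒜).hom_ext_deg fun i a ha => (GrMod.self 𝒜).hom_ext_deg fun j b hb =>
      h₁ i a ha j b hb
  exact LinearMap.congr_fun₂ h₂ a b

/-- The augmentation of a connected graded algebra. -/
theorem IsConnectedGraded.exists_aug (h : IsConnectedGraded 𝒜) :
    ∃ f : A →ₐ[k] k, ∀ a, algebraMap k A (f a) = GradedAlgebra.proj 𝒜 0 a := by
  have := h.nontrivial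
  have hinj : Function.Injective (algebraMap k A) := (algebraMap k A).injective
  have hex : ∀ a, ∃ c, algebraMap k A c = GradedAlgebra.proj 𝒜 0 a := fun a => by
    have := GradedAlgebra.proj_mem' (𝒜 := 𝒜) 0 a
    rw [h.deg_zero] at this
    exact this
  choose f hf using hex
  have h₁ : GradedAlgebra.proj 𝒜 0 1 = 1 :=
    GradedAlgebra.proj_same (SetLike.one_mem_graded 𝒜)
  refine ⟨{ toFun := f
            map_one' := hinj (by rw [hf, h₁, map_one])
            map_mul' := fun a b => hinj (by rw [hf, h.nonneg.proj_zero_mul, map_mul, hf, hf])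
            map_zero' := hinj (by rw [hf, map_zero, map_zero])
            map_add' := fun a b => hinj (by rw [hf, map_add, map_add, hf, hf])
            commutes' := fun c => hinj ?_ }, hf⟩
  change algebraMap k A (f (algebraMap k A c)) = algebraMap k A c
  rw [hf]
  exact GradedAlgebra.proj_same (h.deg_zero.ge ⟨c, rfl⟩)

end Nonneg

/-! ### The trivial module and AS regular algebras -/

section ASRegular

variable {k A : Type u} [Field k] [Ring A] [Algebra k A] {𝒜 : ℤ → Submodule k A}
  [GradedAlgebra 𝒜]

theorem IsConnectedGraded.nontrivial_trivialModule (h : IsConnectedGraded 𝒜) :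
    Nontrivial (trivialModule 𝒜).carrier := by
  obtain ⟨f, hf⟩ := h.exists_aug
  have := h.nontrivial
  change Nontrivial (A ⧸ augmentationIdeal 𝒜)
  rw [Submodule.Quotient.nontrivial_iff]
  intro htop
  have hle : augmentationIdeal 𝒜 ≤ RingHom.ker (f : A →+* k) := by
    refine Ideal.span_le.2 ?_
    rintro a ⟨i, hi, ha⟩
    refine (algebraMap k A).injective ?_
    exact (hf a).trans ((GradedAlgebra.proj_ne ha hi.ne').trans (map_zero _).symm)
  have h₁ : (1 : A) ∈ RingHom.ker (f : A →+* k) := hle (htop ▸ Submodule.mem_top)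
  rw [RingHom.mem_ker, map_one] at h₁
  exact one_ne_zero h₁

theorem IsConnectedGraded.finiteDimensional_trivialModule (h : IsConnectedGraded 𝒜) :
    FiniteDimensional k (trivialModule 𝒜).carrier := by
  let q : A →ₗ[k] A ⧸ augmentationIdeal 𝒜 := (augmentationIdeal 𝒜).mkQ.restrictScalars k
  have hq : ∀ i, ∀ a ∈ 𝒜 i, q a ∈ LinearMap.range (q ∘ₗ Algebra.linearMap k A) := by
    intro i a ha
    rcases lt_trichotomy i 0 with hi | rfl | hi
    · have : 𝒜 i = ⊥ := by
        by_contra hne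
        exact (h.nonneg i hne).not_gt hi
      rw [this, Submodule.mem_bot] at ha
      rw [ha, map_zero]
      exact zero_mem _
    · obtain ⟨c, rfl⟩ := h.deg_zero.le ha
      exact ⟨c, rfl⟩
    · have : q a = 0 := (Submodule.Quotient.mk_eq_zero _).2 (Ideal.subset_span ⟨i, hi, ha⟩)
      rw [this]
      exact zero_mem _
  have htop : ⊤ ≤ (LinearMap.range (q ∘ₗ Algebra.linearMap k A)).comap q := by
    rw [← (DirectSum.Decomposition.isInternal 𝒜).submodule_iSup_eq_top]
    exact iSup_le hq
  refine Module.Finite.of_surjective (q ∘ₗ Algebra.linearMap k A) fun x => ?_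
  obtain ⟨a, rfl⟩ := (augmentationIdeal 𝒜).mkQ_surjective x
  exact htop (Submodule.mem_top (x := a))

theorem IsASRegular.epsilonCondition [IsNoetherianRing A] (h : IsASRegular 𝒜) :
    EpsilonCondition 𝒜 := by
  have := h.connected.nontrivial_trivialModule
  have := h.connected.finiteDimensional_trivialModule
  exact epsilonCondition_of_hasFiniteGlobalDimension h.finiteGlobalDimension (trivialModule 𝒜)

end ASRegular

/-! ### Koszul complexes -/

section Koszul

open Matrix

variable {k B : Type u} {ι : Type} [Field k] [Ring B] [Algebra k B] [AddCommGroup ι]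
  {ℬ : ι → Submodule k B}

theorem Matrix.mul_smul_one_of_central {I : Type*} [Fintype I] [DecidableEq I] {x : B}
    (hx : ∀ b, Commute x b) (M : Matrix I I B) : M * (x • (1 : Matrix I I B)) = x • M := by
  ext a b
  simp only [mul_apply, Matrix.smul_apply, smul_eq_mul]
  rw [Finset.sum_eq_single b]
  · simp [(hx (M a b)).eq]
  · intro c _ hc
    simp [hc]
  · simp

/-- The Koszul complex of a list of central homogeneous elements. -/
theorem exists_koszul_complex [DecidableEq ι] [GradedAlgebra ℬ] (J : Ideal B) (l : List B)
    (hl : ∀ x ∈ l, x ∈ J ∧ (∃ i, x ∈ ℬ i) ∧ ∀ b, Commute x b) :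
    ∃ (X : MatComplex ℬ) (a₀ : X.I), X.E = 1 ∧ (∀ b, X.D a₀ b = 0) ∧ (∀ a, X.D a a₀ ∈ J) ∧
      ∀ x ∈ l, ∃ s, X.D * s + s * X.D = x • (1 : Matrix X.I X.I B) := by
  -- The vector at `a₀` will be the class of `1`: it is a cycle, and every boundary has its `a₀`
  -- coordinate in `J`. Each listed element acts on the complex null-homotopically.
  have one_mem : ∀ {I : Type} [DecidableEq I] (deg : I → ι) (a b : I),
      (1 : Matrix I I B) a b ∈ ℬ (deg a - deg b) := by
    intro I _ deg a b
    rcases eq_or_ne a b with rfl | h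
    · rw [sub_self, one_apply_eq]
      exact SetLike.one_mem_graded ℬ
    · rw [one_apply_ne h]
      exact zero_mem _
  have one_pos : ∀ {I : Type} [DecidableEq I] (pos : I → ℤ) (a b : I),
      (1 : Matrix I I B) a b ≠ 0 → pos b = pos a := by
    intro I _ pos a b h
    rcases eq_or_ne a b with rfl | h'
    · rfl
    · exact absurd (one_apply_ne h') h
  induction l with
  | nil =>
    exact ⟨{  I := Unit
              deg := 0
              pos := 0
              E := 1
              D := 0
              E_mem := one_mem _
              D_mem := fun _ _ => zero_mem _
              E_pos := one_pos _
              D_pos := fun _ _ h => absurd rfl h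
              EE := Matrix.mul_one _
              ED := Matrix.mul_zero _
              DE := Matrix.zero_mul _
              DD := Matrix.mul_zero _ }, (), rfl, fun _ => rfl, fun _ => zero_mem _, by simp⟩
  | cons x l ih =>
    obtain ⟨X, a₀, hE, h₁, h₂, h₃⟩ := ih fun y hy => hl y (List.mem_cons_of_mem x hy)
    obtain ⟨hxJ, ⟨i, hi⟩, hx⟩ := hl x List.mem_cons_self
    let deg : X.I ⊕ X.I → ι := Sum.elim X.deg fun a => X.deg a + i
    let pos : X.I ⊕ X.I → ℤ := Sum.elim X.pos fun a => X.pos a - 1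
    -- The cone of multiplication by `x`. The second copy is shifted in degree by that of `x` and
    -- placed one position lower, and its differential changes sign.
    let D : Matrix (X.I ⊕ X.I) (X.I ⊕ X.I) B :=
      fromBlocks X.D 0 (x • (1 : Matrix X.I X.I B)) (-X.D)
    let Y : MatComplex ℬ :=
      { I := X.I ⊕ X.I
        deg := deg
        pos := pos
        E := 1
        D := D
        E_mem := one_mem _
        D_mem := by
          rintro (a | a) (b | b)
          · exact X.D_mem a b
          · exact zero_mem _
          · change (x • (1 : Matrix X.I X.I B)) a b ∈ ℬ (X.deg a + i - X.deg b)
            rcases eq_or_ne a b with rfl | h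
            · simpa using hi
            · simp [h]
          · change -X.D a b ∈ ℬ (X.deg a + i - (X.deg b + i))
            rw [add_sub_add_right_eq_sub]
            exact neg_mem (X.D_mem a b)
        E_pos := one_pos _
        D_pos := by
          rintro (a | a) (b | b) h
          · exact X.D_pos a b h
          · exact absurd rfl h
          · have h : (x • (1 : Matrix X.I X.I B)) a b ≠ 0 := h
            rcases eq_or_ne a b with rfl | h'
            · simp [pos]
            · simp [h'] at h
          · have h : -X.D a b ≠ 0 := h
            have := X.D_pos a b (neg_ne_zero.1 h)
            simp [pos, this]
        EE := Matrix.mul_one _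
        ED := Matrix.one_mul _
        DE := Matrix.mul_one _
        DD := by
          simp [D, fromBlocks_multiply, X.DD, mul_smul_one_of_central hx] }
    refine ⟨Y, Sum.inl a₀, rfl, ?_, ?_, ?_⟩
    · rintro (b | b)
      · exact h₁ b
      · rfl
    · rintro (a | a)
      · exact h₂ a
      · change (x • (1 : Matrix X.I X.I B)) a a₀ ∈ J
        rcases eq_or_ne a a₀ with rfl | h
        · simpa using hxJ
        · simp [h]
    · have h1 : ∀ y : B, y • (1 : Matrix (X.I ⊕ X.I) (X.I ⊕ X.I) B) =
          fromBlocks (y • 1) 0 0 (y • 1) := fun y => by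
        rw [← fromBlocks_one, fromBlocks_smul]
        simp
      intro y hy
      rcases List.mem_cons.1 hy with rfl | hy
      -- For the new element, the homotopy sends the first copy identically to the second.
      · have key : D * fromBlocks 0 1 0 0 + fromBlocks 0 1 0 0 * D =
            y • (1 : Matrix (X.I ⊕ X.I) (X.I ⊕ X.I) B) := by
          rw [h1]
          simp [D, fromBlocks_multiply, fromBlocks_add]
        exact ⟨_, key⟩
      · obtain ⟨s, hs⟩ := h₃ y hy
        -- An earlier homotopy is used on both copies, with the sign that matches the differential.
        have key : D * fromBlocks s 0 0 (-s) + fromBlocks s 0 0 (-s) * D =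
            y • (1 : Matrix (X.I ⊕ X.I) (X.I ⊕ X.I) B) := by
          rw [h1]
          simp [D, fromBlocks_multiply, fromBlocks_add, mul_smul_one_of_central hx, hs]
        exact ⟨_, key⟩

/-- The cycles are finitely generated since `B` is noetherian, and the ideal of `G` carries them
into boundaries. Hence the homology is spanned by finitely many cycles with coefficients from a
finite-dimensional complement of that ideal. The class at `a₀` survives because `1` is not in the
ideal. -/
theorem hasEpsilonMatrices_of_central [DecidableEq ι] [GradedAlgebra ℬ] [IsNoetherianRing B]
    (G : Finset B) (hG : ∀ x ∈ G, (∃ i, x ∈ ℬ i) ∧ ∀ b, Commute x b)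
    (hfin : FiniteModulo ⊤ ((Ideal.span (G : Set B)).restrictScalars k))
    (hne : (1 : B) ∉ Ideal.span (G : Set B)) : HasEpsilonMatrices ℬ := by
  obtain ⟨X, a₀, hE, h₁, h₂, h₃⟩ := exists_koszul_complex (ℬ := ℬ) (Ideal.span (G : Set B))
    G.toList fun x hx => ⟨Ideal.subset_span (Finset.mem_toList.1 hx), hG x (Finset.mem_toList.1 hx)⟩
  refine ⟨X, ?_, fun hle => hne ?_⟩
  · obtain ⟨S, hS, hS'⟩ := hfin
    obtain ⟨t, ht⟩ := (IsNoetherian.noetherian X.cycles : X.cycles.FG)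
    refine ⟨⨆ z ∈ t, S.map ((LinearMap.toSpanSingleton B (X.I → B) z).restrictScalars k),
      Submodule.fg_biSup _ _ fun z _ => hS.map _, fun v hv => ?_⟩
    have hv' : v ∈ Submodule.span B (t : Set (X.I → B)) := ht ▸ hv
    obtain ⟨c, -, rfl⟩ := Submodule.mem_span_finset.1 hv'
    refine Submodule.sum_mem _ fun z hz => ?_
    have hzc : z ∈ X.cycles := ht ▸ Submodule.subset_span hz
    -- On a cycle `z` the homotopy identity reads `z s D = x z`, so each generator `x` carries `z`
    -- to a boundary.
    have hle : Ideal.span (G : Set B) ≤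
        X.boundaries.comap (LinearMap.toSpanSingleton B (X.I → B) z) := by
      refine Ideal.span_le.2 fun x hx => ?_
      obtain ⟨s, hs⟩ := h₃ x (Finset.mem_toList.2 hx)
      refine ⟨z ᵥ* s, ?_⟩
      change z ᵥ* s ᵥ* X.D = x • z
      have : z ᵥ* (X.D * s + s * X.D) = z ᵥ* s ᵥ* X.D := by
        rw [vecMul_add, ← vecMul_vecMul, (MatComplex.mem_cycles.1 hzc).2, zero_vecMul, zero_add,
          vecMul_vecMul]
      rw [← this, hs]
      funext a
      simp only [vecMul, dotProduct, Matrix.smul_apply, smul_eq_mul, Pi.smul_apply]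
      rw [Finset.sum_eq_single a]
      · simp [((hG x hx).2 (z a)).eq]
      · intro c _ hc
        simp [hc]
      · simp
    obtain ⟨j, hj, s, hs, e⟩ := Submodule.mem_sup.1 (hS' (Submodule.mem_top (x := c z)))
    rw [← e, add_smul]
    refine Submodule.add_mem_sup (hle hj) ?_
    exact Submodule.mem_iSup_of_mem z (Submodule.mem_iSup_of_mem hz ⟨s, hs, rfl⟩)
  · have hc : (Pi.single (M := fun _ => B) a₀ 1) ∈ X.cycles := by
      refine MatComplex.mem_cycles.2 ⟨by rw [hE, vecMul_one], ?_⟩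
      funext b
      simp [h₁]
    obtain ⟨u, hu⟩ := MatComplex.mem_boundaries.1 (hle hc)
    have := congrFun hu a₀
    rw [Pi.single_eq_same] at this
    rw [← this]
    exact Submodule.sum_mem _ fun a _ => Ideal.mul_mem_left _ _ (h₂ a)

end Koszul

/-! ### Homogeneous central elements and algebras finite over their center -/

section Central

variable {k B : Type u} {ι : Type} [Field k] [Ring B] [Algebra k B] [AddCommGroup ι]
  [DecidableEq ι] {ℬ : ι → Submodule k B} [GradedAlgebra ℬ]

variable (ℬ) in
theorem GradedAlgebra.linearMap_ext {W : Type*} [AddCommGroup W] [Module k W] {f g : B →ₗ[k] W}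
    (h : ∀ i, ∀ b ∈ ℬ i, f b = g b) : f = g := by
  have h' : (⊤ : Submodule k B) ≤ LinearMap.eqLocus f g := by
    rw [← (DirectSum.Decomposition.isInternal ℬ).submodule_iSup_eq_top]
    exact iSup_le h
  ext b
  exact h' (Submodule.mem_top (x := b))

theorem GradedAlgebra.proj_mul_right {j : ι} {b : B} (hb : b ∈ ℬ j) (i : ι) (a : B) :
    GradedAlgebra.proj ℬ (i + j) (a * b) = GradedAlgebra.proj ℬ i a * b := by
  have : GradedAlgebra.proj ℬ (i + j) ∘ₗ LinearMap.mulRight k b =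
      LinearMap.mulRight k b ∘ₗ GradedAlgebra.proj ℬ i := by
    refine GradedAlgebra.linearMap_ext ℬ fun l a ha => ?_
    by_cases h : l = i
    · subst h
      simp [proj_same ha, proj_same (SetLike.mul_mem_graded ha hb)]
    · simp [proj_ne ha h,
        proj_ne (SetLike.mul_mem_graded ha hb) fun e => h (add_right_cancel e)]
  exact LinearMap.congr_fun this a

theorem GradedAlgebra.proj_mul_left {j : ι} {b : B} (hb : b ∈ ℬ j) (i : ι) (a : B) :
    GradedAlgebra.proj ℬ (j + i) (b * a) = b * GradedAlgebra.proj ℬ i a := by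
  have : GradedAlgebra.proj ℬ (j + i) ∘ₗ LinearMap.mulLeft k b =
      LinearMap.mulLeft k b ∘ₗ GradedAlgebra.proj ℬ i := by
    refine GradedAlgebra.linearMap_ext ℬ fun l a ha => ?_
    by_cases h : l = i
    · subst h
      simp [proj_same ha, proj_same (SetLike.mul_mem_graded hb ha)]
    · simp [proj_ne ha h,
        proj_ne (SetLike.mul_mem_graded hb ha) fun e => h (add_left_cancel e)]
  exact LinearMap.congr_fun this a

/-- The homogeneous components of a central element are central. -/
theorem GradedAlgebra.commute_proj {z : B} (hz : ∀ b, Commute z b) (i : ι) (b : B) :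
    Commute (GradedAlgebra.proj ℬ i z) b := by
  have : LinearMap.mulLeft k (GradedAlgebra.proj ℬ i z) =
      LinearMap.mulRight k (GradedAlgebra.proj ℬ i z) := by
    refine GradedAlgebra.linearMap_ext ℬ fun j b hb => ?_
    change GradedAlgebra.proj ℬ i z * b = b * GradedAlgebra.proj ℬ i z
    rw [← proj_mul_right hb, ← proj_mul_left hb, (hz b).eq, add_comm]
  exact LinearMap.congr_fun this b

theorem GradedAlgebra.mem_of_proj_mem (S : Submodule k B) (b : B)
    (h : ∀ i, GradedAlgebra.proj ℬ i b ∈ S) : b ∈ S := by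
  classical
  rw [← DirectSum.sum_support_decompose ℬ b]
  exact S.sum_mem fun i _ => h i

variable [PartialOrder ι] [IsOrderedAddMonoid ι]

/-- A nonnegatively graded algebra that is finite over its affine center satisfies the
`ε`-condition. -/
theorem hasEpsilonMatrices_of_finite_center [Nontrivial B] (hnn : IsNonnegGraded ℬ)
    (h₀ : FiniteDimensional k (ℬ 0)) [Algebra.FiniteType k (Subalgebra.center k B)]
    [Module.Finite (Subalgebra.center k B) B] : HasEpsilonMatrices ℬ := by
  classical
  let C := Subalgebra.center k B
  have hC : ∀ c : C, ∀ b, Commute (c : B) b := fun c b =>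
    ((Subalgebra.mem_center_iff.1 c.2) b).symm
  have : IsNoetherianRing C := Algebra.FiniteType.isNoetherianRing k C
  have : IsNoetherian C B := isNoetherian_of_isNoetherianRing_of_finite C B
  have : IsNoetherianRing B := isNoetherian_of_tower C this
  obtain ⟨t, ht⟩ := (inferInstance : Algebra.FiniteType k C).out
  obtain ⟨g, hg⟩ := (inferInstance : Module.Finite C B).fg_top
  -- The homogeneous components of nonzero degree of the chosen generators of the center. They are
  -- again central, so the left ideal `J` they generate is two-sided.
  let G : Finset B := t.biUnion fun c =>
    ((DirectSum.decompose ℬ (c : B)).support.filter (· ≠ 0)).image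
      fun i => GradedAlgebra.proj ℬ i (c : B)
  have hG : ∀ x ∈ G, ∃ c ∈ t, ∃ i ≠ 0, GradedAlgebra.proj ℬ i (c : B) = x := by
    intro x hx
    obtain ⟨c, hc, hx⟩ := Finset.mem_biUnion.1 hx
    obtain ⟨i, hi, hx⟩ := Finset.mem_image.1 hx
    exact ⟨c, hc, i, (Finset.mem_filter.1 hi).2, hx⟩
  have hGc : ∀ x ∈ G, ∀ b, Commute x b := by
    intro x hx
    obtain ⟨c, -, i, -, rfl⟩ := hG x hx
    exact GradedAlgebra.commute_proj (hC c) i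
  let J : Ideal B := Ideal.span (G : Set B)
  have hJr : ∀ j ∈ J, ∀ b, j * b ∈ J := by
    intro j hj b
    induction hj using Submodule.span_induction with
    | mem x hx =>
      rw [(hGc x hx b).eq]
      exact J.mul_mem_left b (Ideal.subset_span hx)
    | zero => simp
    | add x y _ _ hx hy => rw [add_mul]; exact J.add_mem hx hy
    | smul a x _ hx => rw [smul_eq_mul, mul_assoc]; exact J.mul_mem_left a hx
  -- `J` has no component in degree zero, so it does not contain `1`.
  have hJ₀ : ∀ j ∈ J, GradedAlgebra.proj ℬ 0 j = 0 := by
    intro j hj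
    induction hj using Submodule.span_induction with
    | mem x hx =>
      obtain ⟨c, -, i, hi, rfl⟩ := hG x hx
      exact GradedAlgebra.proj_ne (GradedAlgebra.proj_mem' i _) hi
    | zero => exact map_zero _
    | add x y _ _ hx hy => rw [map_add, hx, hy, add_zero]
    | smul a x _ hx => rw [smul_eq_mul, hnn.proj_zero_mul, hx, mul_zero]
  -- Modulo `J` every generator of the center lies in `ℬ 0`, which is closed under multiplication.
  -- Thus `B` modulo `J` is spanned by the products of `ℬ 0` with finitely many module generators.
  have hT : ∀ c : C, (c : B) ∈ J.restrictScalars k ⊔ ℬ 0 := by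
    intro c
    have hc : c ∈ Algebra.adjoin k (t : Set C) := ht ▸ Algebra.mem_top
    induction hc using Algebra.adjoin_induction with
    | mem c hc =>
      refine GradedAlgebra.mem_of_proj_mem (ℬ := ℬ) _ _ fun i => ?_
      by_cases hi : i = 0
      · subst hi
        exact Submodule.mem_sup_right (GradedAlgebra.proj_mem' 0 _)
      · refine Submodule.mem_sup_left ?_
        by_cases h : GradedAlgebra.proj ℬ i (c : B) = 0
        · rw [h]
          exact zero_mem _
        · refine Ideal.subset_span (Finset.mem_biUnion.2 ⟨c, hc, Finset.mem_image.2 ⟨i, ?_, rfl⟩⟩)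
          refine Finset.mem_filter.2 ⟨?_, hi⟩
          rw [DFinsupp.mem_support_iff]
          exact fun e => h (congrArg Subtype.val e)
    | algebraMap r =>
      exact Submodule.mem_sup_right (SetLike.algebraMap_mem_graded ℬ r)
    | add x y _ _ hx hy => exact Submodule.add_mem _ hx hy
    | mul x y _ _ hx hy =>
      obtain ⟨j, hj, b, hb, e⟩ := Submodule.mem_sup.1 hx
      obtain ⟨j', hj', b', hb', e'⟩ := Submodule.mem_sup.1 hy
      have e'' : ((x * y : C) : B) = (j * y + b * j') + b * b' := by
        rw [Subalgebra.coe_mul, ← e, add_mul, add_assoc, ← mul_add, e']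
      rw [e'']
      refine Submodule.add_mem_sup (J.add_mem (hJr j hj _) (J.mul_mem_left _ hj')) ?_
      have := SetLike.mul_mem_graded hb hb'
      rwa [add_zero] at this
  refine hasEpsilonMatrices_of_central G (fun x hx => ⟨?_, hGc x hx⟩) ?_ fun h => ?_
  · obtain ⟨c, -, i, -, rfl⟩ := hG x hx
    exact ⟨i, GradedAlgebra.proj_mem' i _⟩
  · refine ⟨⨆ x ∈ g, (ℬ 0).map (LinearMap.mulRight k x),
      Submodule.fg_biSup _ _ fun x _ => (Module.Finite.iff_fg.1 h₀).map _, fun v _ => ?_⟩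
    have hv : v ∈ Submodule.span C (g : Set B) := hg ▸ Submodule.mem_top
    obtain ⟨c, -, rfl⟩ := Submodule.mem_span_finset.1 hv
    refine Submodule.sum_mem _ fun x hx => ?_
    obtain ⟨j, hj, b, hb, e⟩ := Submodule.mem_sup.1 (hT (c x))
    rw [Subalgebra.smul_def, smul_eq_mul, ← e, add_mul]
    exact Submodule.add_mem_sup (hJr j hj x)
      (Submodule.mem_iSup_of_mem x (Submodule.mem_iSup_of_mem hx ⟨b, hb, rfl⟩))
  · have := hJ₀ 1 h
    rw [GradedAlgebra.proj_same (SetLike.one_mem_graded ℬ)] at this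
    exact one_ne_zero this

end Central

/-! ### Finiteness of the homology after base change -/

section RightModules

open Matrix MulOpposite

variable {k A : Type u} {ι : Type} [Field k] [Ring A] [Algebra k A] [AddCommGroup ι]

section RMul

variable {I J L : Type} [Fintype I] {N N' : Type u} [AddCommGroup N] [Module k N]
  [Module Aᵐᵒᵖ N] [IsScalarTower k Aᵐᵒᵖ N] [AddCommGroup N'] [Module k N'] [Module Aᵐᵒᵖ N']
  [IsScalarTower k Aᵐᵒᵖ N']

variable (k N) in
/-- The right action of matrices on rows with entries in a right module. -/
def rowMul (M : Matrix I J A) : (I → N) →ₗ[k] (J → N) where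
  toFun v b := ∑ a, op (M a b) • v a
  map_add' v w := funext fun b => by simp [Finset.sum_add_distrib]
  map_smul' c v := funext fun b => by
    have : SMulCommClass Aᵐᵒᵖ k N := IsScalarTower.to_smulCommClass'
    simp only [Pi.smul_apply, RingHom.id_apply, Finset.smul_sum]
    exact Finset.sum_congr rfl fun a _ => smul_comm _ _ _

theorem rowMul_apply (M : Matrix I J A) (v : I → N) (b : J) :
    rowMul k N M v b = ∑ a, op (M a b) • v a := rfl

theorem rowMul_rowMul [Fintype J] (M : Matrix I J A) (M' : Matrix J L A) (v : I → N) :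
    rowMul k N M' (rowMul k N M v) = rowMul k N (M * M') v := by
  funext c
  simp only [rowMul_apply, Matrix.mul_apply, Finset.op_sum, Finset.sum_smul, Finset.smul_sum,
    op_mul, mul_smul]
  exact Finset.sum_comm

theorem rowMul_zero (v : I → N) : rowMul k N (0 : Matrix I J A) v = 0 := by
  funext b
  simp [rowMul_apply]

theorem map_rowMul (g : N →ₗ[Aᵐᵒᵖ] N') (M : Matrix I J A) (v : I → N) :
    g ∘ rowMul k N M v = rowMul k N' M (g ∘ v) := by
  funext b
  simp [rowMul_apply]

end RMul

namespace MatComplex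

variable {𝒜 : ι → Submodule k A} (X : MatComplex 𝒜) (N : Type u) [AddCommGroup N] [Module k N]
  [Module Aᵐᵒᵖ N] [IsScalarTower k Aᵐᵒᵖ N]

/-- The cycles in position `n` with coefficients in a right module. -/
def cyclesAt (n : ℤ) : Submodule k (X.I → N) :=
  LinearMap.eqLocus (rowMul k N (X.R n)) LinearMap.id ⊓ LinearMap.ker (rowMul k N X.D)

/-- The homology in position `n` with coefficients in a right module is finite-dimensional. -/
def FiniteAt (n : ℤ) : Prop :=
  FiniteModulo (X.cyclesAt N n) (LinearMap.range (rowMul k N X.D))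

variable {X N}

theorem mem_cyclesAt {n : ℤ} {v : X.I → N} :
    v ∈ X.cyclesAt N n ↔ rowMul k N (X.R n) v = v ∧ rowMul k N X.D v = 0 := Iff.rfl

theorem finiteModulo_of_finiteAt (h : ∀ n, X.FiniteAt N n) (Z : Submodule k (X.I → N))
    (hZ : ∀ v ∈ Z, rowMul k N X.E v = v ∧ rowMul k N X.D v = 0) :
    FiniteModulo Z (LinearMap.range (rowMul k N X.D)) := by
  choose S hS h using h
  refine ⟨⨆ n ∈ X.support, S n, Submodule.fg_biSup _ _ fun n _ => hS n, fun v hv => ?_⟩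
  obtain ⟨h₁, h₂⟩ := hZ v hv
  have e : v = ∑ n ∈ X.support, rowMul k N (X.R n) v := by
    conv_lhs => rw [← h₁, ← X.sum_R]
    funext b
    simp only [rowMul_apply, Matrix.sum_apply, Finset.sum_apply, Finset.op_sum, Finset.sum_smul]
    exact Finset.sum_comm
  rw [e]
  refine Submodule.sum_mem _ fun n hn => ?_
  have : rowMul k N (X.R n) v ∈ X.cyclesAt N n := by
    refine mem_cyclesAt.2 ⟨by rw [rowMul_rowMul, X.R_mul_R], ?_⟩
    rw [rowMul_rowMul, X.R_mul_D, ← rowMul_rowMul, h₂, map_zero]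
  exact sup_le_sup_left (le_biSup S hn) _ (h n this)

variable {K F : Type u} [AddCommGroup K] [Module k K] [Module Aᵐᵒᵖ K] [IsScalarTower k Aᵐᵒᵖ K]
  [AddCommGroup F] [Module k F] [Module Aᵐᵒᵖ F] [IsScalarTower k Aᵐᵒᵖ F]

/-- Finiteness of the homology for a quotient in a short exact sequence. -/
theorem FiniteAt.of_exact (κ : K →ₗ[Aᵐᵒᵖ] F) (π : F →ₗ[Aᵐᵒᵖ] N) (hκ : Function.Injective κ)
    (hπ : Function.Surjective π) (hex : Function.Exact κ π) {n : ℤ} (hF : X.FiniteAt F n)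
    (hK : X.FiniteAt K (n + 1)) : X.FiniteAt N n := by
  let κI : (X.I → K) →ₗ[k] (X.I → F) := (κ.restrictScalars k).compLeft X.I
  let πI : (X.I → F) →ₗ[k] (X.I → N) := (π.restrictScalars k).compLeft X.I
  have hκI : ∀ (M : Matrix X.I X.I A) v, κI (rowMul k K M v) = rowMul k F M (κI v) :=
    fun M v => map_rowMul κ M v
  have hπI : ∀ (M : Matrix X.I X.I A) v, πI (rowMul k F M v) = rowMul k N M (πI v) :=
    fun M v => map_rowMul π M v
  have hκinj : Function.Injective κI := fun u v h => funext fun a => hκ (congrFun h a)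
  have hπκ : ∀ u, πI (κI u) = 0 := fun u => funext fun a => hex.apply_apply_eq_zero (u a)
  have hker : ∀ v, πI v = 0 → ∃ u, κI u = v := fun v hv => by
    choose u hu using fun a => (hex (v a)).1 (congrFun hv a)
    exact ⟨u, funext hu⟩
  -- The rows over `F` in position `n` whose image over `N` is a cycle. Their differentials come
  -- from cycles over `K` in position `n + 1`: this is the connecting homomorphism.
  let W : Submodule k (X.I → F) :=
    LinearMap.eqLocus (rowMul k F (X.R n)) LinearMap.id ⊓
      LinearMap.ker (πI ∘ₗ rowMul k F X.D)
  have hW : FiniteModulo (W.map (rowMul k F X.D))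
      ((LinearMap.range (rowMul k K X.D)).map κI) := by
    refine (hK.map κI).mono ?_ le_rfl
    rintro _ ⟨w, ⟨hw₁, hw₂⟩, rfl⟩
    have hw₁ : rowMul k F (X.R n) w = w := hw₁
    obtain ⟨u, hu⟩ := hker _ hw₂
    refine ⟨u, mem_cyclesAt.2 ⟨hκinj ?_, hκinj ?_⟩, hu⟩
    · rw [hκI, hu, rowMul_rowMul, ← X.R_mul_D, ← rowMul_rowMul, hw₁]
    · rw [hκI, hu, rowMul_rowMul, X.DD, rowMul_zero, map_zero]
  obtain ⟨S, hS, hSW, hWS⟩ := FiniteModulo.comap _ hW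
  have h₁ : FiniteModulo W (LinearMap.range κI ⊔ X.cyclesAt F n) := by
    refine ⟨S, hS, fun w hw => ?_⟩
    obtain ⟨y, ⟨_, ⟨u, rfl⟩, hu⟩, s, hs, rfl⟩ := Submodule.mem_sup.1 (hWS hw)
    have hy : y ∈ W := by
      have := W.sub_mem hw (hSW hs)
      rwa [add_sub_cancel_right] at this
    have hy₁ : rowMul k F (X.R n) y = y := hy.1
    refine Submodule.add_mem_sup ?_ hs
    -- The differential of `y` agrees with that of the row `κI (u R_n)` coming from `K`, so the
    -- difference is a cycle over `F`. The part from `K` dies over `N`.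
    have e : y = κI (rowMul k K (X.R n) u) + (y - κI (rowMul k K (X.R n) u)) := by abel
    rw [e]
    refine Submodule.add_mem_sup ⟨_, rfl⟩ (mem_cyclesAt.2 ⟨?_, ?_⟩)
    · rw [map_sub, hy₁, ← hκI, rowMul_rowMul, X.R_mul_R]
    · rw [map_sub, ← hκI, rowMul_rowMul, X.R_mul_D, ← rowMul_rowMul, hκI, hu, rowMul_rowMul,
        ← X.R_mul_D, ← rowMul_rowMul, hy₁, sub_self]
  have h₂ : FiniteModulo (LinearMap.range κI ⊔ X.cyclesAt F n)
      (LinearMap.range κI ⊔ LinearMap.range (rowMul k F X.D)) := by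
    obtain ⟨T, hT, h⟩ := hF
    exact ⟨T, hT, by rw [sup_assoc]; exact sup_le_sup_left h _⟩
  refine ((h₁.trans h₂).map πI).mono (fun v hv => ?_) ?_
  · obtain ⟨hv₁, hv₂⟩ := mem_cyclesAt.1 hv
    choose w hw using fun a => hπ (v a)
    have hw : πI w = v := funext hw
    refine ⟨rowMul k F (X.R n) w, ⟨?_, ?_⟩, ?_⟩
    · change rowMul k F (X.R n) (rowMul k F (X.R n) w) = rowMul k F (X.R n) w
      rw [rowMul_rowMul, X.R_mul_R]
    · change πI (rowMul k F X.D (rowMul k F (X.R n) w)) = 0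
      rw [hπI, hπI, hw, hv₁, hv₂]
    · rw [hπI, hw, hv₁]
  · rw [Submodule.map_sup]
    refine sup_le ?_ ?_
    · rintro _ ⟨_, ⟨u, rfl⟩, rfl⟩
      rw [hπκ]
      exact zero_mem _
    · rintro _ ⟨_, ⟨u, rfl⟩, rfl⟩
      exact ⟨πI u, (hπI _ u).symm⟩

/-- `Aᵐᵒᵖ` is `A` as a right module over itself, so its rows are the rows of the complex. This is
the starting case for coefficients in free modules. -/
theorem HasFiniteHomology.finiteAt_op (h : X.HasFiniteHomology) (n : ℤ) : X.FiniteAt Aᵐᵒᵖ n := by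
  let e : (X.I → A) →ₗ[k] (X.I → Aᵐᵒᵖ) := (opLinearEquiv k).toLinearMap.compLeft X.I
  have he : ∀ (M : Matrix X.I X.I A) v, e (v ᵥ* M) = rowMul k Aᵐᵒᵖ M (e v) := fun M v => by
    funext b
    simp [e, vecMul, dotProduct, rowMul_apply]
  have hinj : Function.Injective e := fun u v huv => funext fun a =>
    op_injective (congrFun huv a)
  have hsurj : Function.Surjective e := fun v => ⟨fun a => unop (v a), rfl⟩
  refine (FiniteModulo.map h e).mono (fun v hv => ?_) ?_
  · obtain ⟨v, rfl⟩ := hsurj v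
    obtain ⟨hv₁, hv₂⟩ := mem_cyclesAt.1 hv
    rw [← he] at hv₁ hv₂
    have hv₁ := hinj hv₁
    refine ⟨v, mem_cycles.2 ⟨?_, hinj (hv₂.trans (map_zero e).symm)⟩, rfl⟩
    conv_lhs => rw [← hv₁]
    rw [vecMul_vecMul, X.R_mul_E, hv₁]
  · rintro _ ⟨_, ⟨u, rfl⟩, rfl⟩
    exact ⟨e u, (he _ u).symm⟩

theorem FiniteAt.pi {n : ℤ} (h : X.FiniteAt N n) (r : ℕ) : X.FiniteAt (Fin r → N) n := by
  let sw : (Fin r → X.I → N) →ₗ[k] (X.I → Fin r → N) :=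
    { toFun := fun v a j => v j a
      map_add' := fun _ _ => rfl
      map_smul' := fun _ _ => rfl }
  have hsw : ∀ (M : Matrix X.I X.I A) v,
      rowMul k (Fin r → N) M (sw v) = sw fun j => rowMul k N M (v j) := fun M v => by
    funext b j
    simp [rowMul_apply, sw]
  have hinj : Function.Injective sw := fun u v huv => funext fun j => funext fun a =>
    congrFun (congrFun huv a) j
  refine ((FiniteModulo.pi fun _ : Fin r => h).map sw).mono (fun v hv => ?_) ?_
  · obtain ⟨v, rfl⟩ : ∃ w, sw w = v := ⟨fun j a => v a j, rfl⟩
    obtain ⟨hv₁, hv₂⟩ := mem_cyclesAt.1 hv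
    rw [hsw] at hv₁ hv₂
    exact ⟨v, fun j _ => ⟨congrFun (hinj hv₁) j,
      congrFun (hinj (hv₂.trans (map_zero sw).symm)) j⟩, rfl⟩
  · rintro _ ⟨v, hv, rfl⟩
    choose u hu using fun j => hv j trivial
    exact ⟨sw u, (hsw _ u).trans (congrArg sw (funext hu))⟩

/-- Over a right noetherian algebra, the homology with coefficients in a finitely generated right
module is finite-dimensional if the homology of the complex is. -/
theorem HasFiniteHomology.finiteAt [IsNoetherianRing Aᵐᵒᵖ] (h : X.HasFiniteHomology) (n : ℤ)
    (N : Type u) [AddCommGroup N] [Module k N] [Module Aᵐᵒᵖ N] [IsScalarTower k Aᵐᵒᵖ N]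
    [Module.Finite Aᵐᵒᵖ N] : X.FiniteAt N n := by
  obtain ⟨b, hb⟩ := X.support.bddAbove
  -- Descending induction on the position, for all coefficient modules at once: `m` bounds how far
  -- `n` lies below the top position `b`. For `m = 0` the position is beyond the support and all
  -- cycles vanish.
  obtain ⟨m, hm⟩ : ∃ m : ℕ, b - m < n := ⟨(b - n + 1).toNat, by omega⟩
  induction m generalizing n N with
  | zero =>
    have hn : n ∉ X.support := fun hn => by
      have := hb hn
      simp at hm
      omega
    refine ⟨⊥, Submodule.fg_bot, fun v hv => ?_⟩
    rw [← (mem_cyclesAt.1 hv).1, X.R_eq_zero hn, rowMul_zero]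
    exact zero_mem _
  | succ m ih =>
    -- Present `N` by a free right module. The kernel is finitely generated by the noetherian
    -- hypothesis and enters one position higher, where the induction applies.
    obtain ⟨r, π, hπ⟩ := Module.Finite.exists_fin' Aᵐᵒᵖ N
    refine FiniteAt.of_exact (LinearMap.ker π).subtype π Subtype.val_injective hπ
      (LinearMap.exact_subtype_ker_map π) ((h.finiteAt_op n).pi r) ?_
    exact ih (n + 1) (LinearMap.ker π) (by push_cast at hm; omega)

variable {B : Type u} [Ring B] [Algebra k B]

/-- The base change of a complex presented by matrices. -/
def map {ℬ : ι → Submodule k B} (X : MatComplex 𝒜) (f : A →ₐ[k] B)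
    (hf : ∀ r, ∀ a ∈ 𝒜 r, f a ∈ ℬ r) : MatComplex ℬ where
  I := X.I
  deg := X.deg
  pos := X.pos
  E := X.E.map f
  D := X.D.map f
  E_mem a b := hf _ _ (X.E_mem a b)
  D_mem a b := hf _ _ (X.D_mem a b)
  E_pos a b h := X.E_pos a b fun h' => h (by simp [h'])
  D_pos a b h := X.D_pos a b fun h' => h (by simp [h'])
  EE := by rw [← Matrix.map_mul, X.EE]
  ED := by rw [← Matrix.map_mul, X.ED]
  DE := by rw [← Matrix.map_mul, X.DE]
  DD := by rw [← Matrix.map_mul, X.DD, Matrix.map_zero _ (map_zero f)]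

theorem hasFiniteHomology_map {ℬ : ι → Submodule k B} (X : MatComplex 𝒜) (f : A →ₐ[k] B)
    (hf : ∀ r, ∀ a ∈ 𝒜 r, f a ∈ ℬ r) [Module Aᵐᵒᵖ B] [IsScalarTower k Aᵐᵒᵖ B]
    (hsmul : ∀ a (b : B), op a • b = b * f a) (h : ∀ n, X.FiniteAt B n) :
    (X.map f hf).HasFiniteHomology := by
  have he : ∀ (M : Matrix X.I X.I A) (v : X.I → B), rowMul k B M v = v ᵥ* M.map f := fun M v => by
    funext b
    simp [rowMul_apply, hsmul, vecMul, dotProduct]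
  refine (finiteModulo_of_finiteAt h ((X.map f hf).cycles.restrictScalars k) fun v hv => ?_).mono
    le_rfl ?_
  · rw [he, he]
    exact mem_cycles.1 hv
  · rintro _ ⟨u, rfl⟩
    exact ⟨u, (he _ _).symm⟩

end MatComplex

end RightModules

/-! ### Nonvanishing of the homology after base change -/

section Nonvanishing

open Matrix

variable {k A : Type u} [Field k] [Ring A] [Algebra k A]

namespace MatComplex

section Retraction

variable {ι : Type} [AddCommGroup ι] {𝒜 : ι → Submodule k A} (X : MatComplex 𝒜)

/-- The cycles in position `n`. -/
def cyc (n : ℤ) : Submodule A (X.I → A) :=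
  LinearMap.eqLocus (X.R n).vecMulLinear LinearMap.id ⊓ LinearMap.ker X.D.vecMulLinear

variable {X}

theorem mem_cyc {n : ℤ} {v : X.I → A} : v ∈ X.cyc n ↔ v ᵥ* X.R n = v ∧ v ᵥ* X.D = 0 := Iff.rfl

theorem cyc_le_cycles (n : ℤ) : X.cyc n ≤ X.cycles := fun v hv => by
  obtain ⟨h₁, h₂⟩ := mem_cyc.1 hv
  refine mem_cycles.2 ⟨?_, h₂⟩
  rw [← h₁, vecMul_vecMul, R_mul_E]

theorem vecMul_R_mem_cyc {v : X.I → A} (hv : v ᵥ* X.D = 0) (n : ℤ) : v ᵥ* X.R n ∈ X.cyc n :=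
  mem_cyc.2 ⟨by rw [vecMul_vecMul, R_mul_R], (mem_cycles.1 (X.vecMul_R_mem_cycles hv n)).2⟩

theorem cyc_eq_bot {n : ℤ} (hn : n ∉ X.support) : X.cyc n = ⊥ := by
  rw [eq_bot_iff]
  intro v hv
  rw [Submodule.mem_bot, ← (mem_cyc.1 hv).1, X.R_eq_zero hn, vecMul_zero]

/-- Above the top nonvanishing homology, the cycles are direct summands. -/
theorem exists_retraction {n : ℤ} (hn : ∀ m, n < m → X.cyc m ≤ X.boundaries) :
    ∃ r : (X.I → A) →ₗ[A] (X.I → A), (∀ v, r v ∈ X.cyc n) ∧ (∀ v ∈ X.cyc n, r v = v) ∧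
      ∀ v, r (v ᵥ* X.R n) = r v := by
  obtain ⟨b, hb⟩ := X.support.bddAbove
  obtain ⟨j, hj⟩ : ∃ j : ℕ, b - j < n := ⟨(b - n + 1).toNat, by omega⟩
  induction j generalizing n with
  | zero =>
    have hn : n ∉ X.support := fun hn => by
      have := hb hn
      simp at hj
      omega
    refine ⟨0, fun v => zero_mem _, fun v hv => ?_, fun v => rfl⟩
    rw [cyc_eq_bot hn, Submodule.mem_bot] at hv
    rw [hv, map_zero]
  | succ j ih =>
    obtain ⟨r, hr₁, hr₂, -⟩ := ih (n := n + 1) (fun m hm => hn m (by omega))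
      (by push_cast at hj; omega)
    let d : (X.I → A) →ₗ[A] X.cyc (n + 1) :=
      (X.D.vecMulLinear ∘ₗ (X.R n).vecMulLinear).codRestrict _ fun v => by
        refine mem_cyc.2 ⟨?_, ?_⟩
        · change v ᵥ* X.R n ᵥ* X.D ᵥ* X.R (n + 1) = v ᵥ* X.R n ᵥ* X.D
          rw [vecMul_vecMul, vecMul_vecMul, ← R_mul_D, ← Matrix.mul_assoc, R_mul_R,
            vecMul_vecMul]
        · change v ᵥ* X.R n ᵥ* X.D ᵥ* X.D = 0
          rw [vecMul_vecMul _ X.D, X.DD, vecMul_zero]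
    have hd : Function.Surjective d := by
      rintro ⟨z, hz⟩
      obtain ⟨u, hu⟩ := mem_boundaries.1 (hn (n + 1) (by omega) hz)
      refine ⟨u, Subtype.ext ?_⟩
      change u ᵥ* X.R n ᵥ* X.D = z
      rw [vecMul_vecMul, R_mul_D, ← vecMul_vecMul, hu, (mem_cyc.1 hz).1]
    -- By induction the cycles in position `n + 1` are a direct summand of a free module. They are
    -- all boundaries, so the differential onto them splits.
    have : Module.Projective A (X.cyc (n + 1)) :=
      Module.Projective.of_split (X.cyc (n + 1)).subtype (r.codRestrict _ hr₁)
        (LinearMap.ext fun z => Subtype.ext (hr₂ z z.2))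
    obtain ⟨s, hs⟩ := Module.projective_lifting_property d LinearMap.id hd
    have hs' : ∀ z, s z ᵥ* X.R n ᵥ* X.D = z := fun z =>
      congrArg Subtype.val (LinearMap.congr_fun hs z)
    have hdv : ∀ v, (d v : X.I → A) = v ᵥ* X.R n ᵥ* X.D := fun v => rfl
    -- Subtracting the lift of its differential makes a row in position `n` a cycle and leaves
    -- cycles unchanged.
    refine ⟨(X.R n).vecMulLinear ∘ₗ (LinearMap.id - s ∘ₗ d), fun v => ?_, fun v hv => ?_,
      fun v => ?_⟩
    · refine mem_cyc.2 ⟨?_, ?_⟩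
      · change (v - s (d v)) ᵥ* X.R n ᵥ* X.R n = (v - s (d v)) ᵥ* X.R n
        rw [vecMul_vecMul, R_mul_R]
      · change (v - s (d v)) ᵥ* X.R n ᵥ* X.D = 0
        rw [sub_vecMul, sub_vecMul, hs', hdv, sub_self]
    · obtain ⟨h₁, h₂⟩ := mem_cyc.1 hv
      have h₃ : d v = 0 := Subtype.ext (by rw [hdv, h₁, h₂]; rfl)
      change (v - s (d v)) ᵥ* X.R n = v
      rw [h₃, map_zero, sub_zero, h₁]
    · have h₃ : d (v ᵥ* X.R n) = d v := Subtype.ext (by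
        rw [hdv, hdv, vecMul_vecMul v, R_mul_R])
      change (v ᵥ* X.R n - s (d (v ᵥ* X.R n))) ᵥ* X.R n = (v - s (d v)) ᵥ* X.R n
      rw [h₃, sub_vecMul, sub_vecMul, vecMul_vecMul v, R_mul_R]

end Retraction

section Residue

variable {𝒜 : ℤ → Submodule k A} [GradedAlgebra 𝒜] (X : MatComplex 𝒜)

/-- The homogeneous component of a row. -/
def comp (r : ℤ) : (X.I → A) →ₗ[k] (X.I → A) :=
  LinearMap.pi fun a => GradedAlgebra.proj 𝒜 (r - X.deg a) ∘ₗ LinearMap.proj a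

theorem comp_apply (r : ℤ) (v : X.I → A) (a : X.I) :
    X.comp r v a = GradedAlgebra.proj 𝒜 (r - X.deg a) (v a) := rfl

theorem comp_vecMul (r : ℤ) (v : X.I → A) {M : Matrix X.I X.I A}
    (hM : ∀ a b, M a b ∈ 𝒜 (X.deg a - X.deg b)) : X.comp r (v ᵥ* M) = X.comp r v ᵥ* M := by
  funext b
  simp only [comp_apply, vecMul, dotProduct, map_sum]
  refine Finset.sum_congr rfl fun a _ => ?_
  rw [← GradedAlgebra.proj_mul_right (hM a b), sub_add_sub_cancel]

theorem comp_comp (r : ℤ) (v : X.I → A) : X.comp r (X.comp r v) = X.comp r v :=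
  funext fun _ => GradedAlgebra.proj_same (GradedAlgebra.proj_mem' _ _)

theorem comp_smul {i : ℤ} {a : A} (ha : a ∈ 𝒜 i) (r : ℤ) (v : X.I → A) :
    X.comp r (a • v) = a • X.comp (r - i) v := by
  funext b
  have e : r - X.deg b = i + (r - i - X.deg b) := by ring
  rw [comp_apply, Pi.smul_apply, Pi.smul_apply, comp_apply, smul_eq_mul, smul_eq_mul, e,
    GradedAlgebra.proj_mul_left ha]

theorem mem_of_comp_mem (S : Submodule k (X.I → A)) (v : X.I → A) (h : ∀ r, X.comp r v ∈ S) :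
    v ∈ S := by
  refine (GrMod.free 𝒜 X.deg).mem_of_proj_mem S v fun r => ?_
  have : (GrMod.free 𝒜 X.deg).proj r = X.comp r := by
    refine (GrMod.free 𝒜 X.deg).hom_ext_deg fun s m hm => ?_
    have hm' := (GrMod.free_mem_deg X.deg).1 hm
    by_cases hsr : s = r
    · subst hsr
      rw [GrMod.proj_same _ hm]
      exact funext fun a => (GradedAlgebra.proj_same (hm' a)).symm
    · rw [GrMod.proj_ne _ hsr hm]
      exact funext fun a => (GradedAlgebra.proj_ne (hm' a) fun e => hsr (by omega)).symm
  rw [this]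
  exact h r

/-- Over a connected graded algebra, the residual complex detects the homology. -/
theorem exists_residue (h𝒜 : IsConnectedGraded 𝒜) {f : A →ₐ[k] k}
    (hf : ∀ a, algebraMap k A (f a) = GradedAlgebra.proj 𝒜 0 a)
    (hX : ¬ X.cycles ≤ X.boundaries) :
    ∃ c : X.I → k, ∃ z ∈ X.cycles, (∀ a, ∑ b, f (X.D a b) * c b = 0) ∧
      ∑ a, f (z a) * c a ≠ 0 := by
  classical
  have h𝒜neg : ∀ i < 0, ∀ a ∈ 𝒜 i, a = 0 := fun i hi a ha => by
    by_contra h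
    exact (h𝒜.nonneg i fun e => h (by simpa [e] using ha)).not_gt hi
  -- the top position with nonzero homology
  obtain ⟨n, hn, hmax⟩ : ∃ n, ¬ X.cyc n ≤ X.boundaries ∧ ∀ m, n < m → X.cyc m ≤ X.boundaries := by
    let T := X.support.filter fun n => ¬ X.cyc n ≤ X.boundaries
    have hmem : ∀ n, ¬ X.cyc n ≤ X.boundaries → n ∈ T := fun n hn =>
      Finset.mem_filter.2 ⟨by
        by_contra h
        rw [cyc_eq_bot h] at hn
        exact hn bot_le, hn⟩
    have hT : T.Nonempty := by
      by_contra h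
      refine hX fun v hv => X.mem_of_vecMul_R_mem (mem_cycles.1 hv).1 fun n => ?_
      have hn : X.cyc n ≤ X.boundaries := by
        by_contra hn
        exact h ⟨n, hmem n hn⟩
      exact hn (vecMul_R_mem_cyc (mem_cycles.1 hv).2 n)
    refine ⟨T.max' hT, (Finset.mem_filter.1 (T.max'_mem hT)).2, fun m hm => ?_⟩
    by_contra h
    exact (T.le_max' m (hmem m h)).not_gt hm
  obtain ⟨ρ, hρ₁, hρ₂, hρ₃⟩ := exists_retraction hmax
  have hcyc : ∀ r, ∀ v ∈ X.cyc n, X.comp r v ∈ X.cyc n := fun r v hv => by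
    obtain ⟨h₁, h₂⟩ := mem_cyc.1 hv
    refine mem_cyc.2 ⟨?_, ?_⟩
    · rw [← comp_vecMul X r v (X.R_mem n), h₁]
    · rw [← comp_vecMul X r v X.D_mem, h₂, map_zero]
  have hbd : ∀ r, ∀ v ∈ X.boundaries, X.comp r v ∈ X.boundaries := by
    rintro r _ ⟨u, rfl⟩
    exact ⟨X.comp r u, (comp_vecMul X r u X.D_mem).symm⟩
  -- the lowest degree with nonzero homology
  obtain ⟨r, ⟨z₀, hz₀, hz₀'⟩, hmin⟩ : ∃ r, (∃ z ∈ X.cyc n, X.comp r z ∉ X.boundaries) ∧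
      ∀ s, (∃ z ∈ X.cyc n, X.comp s z ∉ X.boundaries) → r ≤ s := by
    obtain ⟨L, hL⟩ := (Finset.univ.image X.deg).bddBelow
    refine Int.exists_least_of_bdd ⟨L, ?_⟩ ?_
    · rintro s ⟨z, -, hz⟩
      by_contra hs
      refine hz ?_
      have : X.comp s z = 0 := funext fun a => h𝒜neg (s - X.deg a) (by
        have := hL (Finset.mem_coe.2 (Finset.mem_image_of_mem X.deg (Finset.mem_univ a)))
        omega) _ (GradedAlgebra.proj_mem' _ _)
      rw [this]
      exact zero_mem _
    · by_contra! h
      exact hn fun v hv =>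
        X.mem_of_comp_mem (X.boundaries.restrictScalars k) v fun r => h r v hv
  let z := X.comp r z₀
  have hz : z ∈ X.cyc n := hcyc r z₀ hz₀
  have hlow : ∀ s < r, ∀ y ∈ X.cyc n, X.comp s y ∈ X.boundaries := fun s hs y hy => by
    by_contra h
    exact (hmin s ⟨y, hy, h⟩).not_gt hs
  -- `U` is the span of the boundaries and of the products of the kernel of `f` with the cycles in
  -- position `n`. Its component of degree `r` consists of boundaries: a coefficient of positive
  -- degree multiplies a component of a cycle below degree `r`, a boundary by minimality of `r`. So
  -- `z` is not in `U`, as in Nakayama's lemma.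
  let U : Submodule k (X.I → A) := X.boundaries.restrictScalars k ⊔
    Submodule.span k {u | ∃ a : A, f a = 0 ∧ ∃ y ∈ X.cyc n, a • y = u}
  have hU : U ≤ (X.boundaries.restrictScalars k).comap (X.comp r) := by
    refine sup_le (fun v hv => hbd r v hv) (Submodule.span_le.2 ?_)
    rintro _ ⟨a, ha, y, hy, rfl⟩
    refine GradedAlgebra.mem_of_proj_mem (ℬ := 𝒜) (((X.boundaries.restrictScalars k).comap
      (X.comp r)).comap ((LinearMap.toSpanSingleton A (X.I → A) y).restrictScalars k)) a
      fun i => ?_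
    change X.comp r (GradedAlgebra.proj 𝒜 i a • y) ∈ X.boundaries
    rcases lt_trichotomy i 0 with hi | rfl | hi
    · rw [h𝒜neg i hi _ (GradedAlgebra.proj_mem' _ _), zero_smul, map_zero]
      exact zero_mem _
    · rw [← hf, ha, map_zero, zero_smul, map_zero]
      exact zero_mem _
    · rw [comp_smul X (GradedAlgebra.proj_mem' _ _)]
      exact X.boundaries.smul_mem _ (hlow _ (by omega) y hy)
  have hzU : z ∉ U := fun h => hz₀' (by
    have h' : X.comp r z ∈ X.boundaries := hU h
    rwa [comp_comp] at h')
  obtain ⟨μ, hμz, hμU⟩ := Submodule.exists_le_ker_of_notMem hzU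
  -- The retraction extends the functional `μ` from cycles to all rows. Since `U` absorbs the action
  -- of `a - f a` on cycles, `ψ` is `A`-linear through `f`, hence determined by its values on the
  -- basis, which form the covector `c`.
  let ψ : (X.I → A) →ₗ[k] k := μ ∘ₗ ρ.restrictScalars k
  have hψ : ∀ v, ψ v = μ (ρ v) := fun _ => rfl
  have hψ_smul : ∀ (a : A) v, ψ (a • v) = f a * ψ v := by
    intro a v
    have e : a • ρ v = (a - algebraMap k A (f a)) • ρ v + f a • ρ v := by
      rw [sub_smul, algebraMap_smul]
      abel
    have h₀ : (a - algebraMap k A (f a)) • ρ v ∈ U := Submodule.mem_sup_right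
      (Submodule.subset_span ⟨_, by simp, ρ v, hρ₁ v, rfl⟩)
    rw [hψ, map_smul, e, map_add, LinearMap.mem_ker.1 (hμU h₀), zero_add, map_smul, hψ,
      smul_eq_mul]
  have hψ_eq : ∀ v, ψ v = ∑ a, f (v a) * ψ (Pi.single a 1) := by
    intro v
    conv_lhs => rw [pi_eq_sum_univ' v]
    rw [map_sum]
    exact Finset.sum_congr rfl fun a _ => hψ_smul _ _
  refine ⟨fun a => ψ (Pi.single a 1), z, cyc_le_cycles n hz, fun a => ?_, ?_⟩
  · rw [← hψ_eq (X.D a), hψ, ← hρ₃]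
    have hDD : X.D a ᵥ* X.D = 0 := by
      rw [← Matrix.mul_apply_eq_vecMul, X.DD]
      rfl
    -- The part in position `n` of a row of `D` is a cycle, on which the retraction is the identity.
    -- It is also a boundary, so `μ` kills it.
    have hmem : X.D a ᵥ* X.R n ∈ X.cyc n := vecMul_R_mem_cyc hDD n
    rw [hρ₂ _ hmem]
    refine LinearMap.mem_ker.1 (hμU (Submodule.mem_sup_left ?_))
    refine ⟨X.R (n - 1) a, ?_⟩
    change X.R (n - 1) a ᵥ* X.D = X.D a ᵥ* X.R n
    rw [← Matrix.mul_apply_eq_vecMul, ← Matrix.mul_apply_eq_vecMul, R_mul_D, sub_add_cancel]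
  · rw [← hψ_eq z, hψ, hρ₂ z hz]
    exact hμz

end Residue

end MatComplex

variable {B : Type u} [Ring B] [Algebra k B]

/-- A nonzero graded algebra that is finite as a right module over a connected graded algebra `A`
is not generated by the augmentation ideal of `A`. -/
theorem exists_notMem_augmentation {𝒜 : ℤ → Submodule k A} [GradedAlgebra 𝒜]
    (h𝒜 : IsConnectedGraded 𝒜) {ℬ : ℤ → Submodule k B} [GradedAlgebra ℬ] [Nontrivial B]
    (f : A →ₐ[k] B) (hf : ∀ r, ∀ a ∈ 𝒜 r, f a ∈ ℬ r) (hfin : IsRightFinite f) :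
    ∃ b : B, b ∉ Submodule.span k {x | ∃ (y : B) (a : A), GradedAlgebra.proj 𝒜 0 a = 0 ∧
      y * f a = x} := by
  classical
  have h𝒜neg : ∀ i < 0, ∀ a ∈ 𝒜 i, a = 0 := fun i hi a ha => by
    by_contra h
    exact (h𝒜.nonneg i fun e => h (by simpa [e] using ha)).not_gt hi
  let _ : Module Aᵐᵒᵖ B := Module.compHom B (RingHom.op (f : A →+* B))
  obtain ⟨g, hg⟩ := (hfin : Module.Finite Aᵐᵒᵖ B).fg_top
  obtain ⟨L, hL⟩ := (g.biUnion fun b => (DirectSum.decompose ℬ b).support).bddBelow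
  -- Finitely many generators and nonnegative degrees in `A` bound the degrees of `B` from below.
  have hlow : ∀ b : B, ∀ r < L, GradedAlgebra.proj ℬ r b = 0 := by
    intro b
    have hb : b ∈ Submodule.span Aᵐᵒᵖ (g : Set B) := hg ▸ Submodule.mem_top
    induction hb using Submodule.span_induction with
    | mem x hx =>
      intro r hr
      by_contra h
      refine (hL (Finset.mem_coe.2 (Finset.mem_biUnion.2 ⟨x, hx, ?_⟩))).not_gt hr
      rw [DFinsupp.mem_support_iff]
      exact fun e => h (congrArg Subtype.val e)
    | zero => exact fun r _ => map_zero _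
    | add x y _ _ hx hy => exact fun r hr => by rw [map_add, hx r hr, hy r hr, add_zero]
    | smul a x _ hx =>
      intro r hr
      change GradedAlgebra.proj ℬ r (x * f a.unop) = 0
      refine GradedAlgebra.mem_of_proj_mem (ℬ := 𝒜) (LinearMap.ker
        (GradedAlgebra.proj ℬ r ∘ₗ LinearMap.mulLeft k x ∘ₗ f.toLinearMap)) a.unop fun i => ?_
      change GradedAlgebra.proj ℬ r (x * f (GradedAlgebra.proj 𝒜 i a.unop)) = 0
      have hi := GradedAlgebra.proj_mem' (𝒜 := 𝒜) i a.unop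
      rcases lt_or_ge i 0 with h | h
      · rw [h𝒜neg i h _ hi, map_zero, mul_zero, map_zero]
      · have := GradedAlgebra.proj_mul_right (hf i _ hi) (r - i) x
        rw [sub_add_cancel] at this
        rw [this, hx _ (by omega), zero_mul]
  -- In the lowest nonzero degree of `B`, no product of an element of `B` with one of positive
  -- degree in `A` can contribute.
  obtain ⟨r, hr, hmin⟩ : ∃ r, (∃ b ∈ ℬ r, b ≠ 0) ∧ ∀ s, (∃ b ∈ ℬ s, b ≠ 0) → r ≤ s := by
    refine Int.exists_least_of_bdd ⟨L, ?_⟩ ⟨0, 1, SetLike.one_mem_graded ℬ, one_ne_zero⟩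
    rintro s ⟨b, hb, hb'⟩
    by_contra hs
    exact hb' ((GradedAlgebra.proj_same hb).symm.trans (hlow b s (not_le.1 hs)))
  obtain ⟨b, hb, hb'⟩ := hr
  refine ⟨b, fun hmem => hb' ?_⟩
  rw [← GradedAlgebra.proj_same hb]
  refine (Submodule.span_le.2 ?_ : _ ≤ LinearMap.ker (GradedAlgebra.proj ℬ r)) hmem
  rintro _ ⟨y, a, ha, rfl⟩
  refine GradedAlgebra.mem_of_proj_mem (ℬ := 𝒜) (LinearMap.ker
    (GradedAlgebra.proj ℬ r ∘ₗ LinearMap.mulLeft k y ∘ₗ f.toLinearMap)) a fun i => ?_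
  change GradedAlgebra.proj ℬ r (y * f (GradedAlgebra.proj 𝒜 i a)) = 0
  have hi := GradedAlgebra.proj_mem' (𝒜 := 𝒜) i a
  rcases lt_trichotomy i 0 with h | rfl | h
  · rw [h𝒜neg i h _ hi, map_zero, mul_zero, map_zero]
  · rw [ha, map_zero, mul_zero, map_zero]
  · have := GradedAlgebra.proj_mul_right (hf i _ hi) (r - i) y
    rw [sub_add_cancel] at this
    rw [this]
    have h₀ : GradedAlgebra.proj ℬ (r - i) y = 0 := by
      by_contra hne
      have := hmin _ ⟨_, GradedAlgebra.proj_mem' (r - i) y, hne⟩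
      omega
    rw [h₀, zero_mul]

variable {ι : Type} [AddCommGroup ι]

/-- The homology does not vanish after a finite base change. -/
theorem MatComplex.not_cycles_le_map [DecidableEq ι] {𝒜 : ι → Submodule k A} [GradedAlgebra 𝒜]
    {ℬ : ι → Submodule k B} [GradedAlgebra ℬ] (ℓ : ι →+ ℤ)
    (h𝒜 : IsConnectedGraded (_root_.regrade ℓ 𝒜)) [Nontrivial B] (f : A →ₐ[k] B)
    (hf : ∀ r, ∀ a ∈ 𝒜 r, f a ∈ ℬ r) (hfin : IsRightFinite f) (X : MatComplex 𝒜)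
    (hX : ¬ X.cycles ≤ X.boundaries) : ¬ (X.map f hf).cycles ≤ (X.map f hf).boundaries := by
  obtain ⟨ε, hε⟩ := h𝒜.exists_aug
  obtain ⟨c, z, hz, hc, hzc⟩ := (X.regrade ℓ).exists_residue h𝒜 hε hX
  obtain ⟨b, hb⟩ := exists_notMem_augmentation h𝒜 (ℬ := _root_.regrade ℓ ℬ) f (fun r => by
    refine regrade_le (S := (_root_.regrade ℓ ℬ r).comap f.toLinearMap) ℓ ?_
    rintro i rfl a ha
    exact mem_regrade ℓ (hf i a ha)) hfin
  change X.I → k at c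
  change X.I → A at z
  have hc : ∀ a, ∑ b, ε (X.D a b) * c b = 0 := hc
  have hzc : ∑ a, ε (z a) * c a ≠ 0 := hzc
  obtain ⟨hz₁, hz₂⟩ : z ᵥ* X.E = z ∧ z ᵥ* X.D = 0 := hz
  set V := Submodule.span k {x | ∃ (y : B) (a : A),
    GradedAlgebra.proj (_root_.regrade ℓ 𝒜) 0 a = 0 ∧ y * f a = x} with hV
  have hVmem : ∀ (y : B) (a : A), ε a = 0 → y * f a ∈ V := fun y a ha =>
    Submodule.subset_span ⟨y, a, by rw [← hε, ha, map_zero], rfl⟩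
  intro hle
  -- The cycle `b ⊗ z`, to be paired with the covector `c`.
  let v : X.I → B := fun a => b * f (z a)
  have hmap : ∀ M : Matrix X.I X.I A, v ᵥ* M.map f = fun a => b * f ((z ᵥ* M) a) := fun M => by
    funext a
    simp [v, vecMul, dotProduct, Finset.mul_sum, mul_assoc]
  have hv : v ∈ (X.map f hf).cycles := by
    refine mem_cycles.2 ⟨?_, ?_⟩
    · change v ᵥ* X.E.map f = v
      rw [hmap, hz₁]
    · change v ᵥ* X.D.map f = 0
      rw [hmap, hz₂]
      funext a
      simp
  obtain ⟨u, hu⟩ := hle hv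
  change X.I → B at u
  have hu : u ᵥ* X.D.map f = v := hu
  -- If `v = u D`, the pairing has coefficients `∑ c_b D_{ab}`, which the augmentation kills.
  -- Computed directly, the pairing is `b` times an element with nonzero augmentation, so `b` itself
  -- would lie in `V`.
  have h₁ : ∑ a, c a • v a ∈ V := by
    have e : ∑ a, c a • v a = ∑ a, u a * f (∑ b, c b • X.D a b) := by
      rw [← hu]
      simp only [vecMul, dotProduct, map_apply, Finset.smul_sum, map_sum, Finset.mul_sum, map_smul,
        mul_smul_comm]
      exact Finset.sum_comm
    rw [e]
    refine V.sum_mem fun a _ => hVmem _ _ ?_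
    rw [map_sum, ← hc a]
    exact Finset.sum_congr rfl fun b _ => by rw [map_smul, smul_eq_mul, mul_comm]
  have h₂ : ∑ a, c a • v a = b * f (∑ a, c a • z a) := by
    simp only [v, map_sum, Finset.mul_sum, map_smul, mul_smul_comm]
  set y := ∑ a, c a • z a with hy
  have hεy : ε y ≠ 0 := by
    rw [hy, map_sum]
    convert hzc using 2 with a
    rw [map_smul, smul_eq_mul, mul_comm]
  have h₃ : b * f y = ε y • b + b * f (y - algebraMap k A (ε y)) := by
    rw [map_sub, AlgHom.commutes, mul_sub, ← Algebra.commutes, ← Algebra.smul_def]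
    abel
  rw [h₂, h₃] at h₁
  have h₄ : ε y • b ∈ V := (V.add_mem_iff_left (hVmem _ _ (by simp))).1 h₁
  exact hb ((V.smul_mem_iff hεy).1 h₄)

/-- The arguments on lowest degrees need a `ℤ`-grading. A homomorphism that is positive on nonzero
nonnegative degrees provides one without enlarging the degree-zero part. -/
theorem IsConnectedGraded.regrade [PartialOrder ι] {𝒜 : ι → Submodule k A}
    (h : IsConnectedGraded 𝒜) (ℓ : ι →+ ℤ) (hℓ : ∀ i, 0 ≤ i → 0 ≤ ℓ i)
    (hℓ' : ∀ i, 0 ≤ i → ℓ i = 0 → i = 0) : IsConnectedGraded (regrade ℓ 𝒜) where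
  nontrivial := h.nontrivial
  nonneg r hr := by
    by_contra hneg
    refine hr (eq_bot_iff.2 (regrade_le ℓ ?_))
    rintro i rfl
    by_contra hi
    exact hneg (hℓ i (h.nonneg i fun e => hi e.le))
  deg_zero := by
    rw [← h.deg_zero]
    refine le_antisymm (regrade_le ℓ fun i hi => ?_) fun a ha => ?_
    · by_cases hb : 𝒜 i = ⊥
      · rw [hb]
        exact bot_le
      · rw [hℓ' i (h.nonneg i hb) hi]
    · simpa using mem_regrade ℓ ha

theorem EpsilonCondition.of_rightFinite [DecidableEq ι] {𝒜 : ι → Submodule k A} [GradedAlgebra 𝒜]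
    {ℬ : ι → Submodule k B} [GradedAlgebra ℬ] (ℓ : ι →+ ℤ)
    (h𝒜 : IsConnectedGraded (_root_.regrade ℓ 𝒜)) [IsNoetherianRing Aᵐᵒᵖ] [Nontrivial B]
    (f : A →ₐ[k] B) (hf : ∀ r, ∀ a ∈ 𝒜 r, f a ∈ ℬ r) (hfin : IsRightFinite f)
    (h : EpsilonCondition 𝒜) : EpsilonCondition ℬ := by
  obtain ⟨X, hX, hne⟩ := h.hasEpsilonMatrices
  refine HasEpsilonMatrices.epsilonCondition
    ⟨X.map f hf, ?_, X.not_cycles_le_map ℓ h𝒜 f hf hfin hne⟩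
  let _ : Module Aᵐᵒᵖ B := Module.compHom B (RingHom.op (f : A →+* B))
  have : Module.Finite Aᵐᵒᵖ B := hfin
  have hsmul : ∀ a (b : B), MulOpposite.op a • b = b * f a := fun _ _ => rfl
  have : IsScalarTower k Aᵐᵒᵖ B := ⟨fun c a b => by
    induction a with
    | h a =>
      rw [← MulOpposite.op_smul, hsmul, hsmul, map_smul, mul_smul_comm]⟩
  exact X.hasFiniteHomology_map f hf hsmul fun n => hX.finiteAt n B

end Nonvanishing

/-! ### Tensor products of complexes -/

section Contraction

variable {k : Type*} [Field k] {V W : Type*} [AddCommGroup V] [Module k V] [AddCommGroup W]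
  [Module k W]

/-- Over a field, a section of the map onto its range extends to the whole space. -/
theorem LinearMap.exists_mul_mul_eq (d : Module.End k V) : ∃ h : Module.End k V, d * h * d = d := by
  obtain ⟨s, hs⟩ := d.rangeRestrict.exists_rightInverse_of_surjective d.range_rangeRestrict
  obtain ⟨h, hh⟩ := s.exists_extend
  refine ⟨h, LinearMap.ext fun v => ?_⟩
  have h₁ : h (d v) = s (d.rangeRestrict v) := LinearMap.congr_fun hh (d.rangeRestrict v)
  have h₂ : d.rangeRestrict (s (d.rangeRestrict v)) = d.rangeRestrict v :=
    LinearMap.congr_fun hs _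
  change d (h (d v)) = d v
  rw [h₁]
  exact congrArg Subtype.val h₂

/-- A complex `e V` of vector spaces with differential `d`, with the sign operator `s` on `e V`. -/
structure SignedComplex (d e s : Module.End k V) : Prop where
  ee : e * e = e
  de : d * e = d
  ed : e * d = d
  dd : d * d = 0
  se : s * e = s
  es : e * s = s
  ss : s * s = e
  ds : d * s = -(s * d)
  two : (2 : k) = 0 → s = e

namespace SignedComplex

variable {d e s : Module.End k V}

/-- A partial inverse of `d` is cut down by `e` and then made odd for the sign operator by taking
half of `h₁ - s h₁ s`. Oddness is what cancels the mixed terms in a tensor product. -/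
theorem exists_homotopy (C : SignedComplex d e s) :
    ∃ h : Module.End k V, d * h * d = d ∧ e * h = h ∧ h * e = h ∧ h * s = -(s * h) := by
  obtain ⟨h₀, hh₀⟩ := d.exists_mul_mul_eq
  let h₁ := e * h₀ * e
  have h₁d : d * h₁ * d = d := by
    calc d * h₁ * d = (d * e) * h₀ * (e * d) := by simp only [h₁, mul_assoc]
      _ = d := by rw [C.de, C.ed, hh₀]
  have eh₁ : e * h₁ = h₁ := by simp only [h₁, ← mul_assoc, C.ee]
  have h₁e : h₁ * e = h₁ := by simp only [h₁, mul_assoc, C.ee]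
  by_cases h2 : (2 : k) = 0
  -- In characteristic two the halving is unavailable, but `s = e` and anticommuting is commuting.
  · refine ⟨h₁, h₁d, eh₁, h₁e, ?_⟩
    rw [C.two h2, eh₁, h₁e, eq_neg_iff_add_eq_zero, ← two_smul k, h2, zero_smul]
  · have hs : d * (s * h₁ * s) * d = -d := by
      calc d * (s * h₁ * s) * d = (d * s) * h₁ * (s * d) := by simp only [mul_assoc]
        _ = (s * (d * h₁ * d)) * s := by
          rw [C.ds, neg_mul, neg_mul, ← mul_neg, ← C.ds]
          simp only [mul_assoc]
        _ = -d := by rw [h₁d, mul_assoc, C.ds, mul_neg, ← mul_assoc, C.ss, C.ed]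
    refine ⟨(2 : k)⁻¹ • (h₁ - s * h₁ * s), ?_, ?_, ?_, ?_⟩
    · rw [mul_smul_comm, smul_mul_assoc, mul_sub, sub_mul, hs, h₁d, sub_neg_eq_add, ← two_smul k,
        smul_smul, inv_mul_cancel₀ h2, one_smul]
    · rw [mul_smul_comm, mul_sub, eh₁, ← mul_assoc, ← mul_assoc, C.es]
    · rw [smul_mul_assoc, sub_mul, h₁e, mul_assoc _ s e, C.se]
    · rw [smul_mul_assoc, mul_smul_comm, ← smul_neg, sub_mul, mul_sub, mul_assoc _ s s, C.ss,
        mul_assoc s h₁ e, h₁e, mul_assoc s h₁ s, ← mul_assoc s s, C.ss, ← mul_assoc e, eh₁, neg_sub]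

/-- If the homology is finite-dimensional, then the complex is contractible up to an endomorphism
whose square has finite rank. -/
theorem exists_contraction (C : SignedComplex d e s)
    (hfin : FiniteModulo (LinearMap.eqLocus e 1 ⊓ LinearMap.ker d)
    (LinearMap.range d)) :
    ∃ h π : Module.End k V, d * h + h * d = e - π ∧ e * h = h ∧ h * e = h ∧ h * s = -(s * h) ∧
      e * π = π ∧ π * e = π ∧ (LinearMap.range (π * π)).FG := by
  obtain ⟨h, hd, eh, he, hs⟩ := C.exists_homotopy
  refine ⟨h, e - (d * h + h * d), by abel, eh, he, hs, ?_⟩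
  set π := e - (d * h + h * d) with hπ
  have dπ : d * π = 0 := by
    rw [hπ, mul_sub, mul_add, ← mul_assoc, ← mul_assoc, C.dd, hd, C.de, zero_mul, zero_add,
      sub_self]
  have πd : π * d = 0 := by
    rw [hπ, sub_mul, add_mul, hd, mul_assoc h, C.dd, C.ed, mul_zero, add_zero, sub_self]
  have eπ : e * π = π := by
    rw [hπ, mul_sub, mul_add, ← mul_assoc, ← mul_assoc, C.ee, C.ed, eh]
  refine ⟨eπ, ?_, ?_⟩
  · rw [hπ, sub_mul, add_mul, mul_assoc, mul_assoc, C.ee, C.de, he]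
  -- The image of `π` consists of cycles, hence lies in boundaries plus `S`. As `π` kills
  -- boundaries, the image of its square lies in the image of `S`.
  obtain ⟨S, hS, hle⟩ := hfin
  have : FiniteDimensional k (S.map π) := Module.Finite.iff_fg.2 (hS.map π)
  refine Module.Finite.iff_fg.1 (Submodule.finiteDimensional_of_le (S₂ := S.map π) ?_)
  rintro _ ⟨v, rfl⟩
  obtain ⟨_, ⟨u, rfl⟩, t, ht, e₁⟩ := Submodule.mem_sup.1
    (hle (show π v ∈ _ from ⟨LinearMap.congr_fun eπ v, LinearMap.congr_fun dπ v⟩))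
  refine ⟨t, ht, ?_⟩
  change π t = π (π v)
  have h₀ : π (d u) = 0 := LinearMap.congr_fun πd u
  rw [← e₁, map_add, h₀, zero_add]

end SignedComplex

open TensorProduct in
/-- The tensor product of two complexes with finite-dimensional homology has finite-dimensional
homology. -/
theorem SignedComplex.finiteModulo_tensor {d e s : Module.End k V} {d' e' s' : Module.End k W}
    (C : SignedComplex d e s) (C' : SignedComplex d' e' s')
    (hfin : FiniteModulo (LinearMap.eqLocus e 1 ⊓ LinearMap.ker d) (LinearMap.range d))
    (hfin' : FiniteModulo (LinearMap.eqLocus e' 1 ⊓ LinearMap.ker d') (LinearMap.range d')) :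
    FiniteModulo
      (LinearMap.eqLocus (map e e') 1 ⊓ LinearMap.ker (map d e' + map s d'))
      (LinearMap.range (map d e' + map s d')) := by
  obtain ⟨h, π, hh, eh, he, hs, eπ, πe, hπ⟩ := C.exists_contraction hfin
  obtain ⟨h', π', hh', eh', he', hs', eπ', πe', hπ'⟩ := C'.exists_contraction hfin'
  set Δ := map d e' + map s d' with hΔ
  set Z := LinearMap.eqLocus (map e e') 1 ⊓ LinearMap.ker Δ with hZ
  have hneg : ∀ (x : Module.End k V) (y : Module.End k W), map (-x) y = -map x y := fun x y => by
    rw [eq_neg_iff_add_eq_zero, ← map_add_left, neg_add_cancel, map_zero_left]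
  have ΔΔ : Δ * Δ = 0 := by
    rw [hΔ]
    simp only [add_mul, mul_add, ← TensorProduct.map_mul, C.dd, C'.dd, C'.ed, C'.de, C.ds]
    rw [map_zero_left, map_zero_right, hneg, zero_add, add_zero, add_neg_cancel]
  have EΔ : map e e' * Δ = Δ := by
    rw [hΔ, mul_add, ← TensorProduct.map_mul, ← TensorProduct.map_mul, C.ed, C.es, C'.ee, C'.ed]
  have hRZ : LinearMap.range Δ ≤ Z := by
    rintro _ ⟨u, rfl⟩
    exact ⟨LinearMap.congr_fun EΔ u, LinearMap.congr_fun ΔΔ u⟩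
  -- An operator homotopic to the identity moves a cycle only by a boundary.
  have key : ∀ T K : Module.End k (V ⊗[k] W), Δ * K + K * Δ = map e e' - T →
      ∀ z ∈ Z, z - T z ∈ LinearMap.range Δ := by
    rintro T K hK z ⟨hz₁, hz₂⟩
    have hz₁ : map e e' z = z := hz₁
    have hz₂ : Δ z = 0 := hz₂
    refine ⟨K z, ?_⟩
    have := LinearMap.congr_fun hK z
    change Δ (K z) + K (Δ z) = map e e' z - T z at this
    rwa [hz₁, hz₂, map_zero, add_zero] at this
  -- Contract the first factor, then, with the sign operator, the second. The mixed terms cancel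
  -- because `h` and `d` anticommute with `s`.
  have h₁ := key (map π e') (map h e') (by
    rw [hΔ]
    simp only [add_mul, mul_add, ← TensorProduct.map_mul, C'.ee, C'.de, C'.ed, hs]
    rw [hneg, add_add_add_comm, ← map_add_left, hh,
      add_neg_cancel, add_zero, eq_sub_iff_add_eq, ← map_add_left, sub_add_cancel])
  have h₂ := key (map e π') (map s h') (by
    rw [hΔ]
    simp only [add_mul, mul_add, ← TensorProduct.map_mul, C.ss, C.ds, eh', he']
    rw [hneg, add_add_add_comm, ← map_add_right, hh',
      neg_add_cancel, zero_add, eq_sub_iff_add_eq, ← map_add_right, sub_add_cancel])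
  have comp : ∀ T T' : Module.End k (V ⊗[k] W), (∀ z ∈ Z, z - T z ∈ LinearMap.range Δ) →
      (∀ z ∈ Z, z - T' z ∈ LinearMap.range Δ) → ∀ z ∈ Z, z - (T * T') z ∈ LinearMap.range Δ := by
    intro T T' hT hT' z hz
    have h₀ : T' z ∈ Z := by
      have := Z.sub_mem hz (hRZ (hT' z hz))
      rwa [sub_sub_cancel] at this
    have := Submodule.add_mem _ (hT' z hz) (hT _ h₀)
    rwa [sub_add_sub_cancel] at this
  -- Each replacement is applied twice, so that the squares of `π` and `π'`, which have finite rank,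
  -- appear.
  have h₃ := comp _ _ (comp _ _ h₁ h₁) (comp _ _ h₂ h₂)
  have hT : map π e' * map π e' * (map e π' * map e π') = map (π * π) (π' * π') := by
    simp only [← TensorProduct.map_mul, C.ee, C'.ee, mul_assoc, πe]
    rw [← mul_assoc e', eπ']
  rw [hT] at h₃
  refine ⟨LinearMap.range (map (π * π) (π' * π')), ?_, fun z hz => ?_⟩
  · have : FiniteDimensional k (LinearMap.range (π * π)) := Module.Finite.iff_fg.2 hπ
    have : FiniteDimensional k (LinearMap.range (π' * π')) := Module.Finite.iff_fg.2 hπ'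
    refine Module.Finite.iff_fg.1 (Submodule.finiteDimensional_of_le (S₂ := LinearMap.range
      (map (LinearMap.range (π * π)).subtype (LinearMap.range (π' * π')).subtype)) ?_)
    have e₁ : map (π * π) (π' * π') =
        map (LinearMap.range (π * π)).subtype (LinearMap.range (π' * π')).subtype ∘ₗ
          map (π * π).rangeRestrict (π' * π').rangeRestrict := by
      rw [← map_comp]
      rfl
    rw [e₁]
    exact LinearMap.range_comp_le_range _ _
  · rw [← sub_add_cancel z (map (π * π) (π' * π') z)]
    exact Submodule.add_mem_sup (h₃ z hz) ⟨z, rfl⟩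

end Contraction

/-! ### Tensor products of matrix complexes -/

section TensorComplex

open Matrix TensorProduct
open scoped Kronecker

variable {k A B : Type u} [Field k] [Ring A] [Algebra k A] [Ring B] [Algebra k B]

section Rows

variable {I J : Type} [Fintype I] [Fintype J] [DecidableEq I] [DecidableEq J]

variable (k A B I J) in
/-- The tensor product of two spaces of rows. -/
def tensorRows : (I → A) ⊗[k] (J → B) ≃ₗ[k] (I × J → A ⊗[k] B) :=
  LinearEquiv.ofLinearMap
    (LinearMap.pi fun p => TensorProduct.map (LinearMap.proj p.1) (LinearMap.proj p.2))
    (∑ p : I × J, TensorProduct.map (LinearMap.single k (fun _ => A) p.1)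
      (LinearMap.single k (fun _ => B) p.2) ∘ₗ LinearMap.proj p)
    (by
      ext p a b q
      simp only [LinearMap.comp_apply, LinearMap.sum_apply, AlgebraTensorModule.curry_apply,
        curry_apply, LinearMap.coe_restrictScalars, LinearMap.coe_single, LinearMap.pi_apply,
        LinearMap.proj_apply, LinearMap.id_apply]
      rw [Finset.sum_eq_single p _ (by simp)]
      · by_cases hq : q = p
        · subst hq
          simp
        · rw [Pi.single_eq_same, Pi.single_eq_of_ne hq, map_tmul, map_tmul]
          by_cases h₁ : q.1 = p.1
          · have h₂ : q.2 ≠ p.2 := fun h₂ => hq (Prod.ext h₁ h₂)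
            simp [h₂]
          · simp [h₁]
      · intro q _ hq
        rw [Pi.single_eq_of_ne hq, map_zero])
    (by
      ext a b c d
      simp [Fintype.sum_prod_type, ← tmul_sum, ← sum_tmul, Finset.univ_sum_single])

theorem tensorRows_tmul (v : I → A) (w : J → B) (p : I × J) :
    tensorRows k A B I J (v ⊗ₜ w) p = v p.1 ⊗ₜ w p.2 := rfl

theorem tensorRows_map_vecMul (M : Matrix I I A) (N : Matrix J J B) (x : (I → A) ⊗[k] (J → B)) :
    tensorRows k A B I J (TensorProduct.map (M.vecMulLinear.restrictScalars k)
      (N.vecMulLinear.restrictScalars k) x) = tensorRows k A B I J x ᵥ* (M ⊗ₖₜ[k] N) := by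
  induction x with
  | zero => simp
  | add x y hx hy => rw [map_add, map_add, map_add, add_vecMul, hx, hy]
  | tmul v w =>
    funext ⟨b, d⟩
    rw [TensorProduct.map_tmul, tensorRows_tmul]
    simp only [vecMul, dotProduct, Fintype.sum_prod_type, tensorRows_tmul, kroneckerMap_apply,
      Algebra.TensorProduct.tmul_mul_tmul, LinearMap.coe_restrictScalars, vecMulLinear_apply,
      sum_tmul, tmul_sum]
    exact Finset.sum_comm

end Rows

variable (k) in
/-- The action of a matrix on rows. -/
abbrev Matrix.rowOp {I : Type} [Fintype I] (M : Matrix I I A) : Module.End k (I → A) :=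
  M.vecMulLinear.restrictScalars k

theorem Matrix.rowOp_mul {I : Type} [Fintype I] (M N : Matrix I I A) :
    M.rowOp k * N.rowOp k = (N * M).rowOp k :=
  LinearMap.ext fun v => vecMul_vecMul v N M

namespace MatComplex

variable {ι κ : Type} [AddCommGroup ι] [AddCommGroup κ] {𝒜 : ι → Submodule k A}
  (X : MatComplex 𝒜)

/-- The sign of a basis vector. -/
def sgn (a : X.I) : k := ((-1 : kˣ) ^ X.pos a : kˣ)

theorem sgn_mul_sgn (a : X.I) : X.sgn a * X.sgn a = 1 := by
  rw [sgn, ← Units.val_mul, ← mul_zpow, neg_mul_neg, one_mul, _root_.one_zpow, Units.val_one]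

/-- The idempotent with signs. -/
def signE : Matrix X.I X.I A := Matrix.of fun a b => X.sgn a • X.E a b

theorem signE_eq : X.signE = diagonal (fun a => algebraMap k A (X.sgn a)) * X.E := by
  ext a b
  rw [diagonal_mul, ← Algebra.smul_def]
  rfl

theorem signE_eq' : X.signE = X.E * diagonal (fun a => algebraMap k A (X.sgn a)) := by
  ext a b
  rw [mul_diagonal, ← Algebra.commutes, ← Algebra.smul_def]
  change X.sgn a • X.E a b = X.sgn b • X.E a b
  by_cases h : X.E a b = 0
  · rw [h, smul_zero, smul_zero]
  · rw [sgn, sgn, X.E_pos a b h]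

/-- Nonzero entries of `D` change the position by one and so flip the sign. -/
theorem diagonal_sgn_mul_D : diagonal (fun a => algebraMap k A (X.sgn a)) * X.D =
    -(X.D * diagonal fun a => algebraMap k A (X.sgn a)) := by
  ext a b
  rw [neg_apply, diagonal_mul, mul_diagonal, ← Algebra.commutes (X.sgn b)]
  by_cases h : X.D a b = 0
  · rw [h, mul_zero, mul_zero, neg_zero]
  · rw [sgn, sgn, X.D_pos a b h, _root_.zpow_add, _root_.zpow_one, mul_neg, mul_one, Units.val_neg,
      map_neg, neg_mul, neg_neg]

theorem diagonal_sgn_sq : diagonal (fun a => algebraMap k A (X.sgn a)) *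
    diagonal (fun a => algebraMap k A (X.sgn a)) = 1 := by
  rw [diagonal_mul_diagonal, ← diagonal_one]
  exact congrArg _ (funext fun a => by rw [← map_mul, X.sgn_mul_sgn, map_one])

theorem signE_mul_E : X.signE * X.E = X.signE := by
  rw [signE_eq, Matrix.mul_assoc, X.EE]

theorem E_mul_signE : X.E * X.signE = X.signE := by
  rw [signE_eq', ← Matrix.mul_assoc, X.EE]

theorem signE_mul_signE : X.signE * X.signE = X.E := by
  nth_rewrite 1 [signE_eq]
  rw [Matrix.mul_assoc, E_mul_signE, signE_eq, ← Matrix.mul_assoc, diagonal_sgn_sq,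
    Matrix.one_mul]

theorem signE_mul_D : X.signE * X.D = -(X.D * X.signE) := by
  rw [signE_eq, Matrix.mul_assoc, X.ED, diagonal_sgn_mul_D, ← signE_eq, signE_eq',
    ← Matrix.mul_assoc, X.DE]

theorem signedComplex : SignedComplex (X.D.rowOp k) (X.E.rowOp k) (X.signE.rowOp k) where
  ee := by rw [rowOp_mul, X.EE]
  de := by rw [rowOp_mul, X.ED]
  ed := by rw [rowOp_mul, X.DE]
  dd := by
    rw [rowOp_mul, X.DD]
    exact LinearMap.ext vecMul_zero
  se := by rw [rowOp_mul, X.E_mul_signE]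
  es := by rw [rowOp_mul, X.signE_mul_E]
  ss := by rw [rowOp_mul, X.signE_mul_signE]
  ds := by
    rw [rowOp_mul, rowOp_mul, signE_mul_D]
    exact LinearMap.ext fun v => vecMul_neg v _
  two h := by
    have h₁ : (-1 : kˣ) = 1 := Units.ext (by
      rw [Units.val_neg, Units.val_one, neg_eq_iff_add_eq_zero, one_add_one_eq_two, h])
    have h₂ : X.signE = X.E := by
      ext a b
      simp [signE, sgn, h₁]
    rw [h₂]

variable {ℬ : κ → Submodule k B} (Y : MatComplex ℬ)

/-- The tensor product of two complexes. -/
def tensor : MatComplex (fun r : ι × κ => Submodule.map₂ (TensorProduct.mk k A B) (𝒜 r.1) (ℬ r.2))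
    where
  I := X.I × Y.I
  deg p := (X.deg p.1, Y.deg p.2)
  pos p := X.pos p.1 + Y.pos p.2
  E := X.E ⊗ₖₜ[k] Y.E
  D := X.D ⊗ₖₜ[k] Y.E + X.signE ⊗ₖₜ[k] Y.D
  E_mem p q := Submodule.apply_mem_map₂ _ (X.E_mem _ _) (Y.E_mem _ _)
  D_mem p q := Submodule.add_mem _ (Submodule.apply_mem_map₂ _ (X.D_mem _ _) (Y.E_mem _ _))
    (Submodule.apply_mem_map₂ _ (Submodule.smul_mem _ _ (X.E_mem _ _)) (Y.D_mem _ _))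
  E_pos p q h := by
    rw [kroneckerMap_apply] at h
    rw [X.E_pos p.1 q.1 fun e => h (by rw [e, zero_tmul]),
      Y.E_pos p.2 q.2 fun e => h (by rw [e, tmul_zero])]
  D_pos p q h := by
    rw [Matrix.add_apply, kroneckerMap_apply, kroneckerMap_apply] at h
    by_cases h₁ : X.D p.1 q.1 ⊗ₜ[k] Y.E p.2 q.2 = 0
    · rw [h₁, zero_add] at h
      have h₂ : X.E p.1 q.1 ≠ 0 := fun e => h (by simp [signE, e])
      rw [X.E_pos p.1 q.1 h₂, Y.D_pos p.2 q.2 fun e => h (by rw [e, tmul_zero]), add_assoc]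
    · rw [X.D_pos p.1 q.1 fun e => h₁ (by rw [e, zero_tmul]),
        Y.E_pos p.2 q.2 fun e => h₁ (by rw [e, tmul_zero]), add_right_comm]
  EE := by rw [← mul_kroneckerTMul_mul, X.EE, Y.EE]
  ED := by
    rw [Matrix.mul_add, ← mul_kroneckerTMul_mul, ← mul_kroneckerTMul_mul, X.ED, Y.EE,
      X.E_mul_signE, Y.ED]
  DE := by
    rw [Matrix.add_mul, ← mul_kroneckerTMul_mul, ← mul_kroneckerTMul_mul, X.DE, Y.EE,
      X.signE_mul_E, Y.DE]
  DD := by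
    rw [Matrix.mul_add, Matrix.add_mul, Matrix.add_mul, ← mul_kroneckerTMul_mul,
      ← mul_kroneckerTMul_mul, ← mul_kroneckerTMul_mul, ← mul_kroneckerTMul_mul, X.DD, Y.DD,
      X.signE_mul_D, Y.ED, Y.DE]
    ext p q
    simp [neg_tmul]

theorem tensorRows_rowOp_D (x : (X.I → A) ⊗[k] (Y.I → B)) :
    tensorRows k A B X.I Y.I ((TensorProduct.map (X.D.rowOp k) (Y.E.rowOp k) +
      TensorProduct.map (X.signE.rowOp k) (Y.D.rowOp k)) x) =
      tensorRows k A B X.I Y.I x ᵥ* (X.tensor Y).D := by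
  rw [LinearMap.add_apply, map_add, tensorRows_map_vecMul, tensorRows_map_vecMul, ← vecMul_add]
  rfl

end MatComplex

/-- Finiteness comes from the contractions. For nonvanishing, functionals that kill the boundaries
and are nonzero on cycles `p` and `q` have a tensor product that kills the boundaries of the product
and is nonzero on `p ⊗ q`. -/
theorem HasEpsilonMatrices.tensor {ι κ : Type} [AddCommGroup ι] [AddCommGroup κ]
    {𝒜 : ι → Submodule k A} {ℬ : κ → Submodule k B} (h : HasEpsilonMatrices 𝒜)
    (h' : HasEpsilonMatrices ℬ) : HasEpsilonMatrices
      (fun r : ι × κ => Submodule.map₂ (TensorProduct.mk k A B) (𝒜 r.1) (ℬ r.2)) := by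
  obtain ⟨X, hX, hX'⟩ := h
  obtain ⟨Y, hY, hY'⟩ := h'
  let Φ := tensorRows k A B X.I Y.I
  refine ⟨X.tensor Y, ?_, fun hle => ?_⟩
  · refine ((X.signedComplex.finiteModulo_tensor Y.signedComplex hX hY).map Φ.toLinearMap).mono
      (fun v hv => ?_) ?_
    · obtain ⟨x, rfl⟩ := Φ.surjective v
      obtain ⟨h₁, h₂⟩ := MatComplex.mem_cycles.1 hv
      refine ⟨x, ⟨Φ.injective ?_, Φ.injective ?_⟩, rfl⟩
      · exact (tensorRows_map_vecMul X.E Y.E x).trans h₁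
      · exact (X.tensorRows_rowOp_D Y x).trans (h₂.trans (map_zero Φ).symm)
    · rintro _ ⟨_, ⟨u, rfl⟩, rfl⟩
      exact ⟨Φ u, (X.tensorRows_rowOp_D Y u).symm⟩
  · obtain ⟨p, hp, hp'⟩ := Set.not_subset.1 hX'
    obtain ⟨q, hq, hq'⟩ := Set.not_subset.1 hY'
    obtain ⟨lam, hlam, hlam'⟩ := Submodule.exists_le_ker_of_notMem
      (p := X.boundaries.restrictScalars k) hp'
    obtain ⟨mu, hmu, hmu'⟩ := Submodule.exists_le_ker_of_notMem
      (p := Y.boundaries.restrictScalars k) hq'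
    have h₁ : lam ∘ₗ X.D.rowOp k = 0 := LinearMap.ext fun u => hlam' (X.vecMul_D_mem u)
    have h₂ : mu ∘ₗ Y.D.rowOp k = 0 := LinearMap.ext fun u => hmu' (Y.vecMul_D_mem u)
    obtain ⟨hp₁, hp₂⟩ := MatComplex.mem_cycles.1 hp
    obtain ⟨hq₁, hq₂⟩ := MatComplex.mem_cycles.1 hq
    have hp₂ : X.D.rowOp k p = 0 := hp₂
    have hq₂ : Y.D.rowOp k q = 0 := hq₂
    have hz : Φ (p ⊗ₜ q) ∈ (X.tensor Y).cycles := by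
      refine MatComplex.mem_cycles.2 ⟨?_, ?_⟩
      · refine (tensorRows_map_vecMul X.E Y.E _).symm.trans (congrArg Φ ?_)
        exact (map_tmul _ _ _ _).trans (congrArg₂ _ hp₁ hq₁)
      · refine (X.tensorRows_rowOp_D Y _).symm.trans ?_
        rw [LinearMap.add_apply, map_tmul, map_tmul, hp₂, hq₂, zero_tmul, tmul_zero, add_zero,
          map_zero]
        rfl
    obtain ⟨u, hu⟩ := hle hz
    obtain ⟨x, rfl⟩ := Φ.surjective u
    have hx := Φ.injective ((X.tensorRows_rowOp_D Y x).trans hu)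
    have h₃ := congrArg (TensorProduct.map lam mu) hx
    rw [LinearMap.add_apply, map_add, ← LinearMap.comp_apply, ← LinearMap.comp_apply, ← map_comp,
      ← map_comp, h₁, h₂, map_zero_left, map_zero_right, LinearMap.zero_apply,
      add_zero, map_tmul] at h₃
    have h₄ := congrArg (TensorProduct.lid k k) h₃
    rw [map_zero, lid_tmul, smul_eq_mul] at h₄
    exact mul_ne_zero hlam hmu h₄.symm

end TensorComplex

/-! ### Gradings of tensor products -/

section TensorGrading

open TensorProduct

variable {k A B : Type u} [Field k] [Ring A] [Algebra k A] [Ring B] [Algebra k B]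
  {𝒜 : ℤ → Submodule k A} {ℬ : ℤ → Submodule k B}

theorem tmul_mem_tensorGrading {i j : ℤ} {a : A} {b : B} (ha : a ∈ 𝒜 i) (hb : b ∈ ℬ j) :
    a ⊗ₜ[k] b ∈ tensorGrading 𝒜 ℬ (i, j) :=
  Submodule.apply_mem_map₂ _ ha hb

instance GradedAlgebra.tensor (𝒜 : ℤ → Submodule k A) [GradedAlgebra 𝒜] (ℬ : ℤ → Submodule k B)
    [GradedAlgebra ℬ] : GradedAlgebra (tensorGrading 𝒜 ℬ) := by
  refine GradedAlgebra.ofIsInternal _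
    (tmul_mem_tensorGrading (SetLike.one_mem_graded 𝒜) (SetLike.one_mem_graded ℬ)) ?_ ?_
  · rintro ⟨i, j⟩ ⟨i', j'⟩
    rw [tensorGrading, tensorGrading, Submodule.map₂_eq_span_image2,
      Submodule.map₂_eq_span_image2, Submodule.span_mul_span, Submodule.span_le]
    rintro _ ⟨_, ⟨a, ha, b, hb, rfl⟩, _, ⟨a', ha', b', hb', rfl⟩, rfl⟩
    change (a ⊗ₜ[k] b) * (a' ⊗ₜ[k] b') ∈ tensorGrading 𝒜 ℬ (i + i', j + j')
    rw [Algebra.TensorProduct.tmul_mul_tmul]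
    exact tmul_mem_tensorGrading (SetLike.mul_mem_graded ha ha') (SetLike.mul_mem_graded hb hb')
  · refine isInternal_of_proj _
      (fun r => TensorProduct.map (GradedAlgebra.proj 𝒜 r.1) (GradedAlgebra.proj ℬ r.2)) ?_ ?_ ?_
    · rintro ⟨i, j⟩ v hv
      refine (Submodule.map₂_le.2 fun a ha b hb => ?_ : tensorGrading 𝒜 ℬ (i, j) ≤
        LinearMap.eqLocus (TensorProduct.map (GradedAlgebra.proj 𝒜 i) (GradedAlgebra.proj ℬ j))
          LinearMap.id) hv
      exact congrArg₂ (· ⊗ₜ[k] ·) (GradedAlgebra.proj_same ha) (GradedAlgebra.proj_same hb)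
    · rintro ⟨i, j⟩ ⟨i', j'⟩ hij v hv
      refine (Submodule.map₂_le.2 fun a ha b hb => ?_ : tensorGrading 𝒜 ℬ (i, j) ≤
        LinearMap.ker (TensorProduct.map (GradedAlgebra.proj 𝒜 i') (GradedAlgebra.proj ℬ j'))) hv
      rw [LinearMap.mem_ker, TensorProduct.mk_apply, TensorProduct.map_tmul]
      by_cases h : i = i'
      · rw [GradedAlgebra.proj_ne hb fun h' => hij (Prod.ext h h'), tmul_zero]
      · rw [GradedAlgebra.proj_ne ha h, zero_tmul]
    · rw [eq_top_iff, ← TensorProduct.span_tmul_eq_top, Submodule.span_le]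
      rintro _ ⟨a, b, rfl⟩
      refine GradedAlgebra.mem_of_proj_mem (ℬ := 𝒜)
        ((⨆ r, tensorGrading 𝒜 ℬ r).comap ((TensorProduct.mk k A B).flip b)) a fun i => ?_
      refine GradedAlgebra.mem_of_proj_mem (ℬ := ℬ)
        ((⨆ r, tensorGrading 𝒜 ℬ r).comap (TensorProduct.mk k A B _)) b fun j => ?_
      exact Submodule.mem_iSup_of_mem (i, j)
        (tmul_mem_tensorGrading (GradedAlgebra.proj_mem' i a) (GradedAlgebra.proj_mem' j b))

theorem IsConnectedGraded.regrade_id (h𝒜 : IsConnectedGraded 𝒜) :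
    IsConnectedGraded (_root_.regrade (AddMonoidHom.id ℤ) 𝒜) :=
  h𝒜.regrade _ (fun _ h => h) fun _ _ h => h

variable [GradedAlgebra 𝒜] [GradedAlgebra ℬ]

theorem IsConnectedGraded.aug_eq_zero (h𝒜 : IsConnectedGraded 𝒜) {f : A →ₐ[k] k}
    (hf : ∀ a, algebraMap k A (f a) = GradedAlgebra.proj 𝒜 0 a) {i : ℤ} (hi : i ≠ 0) {a : A}
    (ha : a ∈ 𝒜 i) : f a = 0 := by
  have := h𝒜.nontrivial
  refine (algebraMap k A).injective ?_
  rw [hf, GradedAlgebra.proj_ne ha hi, map_zero]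

theorem IsConnectedGraded.tensor (h𝒜 : IsConnectedGraded 𝒜) (hℬ : IsConnectedGraded ℬ) :
    IsConnectedGraded (tensorGrading 𝒜 ℬ) where
  nontrivial := by
    obtain ⟨f, -⟩ := h𝒜.exists_aug
    obtain ⟨g, -⟩ := hℬ.exists_aug
    exact (Algebra.TensorProduct.lift f g fun _ _ => Commute.all _ _).toRingHom.domain_nontrivial
  nonneg := by
    rintro ⟨i, j⟩ h
    refine ⟨h𝒜.nonneg i fun e => h ?_, hℬ.nonneg j fun e => h ?_⟩
    · rw [tensorGrading, e, Submodule.map₂_bot_left]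
    · rw [tensorGrading, e, Submodule.map₂_bot_right]
  deg_zero := by
    refine le_antisymm (Submodule.map₂_le.2 fun a ha b hb => ?_) ?_
    · rw [Prod.fst_zero, h𝒜.deg_zero] at ha
      rw [Prod.snd_zero, hℬ.deg_zero] at hb
      obtain ⟨x, rfl⟩ := ha
      obtain ⟨y, rfl⟩ := hb
      refine ⟨x * y, ?_⟩
      simp [Algebra.algebraMap_eq_smul_one, Algebra.TensorProduct.one_def, smul_tmul',
        smul_smul, mul_comm x y]
    · rintro _ ⟨x, rfl⟩
      rw [Algebra.linearMap_apply, Algebra.algebraMap_eq_smul_one]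
      exact Submodule.smul_mem _ _
        (tmul_mem_tensorGrading (SetLike.one_mem_graded 𝒜) (SetLike.one_mem_graded ℬ))

theorem totalDegree_nonneg (r : ℤ × ℤ) (hr : 0 ≤ r) : 0 ≤ totalDegree r :=
  add_nonneg hr.1 hr.2

theorem eq_zero_of_totalDegree (r : ℤ × ℤ) (hr : 0 ≤ r) (h : totalDegree r = 0) : r = 0 := by
  have h₁ : 0 ≤ r.1 := hr.1
  have h₂ : 0 ≤ r.2 := hr.2
  have h₃ : r.1 + r.2 = 0 := h
  exact Prod.ext (by simp; omega) (by simp; omega)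

theorem IsRightFinite.of_surjective {f : A →ₐ[k] B} (hf : Function.Surjective f) :
    IsRightFinite f := by
  let _ : Module Aᵐᵒᵖ B := Module.compHom B (RingHom.op (f : A →+* B))
  refine ⟨⟨{1}, eq_top_iff.2 fun b _ => ?_⟩⟩
  obtain ⟨a, rfl⟩ := hf b
  have : f a = MulOpposite.op a • (1 : B) := (one_mul (f a)).symm
  rw [this]
  exact Submodule.smul_mem _ _ (Submodule.subset_span (by simp))

/-- The identity of `A` times the augmentation of `B` is a surjection onto `A`. It respects the
total degree because the augmentation kills every nonzero degree of `B`, so base change applies. -/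
theorem EpsilonCondition.of_tensor_left (h𝒜 : IsConnectedGraded 𝒜) (hℬ : IsConnectedGraded ℬ)
    [IsNoetherianRing (A ⊗[k] B)ᵐᵒᵖ]
    (h : EpsilonCondition (_root_.regrade totalDegree (tensorGrading 𝒜 ℬ))) :
    EpsilonCondition 𝒜 := by
  have := h𝒜.nontrivial
  obtain ⟨g, hg⟩ := hℬ.exists_aug
  let f : A ⊗[k] B →ₐ[k] A := Algebra.TensorProduct.lift (AlgHom.id k A)
    ((Algebra.ofId k A).comp g) fun a b => (Algebra.commutes (g b) a).symm
  have hf : ∀ a b, f (a ⊗ₜ b) = a * algebraMap k A (g b) := fun _ _ => rfl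
  refine h.of_rightFinite (AddMonoidHom.id ℤ) ((h𝒜.tensor hℬ).regrade totalDegree
    totalDegree_nonneg eq_zero_of_totalDegree).regrade_id f (fun r => ?_)
    (IsRightFinite.of_surjective fun a => ⟨a ⊗ₜ 1, by simp [hf]⟩)
  refine regrade_le (S := (𝒜 r).comap f.toLinearMap) totalDegree ?_
  rintro ⟨i, j⟩ rfl
  refine Submodule.map₂_le.2 fun a ha b hb => ?_
  change f (a ⊗ₜ b) ∈ 𝒜 (i + j)
  rw [hf]
  by_cases hj : j = 0
  · subst hj
    rw [add_zero, ← Algebra.commutes, ← Algebra.smul_def]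
    exact Submodule.smul_mem _ _ ha
  · rw [hℬ.aug_eq_zero hg hj hb, map_zero, mul_zero]
    exact zero_mem _

theorem EpsilonCondition.of_tensor_right (h𝒜 : IsConnectedGraded 𝒜) (hℬ : IsConnectedGraded ℬ)
    [IsNoetherianRing (A ⊗[k] B)ᵐᵒᵖ]
    (h : EpsilonCondition (_root_.regrade totalDegree (tensorGrading 𝒜 ℬ))) :
    EpsilonCondition ℬ := by
  have := hℬ.nontrivial
  obtain ⟨g, hg⟩ := h𝒜.exists_aug
  let f : A ⊗[k] B →ₐ[k] B := Algebra.TensorProduct.lift ((Algebra.ofId k B).comp g)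
    (AlgHom.id k B) fun a b => Algebra.commutes (g a) b
  have hf : ∀ a b, f (a ⊗ₜ b) = algebraMap k B (g a) * b := fun _ _ => rfl
  refine h.of_rightFinite (AddMonoidHom.id ℤ) ((h𝒜.tensor hℬ).regrade totalDegree
    totalDegree_nonneg eq_zero_of_totalDegree).regrade_id f (fun r => ?_)
    (IsRightFinite.of_surjective fun b => ⟨1 ⊗ₜ b, by simp [hf]⟩)
  refine regrade_le (S := (ℬ r).comap f.toLinearMap) totalDegree ?_
  rintro ⟨i, j⟩ rfl
  refine Submodule.map₂_le.2 fun a ha b hb => ?_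
  change f (a ⊗ₜ b) ∈ ℬ (i + j)
  rw [hf]
  by_cases hi : i = 0
  · subst hi
    rw [zero_add, ← Algebra.smul_def]
    exact Submodule.smul_mem _ _ hb
  · rw [h𝒜.aug_eq_zero hg hi ha, map_zero, zero_mul]
    exact zero_mem _

/-- The `ε`-condition for tensor products. -/
theorem epsilonCondition_tensor_tfae (h𝒜 : IsConnectedGraded 𝒜) (hℬ : IsConnectedGraded ℬ)
    [IsNoetherianRing (A ⊗[k] B)ᵐᵒᵖ] :
    List.TFAE [EpsilonCondition (tensorGrading 𝒜 ℬ),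
      EpsilonCondition (_root_.regrade totalDegree (tensorGrading 𝒜 ℬ)),
      EpsilonCondition 𝒜 ∧ EpsilonCondition ℬ] := by
  tfae_have 1 → 2 := fun h => h.regrade totalDegree
  tfae_have 2 → 3 := fun h => ⟨h.of_tensor_left h𝒜 hℬ, h.of_tensor_right h𝒜 hℬ⟩
  tfae_have 3 → 1 := fun h => HasEpsilonMatrices.epsilonCondition
    (h.1.hasEpsilonMatrices.tensor h.2.hasEpsilonMatrices)
  tfae_finish

end TensorGrading

/-! ### Polynomial extensions -/

section PolyGrading

open Polynomial TensorProduct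

variable {k A : Type u} [Field k] [Ring A] [Algebra k A] {𝒜 : ℤ → Submodule k A} {e : ℤ}

theorem monomial_mem_polyGrading {i : ℤ} {a : A} (ha : a ∈ 𝒜 i) (n : ℕ) :
    monomial n a ∈ polyGrading 𝒜 e (i, n * e) :=
  Submodule.mem_iSup_of_mem n (Submodule.mem_iSup_of_mem rfl ⟨a, ha, rfl⟩)

theorem polyGrading_le {i j : ℤ} {S : Submodule k A[X]}
    (h : ∀ n : ℕ, n * e = j → ∀ a ∈ 𝒜 i, monomial n a ∈ S) : polyGrading 𝒜 e (i, j) ≤ S :=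
  iSup₂_le fun n hn => by
    rintro _ ⟨a, ha, rfl⟩
    exact h n hn a ha

/-- The grading of `A[t]` with `t` in degree `e > 0`. -/
@[reducible] def GradedAlgebra.poly (𝒜 : ℤ → Submodule k A) [GradedAlgebra 𝒜] (he : 0 < e) :
    GradedAlgebra (polyGrading 𝒜 e) := by
  have hinj : ∀ n m : ℕ, n * e = m * e → n = m := fun n m h => by
    exact_mod_cast mul_right_cancel₀ he.ne' h
  refine GradedAlgebra.ofIsInternal _ ?_ ?_ ?_
  · have := monomial_mem_polyGrading (e := e) (SetLike.one_mem_graded 𝒜) 0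
    rwa [Nat.cast_zero, zero_mul, monomial_zero_one] at this
  · rintro ⟨i, j⟩ ⟨i', j'⟩
    refine Submodule.mul_le.2 fun p hp q hq => ?_
    refine (polyGrading_le fun n hn a ha => ?_ : polyGrading 𝒜 e (i, j) ≤
      (polyGrading 𝒜 e ((i, j) + (i', j'))).comap (LinearMap.mulRight k q)) hp
    refine (polyGrading_le fun m hm b hb => ?_ : polyGrading 𝒜 e (i', j') ≤
      (polyGrading 𝒜 e ((i, j) + (i', j'))).comap (LinearMap.mulLeft k (monomial n a))) hq
    have := monomial_mem_polyGrading (e := e) (SetLike.mul_mem_graded ha hb) (n + m)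
    change monomial n a * monomial m b ∈ polyGrading 𝒜 e (i + i', j + j')
    rwa [monomial_mul_monomial, ← hn, ← hm, ← add_mul, ← Nat.cast_add]
  · classical
    let c : ℤ × ℤ → ℕ → A[X] →ₗ[k] A[X] := fun r n =>
      (monomial n : A →ₗ[A] A[X]).restrictScalars k ∘ₗ GradedAlgebra.proj 𝒜 r.1 ∘ₗ
        (lcoeff A n).restrictScalars k
    have hc : ∀ r n m (a : A), c r n (monomial m a) =
        if m = n then monomial n (GradedAlgebra.proj 𝒜 r.1 a) else 0 := fun r n m a => by
      change monomial n (GradedAlgebra.proj 𝒜 r.1 (coeff (monomial m a) n)) = _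
      rw [coeff_monomial]
      split_ifs <;> simp
    -- As `e` is nonzero, at most one exponent `n` satisfies `n e = j`. If there is none, the
    -- component is zero.
    let P : ℤ × ℤ → A[X] →ₗ[k] A[X] := fun r =>
      if h : ∃ n : ℕ, n * e = r.2 then c r h.choose else 0
    have hP : ∀ i j (m : ℕ) (a : A), P (i, j) (monomial m a) =
        if m * e = j then monomial m (GradedAlgebra.proj 𝒜 i a) else 0 := fun i j m a => by
      by_cases h : ∃ n : ℕ, n * e = j
      · have h₁ : P (i, j) = c (i, j) h.choose := dif_pos h
        rw [h₁, hc]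
        by_cases h₂ : m * e = j
        · have h₃ : m = h.choose := hinj _ _ (h₂.trans h.choose_spec.symm)
          rw [if_pos h₃, if_pos h₂, ← h₃]
        · rw [if_neg h₂, if_neg fun h₃ => h₂ (by rw [h₃, h.choose_spec])]
      · have h₁ : P (i, j) = 0 := dif_neg h
        rw [h₁, if_neg fun h₂ => h ⟨m, h₂⟩, LinearMap.zero_apply]
    refine isInternal_of_proj _ P ?_ ?_ ?_
    · rintro ⟨i, j⟩ v hv
      refine (polyGrading_le fun n hn a ha => ?_ : polyGrading 𝒜 e (i, j) ≤
        LinearMap.eqLocus (P (i, j)) LinearMap.id) hv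
      change P (i, j) (monomial n a) = monomial n a
      rw [hP, if_pos hn, GradedAlgebra.proj_same ha]
    · rintro ⟨i, j⟩ ⟨i', j'⟩ hij v hv
      refine (polyGrading_le fun n hn a ha => ?_ : polyGrading 𝒜 e (i, j) ≤
        LinearMap.ker (P (i', j'))) hv
      rw [LinearMap.mem_ker, hP]
      split_ifs with h
      · rw [GradedAlgebra.proj_ne ha fun h' => hij (Prod.ext h' (hn.symm.trans h)), map_zero]
      · rfl
    · rw [eq_top_iff]
      rintro p -
      induction p using Polynomial.induction_on' with
      | add p q hp hq => exact Submodule.add_mem _ hp hq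
      | monomial n a =>
        refine GradedAlgebra.mem_of_proj_mem (ℬ := 𝒜) ((⨆ r, polyGrading 𝒜 e r).comap
          ((monomial n : A →ₗ[A] A[X]).restrictScalars k)) a fun i => ?_
        exact Submodule.mem_iSup_of_mem _
          (monomial_mem_polyGrading (GradedAlgebra.proj_mem' i a) n)

theorem IsConnectedGraded.poly (h : IsConnectedGraded 𝒜) (he : 0 < e) :
    IsConnectedGraded (polyGrading 𝒜 e) where
  nontrivial := by
    have := h.nontrivial
    infer_instance
  nonneg := by
    rintro ⟨i, j⟩ hij
    constructor
    · refine h.nonneg i fun hi => hij (eq_bot_iff.2 (polyGrading_le fun n _ a ha => ?_))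
      rw [hi, Submodule.mem_bot] at ha
      rw [ha, map_zero]
      exact zero_mem _
    · by_contra hj
      refine hij (eq_bot_iff.2 (polyGrading_le fun n hn a ha => (hj ?_).elim))
      rw [← hn]
      positivity
  deg_zero := by
    refine le_antisymm (polyGrading_le fun n hn a ha => ?_) ?_
    · have hn₀ : n = 0 := by simpa [he.ne'] using hn
      rw [h.deg_zero] at ha
      obtain ⟨x, rfl⟩ := ha
      exact ⟨x, by rw [hn₀]; rfl⟩
    · rintro _ ⟨x, rfl⟩
      have hx : algebraMap k A x ∈ 𝒜 0 := by
        rw [h.deg_zero]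
        exact ⟨x, rfl⟩
      have := monomial_mem_polyGrading (e := e) hx 0
      rwa [Nat.cast_zero, zero_mul] at this

open Matrix in
/-- The Koszul complex of the indeterminate. -/
theorem hasEpsilonMatrices_polynomial (k : Type u) [Field k] (e : ℤ) : HasEpsilonMatrices
    (fun j : ℤ => ⨆ n : ℕ, ⨆ (_ : n * e = j), k ∙ (X ^ n : k[X])) := by
  let 𝒬 : ℤ → Submodule k k[X] := fun j => ⨆ n : ℕ, ⨆ (_ : n * e = j), k ∙ (X ^ n : k[X])
  have hmem : ∀ n : ℕ, (X ^ n : k[X]) ∈ 𝒬 (n * e) := fun n =>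
    Submodule.mem_iSup_of_mem n (Submodule.mem_iSup_of_mem rfl
      (Submodule.mem_span_singleton_self _))
  -- Multiplication by `t` from a generator of degree `e` to one of degree zero. The homology is
  -- `k[t]/(t)`, spanned by the class of `![0, 1]`.
  let K : MatComplex 𝒬 :=
    { I := Fin 2
      deg := ![e, 0]
      pos := ![0, 1]
      E := 1
      D := !![0, X; 0, 0]
      E_mem := fun a b => by
        by_cases hab : a = b
        · subst hab
          simpa using hmem 0
        · rw [Matrix.one_apply_ne hab]
          exact zero_mem _
      D_mem := fun a b => by
        fin_cases a <;> fin_cases b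
        · exact zero_mem _
        · simpa using hmem 1
        · exact zero_mem _
        · exact zero_mem _
      E_pos := fun a b h => by
        by_contra hab
        exact h (Matrix.one_apply_ne fun h' => hab (by rw [h']))
      D_pos := fun a b h => by
        fin_cases a <;> fin_cases b <;> simp_all
      EE := one_mul _
      ED := one_mul _
      DE := mul_one _
      DD := by
        ext a b
        fin_cases a <;> fin_cases b <;> simp [Matrix.mul_apply] }
  have hD : ∀ v : Fin 2 → k[X], v ᵥ* K.D = ![0, v 0 * X] := fun v => by
    funext b
    fin_cases b <;> simp [K, vecMul, dotProduct]
  have hE : ∀ v : Fin 2 → k[X], v ᵥ* K.E = v := fun v => Matrix.vecMul_one v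
  refine ⟨K, ⟨k ∙ ![0, 1], Submodule.fg_span_singleton _, fun v hv => ?_⟩, fun hle => ?_⟩
  · change Fin 2 → k[X] at v
    have h₂ : v ᵥ* K.D = 0 := (MatComplex.mem_cycles.1 hv).2
    rw [hD] at h₂
    have h₀ : v 0 = 0 := by simpa using congrFun h₂ 1
    -- Division by `t` with remainder: the quotient gives the boundary and the constant term the
    -- class.
    have e₁ : v = ![divX (v 1), 0] ᵥ* K.D + (coeff (v 1) 0) • ![0, 1] := by
      rw [hD]
      funext b
      fin_cases b
      · simpa using h₀
      · simpa [smul_eq_C_mul] using (divX_mul_X_add (v 1)).symm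
    rw [e₁]
    exact Submodule.add_mem_sup (K.vecMul_D_mem _)
      (Submodule.smul_mem _ _ (Submodule.mem_span_singleton_self _))
  · have hz : (![0, 1] : Fin 2 → k[X]) ∈ K.cycles := by
      refine MatComplex.mem_cycles.2 ⟨hE _, ?_⟩
      refine (hD _).trans ?_
      funext b
      fin_cases b <;> simp
    obtain ⟨u, hu⟩ := hle hz
    have h₁ := congrFun ((hD u).symm.trans hu) 1
    have h₂ := congrArg (eval 0) h₁
    simp at h₂

/-- Tensor with the Koszul complex of `t` over `k[t]`. The twist lemma with trivial automorphisms
transports the result along `A ⊗ k[t] ≃ A[t]`. -/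
theorem HasEpsilonMatrices.poly (h : HasEpsilonMatrices 𝒜) (e : ℤ) :
    HasEpsilonMatrices (polyGrading 𝒜 e) := by
  refine (h.tensor (hasEpsilonMatrices_polynomial k e)).of_twist
    (polyEquivTensor k A).symm.toLinearEquiv (fun _ => LinearEquiv.refl k _) ?_
    (fun _ _ _ => rfl) (fun _ _ _ h => h) (fun _ _ _ _ _ => rfl)
    (fun _ a b _ => (map_mul (polyEquivTensor k A).symm a b).symm)
  rintro ⟨i, j⟩ x hx
  refine (Submodule.map₂_le.2 fun a ha p hp => ?_ : _ ≤
    (polyGrading 𝒜 e (i, j)).comap (polyEquivTensor k A).symm.toLinearMap) hx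
  refine (iSup₂_le fun n hn => ?_ : _ ≤ ((polyGrading 𝒜 e (i, j)).comap
    (polyEquivTensor k A).symm.toLinearMap).comap (TensorProduct.mk k A k[X] a)) hp
  rw [Submodule.span_singleton_le_iff_mem]
  have hn : n * e = j := hn
  change (polyEquivTensor k A).symm (a ⊗ₜ (X ^ n)) ∈ polyGrading 𝒜 e (i, j)
  rw [polyEquivTensor_symm_apply_tmul_eq_smul, Polynomial.map_pow, map_X, ← C_mul',
    C_mul_X_pow_eq_monomial, ← hn]
  exact monomial_mem_polyGrading ha n

open MulOpposite in
/-- Descent of the `ε`-condition along `t ↦ 0`. -/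
theorem EpsilonCondition.of_poly [GradedAlgebra 𝒜] (h𝒜 : IsConnectedGraded 𝒜) (he : 0 < e)
    (h : EpsilonCondition (_root_.regrade totalDegree (polyGrading 𝒜 e))) :
    EpsilonCondition 𝒜 := by
  let _ := GradedAlgebra.poly 𝒜 he
  have := h𝒜.nontrivial
  let f : A[X] →ₐ[k] A :=
    { constantCoeff with
      commutes' := fun c => coeff_C_zero }
  have hf₀ : ∀ p, f p = coeff p 0 := fun _ => rfl
  have hf : ∀ r, ∀ p ∈ _root_.regrade totalDegree (polyGrading 𝒜 e) r, f p ∈ 𝒜 r := by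
    intro r
    refine regrade_le (S := (𝒜 r).comap f.toLinearMap) totalDegree ?_
    rintro ⟨i, j⟩ rfl
    refine polyGrading_le fun n hn a ha => ?_
    change f (monomial n a) ∈ 𝒜 (i + j)
    rw [hf₀, coeff_monomial]
    split_ifs with hn₀
    · rw [← hn, hn₀, Nat.cast_zero, zero_mul, add_zero]
      exact ha
    · exact zero_mem _
  have hsurj : Function.Surjective f := fun a => ⟨C a, coeff_C_zero⟩
  obtain ⟨Y, hY, hne⟩ := h.hasEpsilonMatrices
  refine HasEpsilonMatrices.epsilonCondition ⟨Y.map f hf, ?_, Y.not_cycles_le_map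
    (AddMonoidHom.id ℤ) ((h𝒜.poly he).regrade totalDegree totalDegree_nonneg
      eq_zero_of_totalDegree).regrade_id f hf (IsRightFinite.of_surjective hsurj) hne⟩
  let _ : Module A[X]ᵐᵒᵖ A := Module.compHom A (RingHom.op (f : A[X] →+* A))
  have hsmul : ∀ p (a : A), op p • a = a * f p := fun _ _ => rfl
  have : IsScalarTower k A[X]ᵐᵒᵖ A := ⟨fun c p a => by
    induction p with
    | h p => rw [← op_smul, hsmul, hsmul, map_smul, mul_smul_comm]⟩
  -- Multiplication by `t` and evaluation at zero form a short exact sequence of right modules `0 →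
  -- A[t] → A[t] → A → 0`. Finiteness of the homology with coefficients in `A` follows from that
  -- over `A[t]` in two adjacent positions.
  let κ : A[X]ᵐᵒᵖ →ₗ[A[X]ᵐᵒᵖ] A[X]ᵐᵒᵖ :=
    { toFun := fun p => op (unop p * X)
      map_add' := fun p q => by rw [MulOpposite.unop_add, add_mul, MulOpposite.op_add]
      map_smul' := fun a p => unop_injective (by
        change unop p * unop a * X = unop p * X * unop a
        rw [mul_assoc, ← X_mul, ← mul_assoc]) }
  let π : A[X]ᵐᵒᵖ →ₗ[A[X]ᵐᵒᵖ] A :=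
    { toFun := fun p => f (unop p)
      map_add' := fun p q => by rw [MulOpposite.unop_add, map_add]
      map_smul' := fun a p => map_mul f (unop p) (unop a) }
  refine Y.hasFiniteHomology_map f hf hsmul fun n =>
    MatComplex.FiniteAt.of_exact κ π ?_ ?_ ?_ (hY.finiteAt_op n) (hY.finiteAt_op (n + 1))
  · intro p q hpq
    exact unop_injective (isRegular_X.right (op_injective hpq))
  · exact fun a => (hsurj a).imp' op fun _ h => h
  · intro p
    constructor
    · intro hp
      have hp : coeff (unop p) 0 = 0 := hp
      refine ⟨op (divX (unop p)), unop_injective ?_⟩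
      have := divX_mul_X_add (unop p)
      rwa [hp, C_0, add_zero] at this
    · rintro ⟨q, rfl⟩
      exact coeff_mul_X_zero _

theorem epsilonCondition_poly_iff [GradedAlgebra 𝒜] (h𝒜 : IsConnectedGraded 𝒜) (he : 0 < e) :
    (EpsilonCondition 𝒜 ↔ EpsilonCondition (polyGrading 𝒜 e)) ∧
      (EpsilonCondition 𝒜 ↔ EpsilonCondition (_root_.regrade totalDegree (polyGrading 𝒜 e))) := by
  let _ := GradedAlgebra.poly 𝒜 he
  have h₁ : EpsilonCondition 𝒜 → EpsilonCondition (polyGrading 𝒜 e) := fun h =>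
    HasEpsilonMatrices.epsilonCondition (h.hasEpsilonMatrices.poly e)
  have h₂ : EpsilonCondition (polyGrading 𝒜 e) →
      EpsilonCondition (_root_.regrade totalDegree (polyGrading 𝒜 e)) := fun h =>
    h.regrade totalDegree
  exact ⟨⟨h₁, fun h => (h₂ h).of_poly h𝒜 he⟩, ⟨fun h => h₂ (h₁ h), fun h => h.of_poly h𝒜 he⟩⟩

end PolyGrading

/-! ### Affine connected commutative algebras -/

section Commutative

/-- The algebra is its own center, hence generated by `1` over it, and its degree-zero part is `k`,
so the Koszul construction applies. -/
theorem IsConnectedGraded.epsilonCondition_of_finiteType {k A : Type u} {ι : Type} [Field k]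
    [CommRing A] [Algebra k A] [AddCommGroup ι] [DecidableEq ι] [PartialOrder ι]
    [IsOrderedAddMonoid ι] {𝒜 : ι → Submodule k A} [GradedAlgebra 𝒜] (h𝒜 : IsConnectedGraded 𝒜)
    [Algebra.FiniteType k A] : EpsilonCondition 𝒜 := by
  have := h𝒜.nontrivial
  have hC : Subalgebra.center k A = ⊤ := Subalgebra.center_eq_top k A
  have : Algebra.FiniteType k (Subalgebra.center k A) := by
    rw [hC]
    exact Algebra.FiniteType.equiv ‹_› Subalgebra.topEquiv.symm
  have : Module.Finite (Subalgebra.center k A) A := by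
    refine ⟨⟨{1}, eq_top_iff.2 fun a _ => ?_⟩⟩
    have ha : a ∈ Subalgebra.center k A := hC ▸ Algebra.mem_top
    have : a = (⟨a, ha⟩ : Subalgebra.center k A) • (1 : A) := (mul_one a).symm
    rw [this]
    exact Submodule.smul_mem _ _ (Submodule.subset_span (by simp))
  refine (hasEpsilonMatrices_of_finite_center h𝒜.nonneg ?_).epsilonCondition
  rw [h𝒜.deg_zero]
  infer_instance

end Commutative

end

theorem lemma5p2 (k : Type u) [Field k] :
    -- (1) noetherian algebras of finite global dimension, and AS regular algebras
    ((∀ (w : ℕ) (A : Type u) [Ring A] [Algebra k A] (𝒜 : (Fin w → ℤ) → Submodule k A)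
        [GradedAlgebra 𝒜], IsTwoSidedNoetherian A → HasFiniteGlobalDimension A →
        (∃ M : GrMod 𝒜, Nontrivial M.carrier ∧ FiniteDimensional k M.carrier) →
        EpsilonCondition 𝒜) ∧
      (∀ (A : Type u) [Ring A] [Algebra k A] (𝒜 : ℤ → Submodule k A) [GradedAlgebra 𝒜],
        IsTwoSidedNoetherian A → IsASRegular 𝒜 → EpsilonCondition 𝒜)) ∧
    -- (2) regrading
    (∀ (w n : ℕ) (φ : (Fin w → ℤ) →+ (Fin n → ℤ)) (A : Type u) [Ring A] [Algebra k A]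
      (𝒜 : (Fin w → ℤ) → Submodule k A) [GradedAlgebra 𝒜],
      Nonempty (GradedAlgebra (regrade φ 𝒜)) ∧
        (EpsilonCondition 𝒜 → EpsilonCondition (regrade φ 𝒜))) ∧
    -- (3) finite extensions, and affine connected graded commutative algebras
    ((∀ (w : ℕ), 0 < w → ∀ (A B : Type u) [Ring A] [Algebra k A] [Ring B] [Algebra k B]
        (𝒜 : (Fin w → ℤ) → Submodule k A) [GradedAlgebra 𝒜]
        (ℬ : (Fin w → ℤ) → Submodule k B) [GradedAlgebra ℬ],
        IsConnectedGraded 𝒜 → IsNoetherianRing Aᵐᵒᵖ → EpsilonCondition 𝒜 → Nontrivial B →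
        ∀ f : A →ₐ[k] B, (∀ r, ∀ a ∈ 𝒜 r, f a ∈ ℬ r) → IsRightFinite f →
        EpsilonCondition ℬ) ∧
      (∀ (w : ℕ) (A : Type u) [CommRing A] [Algebra k A] (𝒜 : (Fin w → ℤ) → Submodule k A)
        [GradedAlgebra 𝒜], IsConnectedGraded 𝒜 → Algebra.FiniteType k A →
        EpsilonCondition 𝒜)) ∧
    -- (4) algebras finite over their affine center
    (∀ (B : Type u) [Ring B] [Algebra k B] (ℬ : ℤ → Submodule k B) [GradedAlgebra ℬ],
      Nontrivial B → IsNonnegGraded ℬ → IsLocallyFinite ℬ →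
      Algebra.FiniteType k (Subalgebra.center k B) → Module.Finite (Subalgebra.center k B) B →
      EpsilonCondition ℬ) ∧
    -- (5) tensor products and polynomial extensions
    ((∀ (A B : Type u) [Ring A] [Algebra k A] [Ring B] [Algebra k B]
        (𝒜 : ℤ → Submodule k A) [GradedAlgebra 𝒜] (ℬ : ℤ → Submodule k B) [GradedAlgebra ℬ],
        IsConnectedGraded 𝒜 → IsConnectedGraded ℬ → IsTwoSidedNoetherian (A ⊗[k] B) →
        List.TFAE
          [EpsilonCondition (tensorGrading 𝒜 ℬ),
            EpsilonCondition (regrade totalDegree (tensorGrading 𝒜 ℬ)),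
            EpsilonCondition 𝒜 ∧ EpsilonCondition ℬ]) ∧
      (∀ (A : Type u) [Ring A] [Algebra k A] (𝒜 : ℤ → Submodule k A) [GradedAlgebra 𝒜],
        IsConnectedGraded 𝒜 → IsTwoSidedNoetherian A → ∀ e : ℤ, 0 < e →
        (EpsilonCondition 𝒜 ↔ EpsilonCondition (polyGrading 𝒜 e)) ∧
        (EpsilonCondition 𝒜 ↔ EpsilonCondition (regrade totalDegree (polyGrading 𝒜 e))))) ∧
    -- (6) graded twists
    (∀ (w : ℕ) (A : Type u) [Ring A] [Algebra k A] (𝒜 : (Fin w → ℤ) → Submodule k A)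
      [GradedAlgebra 𝒜] (T : TwistData 𝒜),
      EpsilonCondition 𝒜 ↔ EpsilonCondition T.twistGrading) := by
  refine ⟨⟨?_, ?_⟩, ?_, ⟨?_, ?_⟩, ?_, ⟨?_, ?_⟩, ?_⟩
  · rintro w A _ _ 𝒜 _ ⟨_, -⟩ hdim ⟨M, _, _⟩
    exact epsilonCondition_of_hasFiniteGlobalDimension hdim M
  · rintro A _ _ 𝒜 _ ⟨_, -⟩ h
    exact h.epsilonCondition
  · intro w n φ A _ _ 𝒜 _
    exact ⟨⟨GradedAlgebra.regrade φ 𝒜⟩, fun h => h.regrade φ⟩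
  · intro w _ A B _ _ _ _ 𝒜 _ ℬ _ h𝒜 _ h _ f hf hfin
    -- The sum of the coordinates vanishes on a nonnegative degree only if that degree is zero, so
    -- it keeps the algebra connected.
    exact h.of_rightFinite (∑ i, Pi.evalAddMonoidHom (fun _ : Fin w => ℤ) i)
      (h𝒜.regrade _ (fun r hr => by simpa using Finset.sum_nonneg fun i _ => hr i)
        fun r hr h₀ => funext fun i => (Finset.sum_eq_zero_iff_of_nonneg fun i _ => hr i).1
          (by simpa using h₀) i (Finset.mem_univ i)) f hf hfin
  · intro w A _ _ 𝒜 _ h𝒜 _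
    exact h𝒜.epsilonCondition_of_finiteType
  · intro B _ _ ℬ _ _ hnn hfin _ _
    exact (hasEpsilonMatrices_of_finite_center hnn (hfin 0)).epsilonCondition
  · rintro A B _ _ _ _ 𝒜 _ ℬ _ h𝒜 hℬ ⟨-, _⟩
    exact epsilonCondition_tensor_tfae h𝒜 hℬ
  · intro A _ _ 𝒜 _ h𝒜 _ e he
    exact epsilonCondition_poly_iff h𝒜 he
  · intro w A _ _ 𝒜 _ T
    exact T.epsilonCondition_iff
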